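/- Let $a>0$, $T>0$, let $f\in C^2(\mathbb R;\mathbb R)$ be strictly convex, and let $\mathcal L=\{(u,w)\in\mathbb R^2:\ |u-w|\le a\}$. Let $u_0,w_0\in L^1(\mathbb R)\cap BV(\mathbb R)$ with $(u_0(x),w_0(x))\in\mathcal L$ for a.e. $x$. For the Cauchy problem $$\partial_t u+\partial_t w+\partial_x f(u)=0,\quad w=[\mathcal F(u,w_0)]\ \text{ in }\mathbb R\times[0,T[,\qquad u(\cdot,0)=u_0,\quad w(\cdot,0)=w_0,$$ where $\mathcal F$ is the Play hysteresis operator of amplitude $a$, an entropy weak solution is a couple $u,w\in C^0([0,T[;L^1_{loc}(\mathbb R))$ with $f(u)\in L^1_{loc}(\mathbb R\times[0,T[)$ such that (i) for every nonnegative $\phi\in C^1_c(\mathbb R\times[0,T[)$ and every $(k,\hat k)\in\mathcal L$, $$\int_0^T\!\!\int_{\mathbb R}\Big[(|u-k|+|w-\hat k|)\,\partial_t\phi+\operatorname{sign}(u-k)(f(u)-f(k))\,\partial_x\phi\Big]dx\,dt+\int_{\mathbb R}(|u_0(x)-k|+|w_0(x)-\hat k|)\,\phi(x,0)\,dx\ \ge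 0;$$ (ii) $|u(x,t)-w(x,t)|\le a$ for a.e. $(x,t)\in\mathbb R\times[0,T[$; (iii) $u(\cdot,t),w(\cdot,t)\in L^2(\mathbb R)$ for a.e. $t\in\,]0,T[$, the distributional derivative $\partial_t w$ is a measure, and for a.e. $t\in\,]0,T[$ $$\frac12\int_{\mathbb R}\big(u(x,t)^2-u_0(x)^2\big)dx+\frac12\int_{\mathbb R}\big(w(x,t)^2-w_0(x)^2\big)dx\le -a\,|\partial_t w|(\mathbb R\times]0,t[).$$ Let $(u_0^1,w_0^1)$ and $(u_0^2,w_0^2)$ be two pairs of initial data as above, and let $(u_1,w_1)$, $(u_2,w_2)$ be entropy weak solutions of the corresponding Cauchy problems (with the same $a$, $T$, $f$). Then for a.e. $t\in[0,T[$ the function $|u_1-u_2|(\cdot,t)+|w_1-w_2|(\cdot,t)$ is integrable on $\mathbb R$ and $$\int_{\mathbb R}\big(|u_1-u_2|(x,t)+|w_1-w_2|(x,t)\big)dx\ \le\ \int_{\mathbb R}\big(|u_0^1-u_0^2|(x)+|w_0^1-w_0^2|(x)\big)dx .$$ In particular the entropy weak solution is unique: if $u_0^1=u_0^2$ and $w_0^1=w_0^2$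 a.e., then for every $t\in[0,T[$, $u_1(\cdot,t)=u_2(\cdot,t)$ and $w_1(\cdot,t)=w_2(\cdot,t)$ a.e. in $\mathbb R$. -/

import Mathlib

open MeasureTheory Set Filter Topology

noncomputable section

namespace PlayHysteresis

/-- The closed strip `𝓛 = {(u, w) : |u - w| ≤ a}` of feasible states of the play operator. -/
def strip (a : ℝ) : Set (ℝ × ℝ) := {p | |p.1 - p.2| ≤ a}

/-- `g ∈ L¹(ℝ) ∩ BV(ℝ)`: `g` is integrable and agrees almost everywhere with a function of
bounded variation on the line. -/
def MemL1BV (g : ℝ → ℝ) : Prop :=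
  Integrable g ∧ ∃ h : ℝ → ℝ, h =ᵐ[volume] g ∧ BoundedVariationOn h univ

/-- `v = v(x, t)` belongs to `C⁰([0,T[; L¹_loc(ℝ))`. The joint measurability only says that the
slices `v(·, t)`, which are defined up to null sets, are chosen in a jointly measurable way. -/
structure IsContL1loc (T : ℝ) (v : ℝ → ℝ → ℝ) : Prop where
  aestronglyMeasurable : AEStronglyMeasurable (fun p : ℝ × ℝ => v p.1 p.2)
    (volume.restrict (univ ×ˢ Ico 0 T))
  locallyIntegrable : ∀ t ∈ Ico 0 T, LocallyIntegrable (fun x => v x t)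
  continuous : ∀ t ∈ Ico 0 T, ∀ R : ℝ,
    Tendsto (fun s => ∫ x in Icc (-R) R, |v x s - v x t|) (𝓝[Ico 0 T] t) (𝓝 0)

/-- The nonnegative test functions in `C¹_c(ℝ × [0,T[)`, points being written `(x, t)`. They are
the restrictions to `ℝ × [0,T[` of compactly supported `C¹` functions on `ℝ × ]-∞,T[`; values on
`t = 0` are allowed to be nonzero. -/
structure IsTestFunction (T : ℝ) (φ : ℝ × ℝ → ℝ) : Prop where
  contDiff : ContDiff ℝ 1 φ
  hasCompactSupport : HasCompactSupport φ
  tsupport_subset : tsupport φ ⊆ univ ×ˢ Iio T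
  nonneg : ∀ x t : ℝ, 0 ≤ t → 0 ≤ φ (x, t)

/-- The partial derivative in the space variable. -/
def dx (φ : ℝ × ℝ → ℝ) (p : ℝ × ℝ) : ℝ := fderiv ℝ φ p (1, 0)

/-- The partial derivative in the time variable. -/
def dt (φ : ℝ × ℝ → ℝ) (p : ℝ × ℝ) : ℝ := fderiv ℝ φ p (0, 1)

/-- The integral of `ψ` against a signed measure. -/
def signedIntegral (μ : SignedMeasure (ℝ × ℝ)) (ψ : ℝ × ℝ → ℝ) : ℝ :=
  (∫ p, ψ p ∂μ.toJordanDecomposition.posPart) - ∫ p, ψ p ∂μ.toJordanDecomposition.negPart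

/-- On `ℝ × ]0,T[`, the distributional derivative `∂ₜ w` is the signed measure `μ`. (What `μ` does
outside of `ℝ × ]0,T[` is irrelevant.) -/
def IsDistribTimeDeriv (T : ℝ) (w : ℝ → ℝ → ℝ) (μ : SignedMeasure (ℝ × ℝ)) : Prop :=
  ∀ ψ : ℝ × ℝ → ℝ, ContDiff ℝ 1 ψ → HasCompactSupport ψ → tsupport ψ ⊆ univ ×ˢ Ioo 0 T →
    ∫ p in univ ×ˢ Ioo 0 T, w p.1 p.2 * dt ψ p = - signedIntegral μ ψ

/-- The weak hysteresis relation: `u(·, t)` and `w(·, t)` are in `L²(ℝ)` for almost every `t`,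
`∂ₜ w` is a measure, and the energy inequality with the dissipation `a |∂ₜ w|` holds for almost
every `t`. For `a > 0` the inequality itself bounds `|∂ₜ w|(ℝ × ]0,T[)`, so that it is no
restriction to ask for a finite measure. -/
def WeakHysteresis (a T : ℝ) (u₀ w₀ : ℝ → ℝ) (u w : ℝ → ℝ → ℝ) : Prop :=
  (∀ᵐ t ∂(volume.restrict (Ioo 0 T)),
    MemLp (fun x => u x t) 2 ∧ MemLp (fun x => w x t) 2) ∧
  ∃ μ : SignedMeasure (ℝ × ℝ), IsDistribTimeDeriv T w μ ∧
    ∀ᵐ t ∂(volume.restrict (Ioo 0 T)),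
      1 / 2 * ((∫ x, u x t ^ 2) - ∫ x, u₀ x ^ 2) + 1 / 2 * ((∫ x, w x t ^ 2) - ∫ x, w₀ x ^ 2)
        ≤ - a * (μ.totalVariation (univ ×ˢ Ioo 0 t)).toReal

/-- Entropy weak solutions `(u, w)`, `u = u(x, t)` and `w = w(x, t)`, on `ℝ × [0,T[` of
`∂ₜ u + ∂ₜ w + ∂ₓ f(u) = 0`, `w = 𝓕(u, w₀)`, `u(·, 0) = u₀`, `w(·, 0) = w₀`, where `𝓕` is the
play operator of amplitude `a`. Local integrability of `f(u)` is what makes the integrals in the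
entropy inequality meaningful. -/
structure IsEntropyWeakSolution (a T : ℝ) (f : ℝ → ℝ) (u₀ w₀ : ℝ → ℝ) (u w : ℝ → ℝ → ℝ) :
    Prop where
  cont_u : IsContL1loc T u
  cont_w : IsContL1loc T w
  flux_locallyIntegrable :
    LocallyIntegrableOn (fun p : ℝ × ℝ => f (u p.1 p.2)) (univ ×ˢ Ico 0 T)
  entropy : ∀ φ : ℝ × ℝ → ℝ, IsTestFunction T φ → ∀ k k' : ℝ, (k, k') ∈ strip a →
    0 ≤ (∫ p in univ ×ˢ Ioo 0 T,
          ((|u p.1 p.2 - k| + |w p.1 p.2 - k'|) * dt φ p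
            + Real.sign (u p.1 p.2 - k) * (f (u p.1 p.2) - f k) * dx φ p))
        + ∫ x, (|u₀ x - k| + |w₀ x - k'|) * φ (x, 0)
  feasible : ∀ᵐ p : ℝ × ℝ ∂(volume.restrict (univ ×ˢ Ico 0 T)), (u p.1 p.2, w p.1 p.2) ∈ strip a
  hysteresis : WeakHysteresis a T u₀ w₀ u w

end PlayHysteresis

end

/-! Feasibility makes `(u₂(Y), w₂(Y))` an admissible pair of constants in the entropy inequality for
`(u₁, w₁)`, and conversely. Kruzhkov's doubling of variables therefore gives the Kato inequality
`∂ₜ(|u₁ - u₂| + |w₁ - w₂|) + ∂ₓ(sign(u₁ - u₂)(f(u₁) - f(u₂))) ≤ 0` in weak form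
(`StripSolution.kato`). Tested with a wide spatial cutoff `ψ`, it yields the contraction as soon as
`∬ |f(u₁) - f(u₂)| |ψ'|` tends to zero. This is the real difficulty: there is no `L^∞` bound, `f`
may grow arbitrarily fast, and all that is known is that `f(u)` is locally integrable and that the
energy inequality bounds `u(·, t)` and `w(·, t)` in `L²` uniformly in time.

The boxes have half-width `N²` and the cutoffs satisfy `|ψ'| ≲ N⁻²`, so it suffices that `∬ |f(u) -
f(0)| = O(N)` on such a box (`flux_tail`). This is reached in two stages.

Stage one is a crude bound `O(N³)` (`growth`). Letting the thresholds go to infinity in the entropy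
inequalities gives the balance law (`weak`). It is tested with a function whose derivative is a wide
average minus a concentrated one, which compares the flux at scale `N²` with the flux near the
origin. Convexity bounds `f` below by a quadratic, so this one-sided information controls `|f(u)|`.

Stage two is a bilinear estimate in the spirit of compensated compactness (`interaction`). For
subsolution pairs `(D, E)` and `(A, B)`, doubling `D(x) A(y)` against a smoothed indicator of `x <
y` or of `x > y` controls the diagonal quantity `E A - D B`, up to lateral terms that pair a flux
with `|ψ'|`. It is applied to half entropies `(u - k)⁺ + (w - k - a)⁺`. If the threshold of `(D, E)`
exceeds the two lower ones by more than `2a`, then wherever `D` and `E` do not vanish the two lower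
pairs differ by constants (`halfEnt_commutator`). The diagonal quantity is then twice the flux above
the high threshold minus a multiple of an entropy bounded by the energy. The lateral terms are
`O(N³) · O(N⁻²) = O(N)` by stage one, hence so is the tail of the flux. The part of the flux below
`-k` is treated by the reflection `σ = -1`.

Finally, the entropy inequality up to `t = 0` shows that the continuous representatives attain the
initial data (`initial`), and `N → ∞` gives the contraction for every `t`; uniqueness follows. -/

namespace PlayHysteresis

/-! ### Mollifiers -/

/-- A sequence of bump functions shrinking to the origin of the line. -/
noncomputable def bump (n : ℕ) : ContDiffBump (0 : ℝ) where
  -- The ratio of the radii is `2` for every `n`; the almost everywhere convergence of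
  -- mollifications used in `ae_nonpos_of_integral_mul_cutoff` needs such a uniform ratio.
  rIn := 1 / (2 * (n + 1))
  rOut := 1 / (n + 1)
  rIn_pos := by positivity
  rIn_lt_rOut := by
    apply one_div_lt_one_div_of_lt <;> [positivity; nlinarith [(Nat.cast_nonneg n : (0:ℝ) ≤ n)]]

/-- The radius of the `n`-th mollifier. -/
noncomputable def rad (n : ℕ) : ℝ := 1 / (n + 1)

/-- The standard mollifier of radius `rad n`. -/
noncomputable def rho (n : ℕ) : ℝ → ℝ := (bump n).normed volume

/-- A smooth approximation of the Heaviside function, with derivative `rho n`. -/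
noncomputable def heav (n : ℕ) (z : ℝ) : ℝ := ∫ s in Iic z, rho n s

theorem rad_pos (n : ℕ) : 0 < rad n := by unfold rad; positivity

theorem rad_le_one (n : ℕ) : rad n ≤ 1 := by
  unfold rad; rw [div_le_one (by positivity)]; linarith [(Nat.cast_nonneg n : (0:ℝ) ≤ n)]

theorem tendsto_rad : Tendsto rad atTop (𝓝 0) := tendsto_one_div_add_atTop_nhds_zero_nat

theorem rho_nonneg (n : ℕ) (x : ℝ) : 0 ≤ rho n x := (bump n).nonneg_normed x

theorem rho_contDiff (n : ℕ) : ContDiff ℝ 1 (rho n) := (bump n).contDiff_normed (n := 1)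

theorem rho_continuous (n : ℕ) : Continuous (rho n) := (rho_contDiff n).continuous

theorem rho_neg (n : ℕ) (x : ℝ) : rho n (-x) = rho n x := (bump n).normed_neg x

theorem rho_sub_comm (n : ℕ) (x y : ℝ) : rho n (x - y) = rho n (y - x) := by
  rw [← rho_neg, neg_sub]

theorem rho_integral (n : ℕ) : ∫ x, rho n x = 1 := (bump n).integral_normed

theorem rho_integrable (n : ℕ) : Integrable (rho n) := (bump n).integrable_normed

theorem rho_hasCompactSupport (n : ℕ) : HasCompactSupport (rho n) :=
  (bump n).hasCompactSupport_normed

theorem rho_eq_zero {n : ℕ} {x : ℝ} (h : rad n ≤ |x|) : rho n x = 0 := by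
  have : x ∉ Function.support (rho n) := by
    rw [rho, (bump n).support_normed_eq]
    simpa [bump, rad] using h
  simpa using this

theorem rho_bounded (n : ℕ) : ∃ C, ∀ x, ‖rho n x‖ ≤ C :=
  (rho_hasCompactSupport n).exists_bound_of_continuous (rho_continuous n)

theorem heav_hasDerivAt (n : ℕ) (z : ℝ) : HasDerivAt (heav n) (rho n z) z := by
  have h : heav n = fun z => heav n 0 + ∫ s in (0:ℝ)..z, rho n s := by
    funext z
    rw [← intervalIntegral.integral_Iic_sub_Iic (rho_integrable n).integrableOn
      (rho_integrable n).integrableOn]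
    simp [heav]
  rw [h]
  exact ((rho_continuous n).integral_hasStrictDerivAt 0 z).hasDerivAt.const_add _

theorem heav_contDiff (n : ℕ) : ContDiff ℝ 1 (heav n) := by
  rw [contDiff_one_iff_deriv]
  refine ⟨fun z => (heav_hasDerivAt n z).differentiableAt, ?_⟩
  have : deriv (heav n) = rho n := funext fun z => (heav_hasDerivAt n z).deriv
  rw [this]; exact rho_continuous n

theorem heav_nonneg (n : ℕ) (z : ℝ) : 0 ≤ heav n z :=
  setIntegral_nonneg measurableSet_Iic fun x _ => rho_nonneg n x

theorem heav_le_one (n : ℕ) (z : ℝ) : heav n z ≤ 1 := by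
  rw [← rho_integral n]
  exact setIntegral_le_integral (rho_integrable n) (Eventually.of_forall (rho_nonneg n))

theorem heav_eq_zero {n : ℕ} {z : ℝ} (h : z ≤ -rad n) : heav n z = 0 := by
  refine setIntegral_eq_zero_of_forall_eq_zero fun x hx => rho_eq_zero ?_
  have : x ≤ z := hx
  rw [abs_of_nonpos (by linarith [rad_pos n])]; linarith

theorem heav_eq_one {n : ℕ} {z : ℝ} (h : rad n ≤ z) : heav n z = 1 := by
  rw [← rho_integral n]
  refine setIntegral_eq_integral_of_forall_compl_eq_zero fun x hx => rho_eq_zero ?_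
  have : z < x := not_le.1 hx
  rw [abs_of_nonneg (by linarith [rad_pos n])]; linarith

/-- The product mollifier on the plane. -/
noncomputable def kap (n : ℕ) (p : ℝ × ℝ) : ℝ := rho n p.1 * rho n p.2

theorem kap_nonneg (n : ℕ) (p : ℝ × ℝ) : 0 ≤ kap n p :=
  mul_nonneg (rho_nonneg _ _) (rho_nonneg _ _)

theorem kap_continuous (n : ℕ) : Continuous (kap n) :=
  ((rho_continuous n).comp continuous_fst).mul ((rho_continuous n).comp continuous_snd)

theorem kap_bounded (n : ℕ) : ∃ C, ∀ p, ‖kap n p‖ ≤ C := by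
  obtain ⟨C, hC⟩ := rho_bounded n
  refine ⟨C * C, fun p => ?_⟩
  rw [kap, norm_mul]
  exact mul_le_mul (hC _) (hC _) (norm_nonneg _) ((norm_nonneg _).trans (hC 0))

theorem kap_integrable (n : ℕ) : Integrable (kap n) :=
  (rho_integrable n).mul_prod (rho_integrable n)

theorem kap_integral (n : ℕ) : ∫ p, kap n p = 1 := by
  have : ∫ p, kap n p = (∫ x, rho n x) * ∫ x, rho n x := integral_prod_mul (rho n) (rho n)
  rw [this, rho_integral]; norm_num

theorem kap_eq_zero {n : ℕ} {p : ℝ × ℝ} (h : rad n ≤ ‖p‖) : kap n p = 0 := by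
  rw [Prod.norm_def] at h
  rcases le_max_iff.1 h with h | h
  · rw [kap, rho_eq_zero h, zero_mul]
  · rw [kap, rho_eq_zero h, mul_zero]

/-! ### Translation continuity and mollification -/

theorem tendsto_integral_abs_sub_translate_of_continuous {g : ℝ × ℝ → ℝ} (hg : Continuous g)
    (hc : HasCompactSupport g) :
    Tendsto (fun z => ∫ x, |g x - g (x - z)|) (𝓝 0) (𝓝 0) := by
  obtain ⟨r, hr⟩ := hc.isCompact.isBounded.subset_closedBall (0 : ℝ × ℝ)
  -- The ball of radius `r + 1` contains the support of every translate of `g` by less than `1`, so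
  -- near `z = 0` the integral runs over a fixed compact set.
  have hcont : Continuous fun z => ∫ x in Metric.closedBall (0 : ℝ × ℝ) (r + 1),
      |g x - g (x - z)| := by
    apply continuous_parametric_integral_of_continuous (f := fun z x => |g x - g (x - z)|)
    · fun_prop
    · exact isCompact_closedBall _ _
  have h0 := hcont.tendsto 0
  simp only [sub_zero, sub_self, abs_zero, integral_zero] at h0
  refine h0.congr' ?_
  filter_upwards [Metric.ball_mem_nhds (0 : ℝ × ℝ) one_pos] with z hz
  refine setIntegral_eq_integral_of_forall_compl_eq_zero fun x hx => ?_
  have hz' : ‖z‖ < 1 := by simpa using hz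
  have hx' : r + 1 < ‖x‖ := by simpa using hx
  have e1 : g x = 0 := by
    by_contra h
    have := hr (subset_tsupport g h)
    simp at this; linarith
  have e2 : g (x - z) = 0 := by
    by_contra h
    have := hr (subset_tsupport g h)
    simp only [mem_closedBall_zero_iff] at this
    have := norm_sub_norm_le x z
    linarith
  simp [e1, e2]

/-- Density of compactly supported continuous functions in `L¹`: translation is an isometry, so the
approximation error is paid twice, once for `v` and once for its translate. -/
theorem tendsto_integral_abs_sub_translate {v : ℝ × ℝ → ℝ} (hv : Integrable v) :
    Tendsto (fun z => ∫ x, |v x - v (x - z)|) (𝓝 0) (𝓝 0) := by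
  rw [Metric.tendsto_nhds]
  intro ε hε
  obtain ⟨g, hgc, hgε, hg, hgi⟩ := hv.exists_hasCompactSupport_integral_sub_le
    (show 0 < ε / 3 by positivity)
  have hlim := tendsto_integral_abs_sub_translate_of_continuous hg hgc
  rw [Metric.tendsto_nhds] at hlim
  filter_upwards [hlim (ε / 3) (by positivity)] with z hz
  have hnn : 0 ≤ ∫ x, |v x - v (x - z)| := integral_nonneg fun _ => abs_nonneg _
  have hnn' : 0 ≤ ∫ x, |g x - g (x - z)| := integral_nonneg fun _ => abs_nonneg _
  rw [Real.dist_eq, sub_zero, abs_of_nonneg hnn'] at hz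
  rw [Real.dist_eq, sub_zero, abs_of_nonneg hnn]
  have i1 : Integrable fun x => |v x - g x| := (hv.sub hgi).abs
  have i2 : Integrable fun x => |g x - g (x - z)| := (hgi.sub (hgi.comp_sub_right z)).abs
  have i3 : Integrable fun x => |v (x - z) - g (x - z)| := i1.comp_sub_right z
  have e3 : ∫ x, |v (x - z) - g (x - z)| = ∫ x, |v x - g x| :=
    integral_sub_right_eq_self (fun x => |v x - g x|) z
  have hle : ∫ x, |v x - v (x - z)| ≤
      ∫ x, (|v x - g x| + |g x - g (x - z)| + |v (x - z) - g (x - z)|) := by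
    refine integral_mono (hv.sub (hv.comp_sub_right z)).abs ((i1.add i2).add i3) fun x => ?_
    have := abs_add_three (v x - g x) (g x - g (x - z)) (-(v (x - z) - g (x - z)))
    rw [abs_neg] at this
    simp only
    refine le_trans (le_of_eq ?_) this
    congr 1; ring
  have hsum : ∫ x, (|v x - g x| + |g x - g (x - z)| + |v (x - z) - g (x - z)|) =
      (∫ x, |v x - g x|) + (∫ x, |g x - g (x - z)|) + ∫ x, |v x - g x| := by
    rw [← integral_add i1 i2, ← e3]
    exact integral_add (i1.add i2) i3
  rw [hsum] at hle
  simp only [Real.norm_eq_abs] at hgε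
  linarith

theorem kap_sub_comm (n : ℕ) (p q : ℝ × ℝ) : kap n (p - q) = kap n (q - p) := by
  simp only [kap, Prod.fst_sub, Prod.snd_sub]
  rw [rho_sub_comm, rho_sub_comm n p.2]

/-- After a measure preserving shear, each of `V(x) κ(x - y)` and `V(y) κ(x - y)` is a tensor
product of integrable functions. -/
theorem integrable_abs_sub_mul_kap {V : ℝ × ℝ → ℝ} (hV : Integrable V) (n : ℕ) :
    Integrable (fun q : (ℝ × ℝ) × (ℝ × ℝ) => |V q.1 - V q.2| * kap n (q.1 - q.2))
      (volume.prod volume) := by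
  have j1 : Integrable (fun q : (ℝ × ℝ) × (ℝ × ℝ) => V q.1 * kap n (q.1 - q.2))
      (volume.prod volume) := by
    have := (measurePreserving_prod_sub (volume : Measure (ℝ × ℝ))
      (volume : Measure (ℝ × ℝ))).integrable_comp_of_integrable (hV.mul_prod (kap_integrable n))
    refine this.congr (Eventually.of_forall fun q => ?_)
    simp only [Function.comp_apply]
    rw [kap_sub_comm]
  have j2 : Integrable (fun q : (ℝ × ℝ) × (ℝ × ℝ) => V q.2 * kap n (q.1 - q.2))
      (volume.prod volume) := by
    have := (measurePreserving_sub_prod (volume : Measure (ℝ × ℝ))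
      (volume : Measure (ℝ × ℝ))).integrable_comp_of_integrable ((kap_integrable n).mul_prod hV)
    refine this.congr (Eventually.of_forall fun q => ?_)
    simp only [Function.comp_apply]
    rw [mul_comm]
  refine (j1.sub j2).abs.congr (Eventually.of_forall fun q => ?_)
  simp only [Pi.sub_apply]
  rw [← sub_mul, abs_mul, abs_of_nonneg (kap_nonneg _ _)]

variable {s : Set (ℝ × ℝ)}

/-- Mollification of the `L¹` modulus of continuity. -/
theorem tendsto_mollify_abs_sub {v : ℝ × ℝ → ℝ} (hs : MeasurableSet s)
    (hv : IntegrableOn v s) :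
    Tendsto (fun n => ∫ q, |v q.1 - v q.2| * kap n (q.1 - q.2)
      ∂((volume.restrict s).prod (volume.restrict s))) atTop (𝓝 0) := by
  set V := s.indicator v with hV
  have hVi : Integrable V := (integrable_indicator_iff hs).2 hv
  have hN := tendsto_integral_abs_sub_translate hVi
  rw [Metric.tendsto_nhds] at hN
  rw [Metric.tendsto_nhds]
  intro ε hε
  obtain ⟨r, hr, hball⟩ := Metric.eventually_nhds_iff.1 (hN (ε / 2) (by positivity))
  filter_upwards [tendsto_rad.eventually (gt_mem_nhds hr)] with n hn
  have hnn : 0 ≤ ∫ q, |v q.1 - v q.2| * kap n (q.1 - q.2)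
      ∂((volume.restrict s).prod (volume.restrict s)) :=
    integral_nonneg fun _ => mul_nonneg (abs_nonneg _) (kap_nonneg _ _)
  rw [Real.dist_eq, sub_zero, abs_of_nonneg hnn]
  set Φ : (ℝ × ℝ) × (ℝ × ℝ) → ℝ := fun q => |V q.1 - V q.2| * kap n (q.1 - q.2) with hΦ
  have hΦi : Integrable Φ (volume.prod volume) := integrable_abs_sub_mul_kap hVi n
  -- In the variables `(x - y, y)` the mollifier depends on the first one only, and the inner
  -- integral becomes the `L¹` modulus of continuity of `V`.
  set τ : (ℝ × ℝ) × (ℝ × ℝ) → (ℝ × ℝ) × (ℝ × ℝ) := fun q => (q.1 - q.2, q.2) with hτ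
  have hτm : MeasurePreserving τ (volume.prod volume) (volume.prod volume) :=
    measurePreserving_sub_prod volume volume
  have hτe : MeasurableEmbedding τ := by
    refine hτm.measurable.measurableEmbedding fun q q' h => ?_
    simp only [hτ, Prod.mk.injEq] at h
    refine Prod.ext ?_ h.2
    have := h.1
    rw [h.2] at this
    simpa using this
  set g : (ℝ × ℝ) × (ℝ × ℝ) → ℝ := fun q => |V (q.1 + q.2) - V q.2| * kap n q.1 with hg
  have hgτ : Φ = g ∘ τ := by
    funext q; simp [hg, hΦ, hτ]
  have hgi : Integrable g (volume.prod volume) := by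
    rw [← hτm.integrable_comp_emb hτe, ← hgτ]; exact hΦi
  calc ∫ q, |v q.1 - v q.2| * kap n (q.1 - q.2) ∂((volume.restrict s).prod (volume.restrict s))
      = ∫ q in s ×ˢ s, Φ q ∂(volume.prod volume) := by
        rw [Measure.prod_restrict]
        refine setIntegral_congr_fun (hs.prod hs) fun q hq => ?_
        simp [hΦ, hV, hq.1, hq.2]
    _ ≤ ∫ q, Φ q ∂(volume.prod volume) :=
        setIntegral_le_integral hΦi
          (Eventually.of_forall fun q => mul_nonneg (abs_nonneg _) (kap_nonneg _ _))
    _ = ∫ q, g q ∂(volume.prod volume) := by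
        rw [hgτ]; exact hτm.integral_comp hτe g
    _ = ∫ z, (∫ x, |V x - V (x - z)|) * kap n z := by
        rw [integral_prod _ hgi]
        refine integral_congr_ae (Eventually.of_forall fun z => ?_)
        simp only [hg]
        rw [integral_mul_const]
        congr 1
        rw [← integral_sub_right_eq_self (fun y => |V (z + y) - V y|) z]
        simp
    _ ≤ ∫ z, (ε / 2) * kap n z := by
        have hi := hgi.integral_prod_left
        refine integral_mono_of_nonneg (Eventually.of_forall fun z =>
          mul_nonneg (integral_nonneg fun _ => abs_nonneg _) (kap_nonneg _ _))
          ((kap_integrable n).const_mul _) (Eventually.of_forall fun z => ?_)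
        by_cases hz : rad n ≤ ‖z‖
        · simp [kap_eq_zero hz]
        · refine mul_le_mul_of_nonneg_right ?_ (kap_nonneg _ _)
          have := hball (y := z) (by rw [dist_zero_right]; linarith)
          rw [Real.dist_eq, sub_zero] at this
          exact (le_abs_self _).trans this.le
    _ = ε / 2 := by rw [integral_const_mul, kap_integral, mul_one]
    _ < ε := by linarith

/-- Multiplying by a mollifier an integrable function on the product of two finite measures. -/
theorem integrable_mul_kap {ν : Measure ((ℝ × ℝ) × (ℝ × ℝ))} {F : (ℝ × ℝ) × (ℝ × ℝ) → ℝ}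
    (hF : Integrable F ν) (n : ℕ) : Integrable (fun q => F q * kap n (q.1 - q.2)) ν := by
  obtain ⟨C, hC⟩ := kap_bounded n
  exact hF.mul_bdd (((kap_continuous n).comp
    (continuous_fst.sub continuous_snd)).aestronglyMeasurable) (Eventually.of_forall fun _ => hC _)

/-- Since `s` is open, the mollifier centred at a point of `s` eventually has all its mass in `s`;
its mass in `s` never exceeds `1`, so `|h|` dominates. -/
theorem tendsto_mollify_fst {h : ℝ × ℝ → ℝ} (hs : IsOpen s)
    [IsFiniteMeasure (volume.restrict s)] (hh : IntegrableOn h s) :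
    Tendsto (fun n => ∫ q, h q.2 * kap n (q.1 - q.2)
      ∂((volume.restrict s).prod (volume.restrict s))) atTop (𝓝 (∫ p in s, h p)) := by
  have hrw : ∀ n, ∫ q, h q.2 * kap n (q.1 - q.2)
      ∂((volume.restrict s).prod (volume.restrict s)) =
      ∫ y in s, h y * ∫ x in s, kap n (x - y) := by
    intro n
    rw [integral_prod_symm _ (integrable_mul_kap (hh.integrable.comp_snd _) n)]
    simp_rw [integral_const_mul]
  simp_rw [hrw]
  have hle : ∀ n y, ∫ x in s, kap n (x - y) ≤ 1 := fun n y => by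
    rw [← kap_integral n, ← integral_sub_right_eq_self (kap n) y]
    exact setIntegral_le_integral ((kap_integrable n).comp_sub_right y)
      (Eventually.of_forall fun x => kap_nonneg _ _)
  have hnn : ∀ n y, 0 ≤ ∫ x in s, kap n (x - y) := fun n y =>
    integral_nonneg fun _ => kap_nonneg _ _
  refine tendsto_integral_of_dominated_convergence (fun y => ‖h y‖) ?_ hh.norm ?_ ?_
  · intro n
    exact (integrable_mul_kap (hh.integrable.comp_snd (volume.restrict s)) n).integral_prod_right.1.congr
      (Eventually.of_forall fun y => by simp [integral_const_mul])
  · intro n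
    refine Eventually.of_forall fun y => ?_
    rw [norm_mul, Real.norm_of_nonneg (hnn n y)]
    exact mul_le_of_le_one_right (norm_nonneg _) (hle n y)
  · refine (ae_restrict_iff' hs.measurableSet).2 (Eventually.of_forall fun y hy => ?_)
    obtain ⟨r, hr, hb⟩ := Metric.isOpen_iff.1 hs y hy
    refine tendsto_const_nhds.congr' ?_
    filter_upwards [tendsto_rad.eventually (gt_mem_nhds hr)] with n hn
    have : ∫ x in s, kap n (x - y) = 1 := by
      rw [← kap_integral n, ← integral_sub_right_eq_self (kap n) y]
      refine setIntegral_eq_integral_of_forall_compl_eq_zero fun x hx => kap_eq_zero ?_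
      by_contra hlt
      exact hx (hb (by rw [Metric.mem_ball, dist_eq_norm]; linarith))
    rw [this, mul_one]

/-- Mollifying the product of an integrable function and a bounded one. -/
theorem tendsto_mollify_mul {e b : ℝ × ℝ → ℝ} {M : ℝ} (hs : IsOpen s)
    [IsFiniteMeasure (volume.restrict s)] (he : IntegrableOn e s)
    (hb : AEStronglyMeasurable b (volume.restrict s)) (hM : ∀ᵐ p ∂(volume.restrict s), ‖b p‖ ≤ M) :
    Tendsto (fun n => ∫ q, e q.1 * b q.2 * kap n (q.1 - q.2)
      ∂((volume.restrict s).prod (volume.restrict s))) atTop (𝓝 (∫ p in s, e p * b p)) := by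
  have hM2 : ∀ᵐ q ∂((volume.restrict s).prod (volume.restrict s)), ‖b q.2‖ ≤ M :=
    Measure.quasiMeasurePreserving_snd.ae hM
  have h1 := tendsto_mollify_fst hs (he.integrable.mul_bdd hb hM)
  have h2 := (tendsto_mollify_abs_sub hs.measurableSet he).const_mul M
  rw [mul_zero] at h2
  have i1 : Integrable (fun q : (ℝ × ℝ) × (ℝ × ℝ) => e q.1 * b q.2)
      ((volume.restrict s).prod (volume.restrict s)) :=
    (he.integrable.comp_fst _).mul_bdd hb.comp_snd hM2
  have i2 : Integrable (fun q : (ℝ × ℝ) × (ℝ × ℝ) => e q.2 * b q.2)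
      ((volume.restrict s).prod (volume.restrict s)) :=
    (he.integrable.comp_snd _).mul_bdd hb.comp_snd hM2
  have i3 : Integrable (fun q : (ℝ × ℝ) × (ℝ × ℝ) => |e q.1 - e q.2|)
      ((volume.restrict s).prod (volume.restrict s)) :=
    ((he.integrable.comp_fst _).sub (he.integrable.comp_snd _)).abs
  -- Replacing `e q.1` by `e q.2` costs at most `M` times the mollified modulus of continuity of
  -- `e`; no continuity is asked of the bounded factor `b`.
  refine (tendsto_iff_of_dist (squeeze_zero (fun _ => dist_nonneg) (fun n => ?_) h2)).2 h1
  rw [Real.dist_eq, ← integral_sub (integrable_mul_kap i1 n) (integrable_mul_kap i2 n),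
    ← integral_const_mul]
  refine (abs_integral_le_integral_abs).trans (integral_mono_ae
    ((integrable_mul_kap i1 n).sub (integrable_mul_kap i2 n)).abs
    ((integrable_mul_kap i3 n).const_mul _) ?_)
  filter_upwards [hM2] with q hq
  rw [← sub_mul, ← sub_mul, abs_mul, abs_mul, abs_of_nonneg (kap_nonneg _ _), mul_comm |_| |_|,
    mul_assoc]
  exact mul_le_mul_of_nonneg_right hq (mul_nonneg (abs_nonneg _) (kap_nonneg _ _))

/-- Mollifying the difference of two functions, with weights. -/
theorem tendsto_mollify_weighted {v₁ v₂ c₁ c₂ : ℝ × ℝ → ℝ} {M : ℝ} (hs : IsOpen s)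
    [IsFiniteMeasure (volume.restrict s)] (h₁ : IntegrableOn v₁ s) (h₂ : IntegrableOn v₂ s)
    (hc₁ : Continuous c₁) (hc₂ : Continuous c₂) (hM₁ : ∀ p, ‖c₁ p‖ ≤ M) (hM₂ : ∀ p, ‖c₂ p‖ ≤ M) :
    Integrable (fun q => |v₁ q.1 - v₂ q.2| * (c₁ q.1 * c₂ q.2))
      ((volume.restrict s).prod (volume.restrict s)) ∧
    Tendsto (fun n => ∫ q, |v₁ q.1 - v₂ q.2| * (c₁ q.1 * c₂ q.2) * kap n (q.1 - q.2)
      ∂((volume.restrict s).prod (volume.restrict s))) atTop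
      (𝓝 (∫ p in s, |v₁ p - v₂ p| * (c₁ p * c₂ p))) := by
  have hM0 : 0 ≤ M := (norm_nonneg _).trans (hM₁ 0)
  have hcc : ∀ q : (ℝ × ℝ) × (ℝ × ℝ), ‖c₁ q.1 * c₂ q.2‖ ≤ M * M := fun q => by
    rw [norm_mul]; exact mul_le_mul (hM₁ _) (hM₂ _) (norm_nonneg _) hM0
  have hccm : AEStronglyMeasurable (fun q : (ℝ × ℝ) × (ℝ × ℝ) => c₁ q.1 * c₂ q.2)
      ((volume.restrict s).prod (volume.restrict s)) :=
    ((hc₁.comp continuous_fst).mul (hc₂.comp continuous_snd)).aestronglyMeasurable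
  have i1 : Integrable (fun q : (ℝ × ℝ) × (ℝ × ℝ) => |v₁ q.1 - v₂ q.2| * (c₁ q.1 * c₂ q.2))
      ((volume.restrict s).prod (volume.restrict s)) :=
    (((h₁.integrable.comp_fst _).sub (h₂.integrable.comp_snd _)).abs).mul_bdd hccm
      (Eventually.of_forall hcc)
  have i2 : Integrable (fun q : (ℝ × ℝ) × (ℝ × ℝ) => |v₁ q.1 - v₂ q.1| * (c₁ q.1 * c₂ q.2))
      ((volume.restrict s).prod (volume.restrict s)) :=
    (((h₁.integrable.comp_fst _).sub (h₂.integrable.comp_fst _)).abs).mul_bdd hccm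
      (Eventually.of_forall hcc)
  have i3 : Integrable (fun q : (ℝ × ℝ) × (ℝ × ℝ) => |v₂ q.1 - v₂ q.2|)
      ((volume.restrict s).prod (volume.restrict s)) :=
    ((h₂.integrable.comp_fst _).sub (h₂.integrable.comp_snd _)).abs
  refine ⟨i1, ?_⟩
  have e1 : IntegrableOn (fun p => |v₁ p - v₂ p| * c₁ p) s :=
    ((h₁.integrable.sub h₂.integrable).abs).mul_bdd hc₁.aestronglyMeasurable
      (Eventually.of_forall hM₁)
  have h1 := tendsto_mollify_mul hs e1 hc₂.aestronglyMeasurable (Eventually.of_forall hM₂)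
  simp only [mul_assoc] at h1 i1 i2 ⊢
  have h2 := (tendsto_mollify_abs_sub hs.measurableSet h₂).const_mul (M * M)
  rw [mul_zero] at h2
  refine (tendsto_iff_of_dist (squeeze_zero (fun _ => dist_nonneg) (fun n => ?_) h2)).2 h1
  have j1 := integrable_mul_kap i1 n
  have j2 := integrable_mul_kap i2 n
  simp only [mul_assoc] at j1 j2
  rw [Real.dist_eq, ← integral_sub j1 j2, ← integral_const_mul]
  refine (abs_integral_le_integral_abs).trans (integral_mono_ae
    (j1.sub j2).abs ((integrable_mul_kap i3 n).const_mul _) (Eventually.of_forall fun q => ?_))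
  have hk := kap_nonneg n (q.1 - q.2)
  have hq := hcc q
  have hd : |(|v₁ q.1 - v₂ q.2| - |v₁ q.1 - v₂ q.1|)| ≤ |v₂ q.1 - v₂ q.2| := by
    refine (abs_abs_sub_abs_le _ _).trans (le_of_eq ?_)
    congr 1; ring
  simp only
  rw [← sub_mul, ← mul_assoc (c₁ q.1), abs_mul, abs_mul, abs_of_nonneg hk]
  calc _ ≤ |v₂ q.1 - v₂ q.2| * (M * M * kap n (q.1 - q.2)) :=
        mul_le_mul hd (mul_le_mul_of_nonneg_right hq hk) (by positivity) (abs_nonneg _)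
    _ = _ := by ring

end PlayHysteresis

namespace PlayHysteresis

/-! ### Convex fluxes -/

/-- A convex function of class `C¹` on the line. -/
structure ConvexFlux (f : ℝ → ℝ) : Prop where
  contDiff : ContDiff ℝ 1 f
  convexOn : ConvexOn ℝ univ f

namespace ConvexFlux

variable {f : ℝ → ℝ}

theorem differentiable (hf : ConvexFlux f) : Differentiable ℝ f :=
  hf.contDiff.differentiable (by norm_num)

theorem continuous (hf : ConvexFlux f) : Continuous f := hf.contDiff.continuous

theorem tangent_le (hf : ConvexFlux f) (x y : ℝ) : f x + deriv f x * (y - x) ≤ f y := by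
  rcases lt_trichotomy x y with h | rfl | h
  · have := hf.convexOn.deriv_le_slope (mem_univ x) (mem_univ y) h (hf.differentiable x)
    rw [slope_def_field, le_div_iff₀ (by linarith)] at this
    linarith
  · simp
  · have := hf.convexOn.slope_le_deriv (mem_univ y) (mem_univ x) h (hf.differentiable x)
    rw [slope_def_field, div_le_iff₀ (by linarith)] at this
    linarith

theorem comp_mul (hf : ConvexFlux f) (σ : ℝ) : ConvexFlux fun v => f (σ * v) where
  contDiff := hf.contDiff.comp (contDiff_const.mul contDiff_id)
  convexOn := by
    refine ⟨convex_univ, fun x _ y _ a b ha hb hab => ?_⟩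
    have := hf.convexOn.2 (mem_univ (σ * x)) (mem_univ (σ * y)) ha hb hab
    simp only [smul_eq_mul] at this ⊢
    convert! this using 2
    ring

theorem monotoneOn (hf : ConvexFlux f) {k : ℝ} (hk : 0 ≤ deriv f k) : MonotoneOn f (Ici k) := by
  have hd := hf.convexOn.monotoneOn_deriv fun x _ => hf.differentiable x
  refine monotoneOn_of_deriv_nonneg (convex_Ici k) hf.continuous.continuousOn
    hf.differentiable.differentiableOn fun x hx => ?_
  rw [interior_Ici] at hx
  exact hk.trans (hd (mem_univ _) (mem_univ _) (le_of_lt hx))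

theorem antitoneOn (hf : ConvexFlux f) {k : ℝ} (hk : deriv f k ≤ 0) : AntitoneOn f (Iic k) := by
  have hd := hf.convexOn.monotoneOn_deriv fun x _ => hf.differentiable x
  refine antitoneOn_of_deriv_nonpos (convex_Iic k) hf.continuous.continuousOn
    hf.differentiable.differentiableOn fun x hx => ?_
  rw [interior_Iic] at hx
  exact (hd (mem_univ _) (mem_univ _) (le_of_lt hx)).trans hk

/-- A convex flux is the sum of a nondecreasing and of a nonincreasing function, both of which
are controlled by the flux. -/
theorem exists_monotone_add_antitone (hf : ConvexFlux f) : ∃ p q : ℝ → ℝ, ∃ C : ℝ,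
    Continuous p ∧ Continuous q ∧ Monotone p ∧ Antitone q ∧ (∀ v, f v = p v + q v) ∧
    (∀ v, |p v| ≤ |f v| + C) ∧ ∀ v, |q v| ≤ |f v| + C := by
  by_cases h1 : ∀ v, 0 ≤ deriv f v
  · refine ⟨f, fun _ => 0, 0, hf.continuous, continuous_const,
      monotone_of_deriv_nonneg hf.differentiable h1, antitone_const, by simp, by simp, ?_⟩
    intro v; simp
  by_cases h2 : ∀ v, deriv f v ≤ 0
  · refine ⟨fun _ => 0, f, 0, continuous_const, hf.continuous, monotone_const,
      antitone_of_deriv_nonpos hf.differentiable h2, by simp, ?_, by simp⟩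
    intro v; simp
  push Not at h1 h2
  obtain ⟨y, hy⟩ := h1
  obtain ⟨z, hz⟩ := h2
  have hdc : Continuous (deriv f) := hf.contDiff.continuous_deriv le_rfl
  obtain ⟨c, hc⟩ : (0 : ℝ) ∈ range (deriv f) :=
    mem_range_of_exists_le_of_exists_ge hdc ⟨y, hy.le⟩ ⟨z, hz.le⟩
  have hm := hf.monotoneOn hc.ge
  have ha := hf.antitoneOn hc.le
  -- The flux is split at a critical point `c`. On either side of `c` one of the two parts is
  -- constant, which gives the bounds by `|f v| + |f c|`.
  refine ⟨fun v => f (max v c), fun v => f (min v c) - f c, |f c|,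
    hf.continuous.comp (continuous_id.max continuous_const),
    (hf.continuous.comp (continuous_id.min continuous_const)).sub continuous_const, ?_, ?_, ?_,
    ?_, ?_⟩
  · exact fun v w h => hm (mem_Ici.2 (le_max_right _ _)) (mem_Ici.2 (le_max_right _ _))
      (max_le_max_right c h)
  · intro v w h
    have := ha (mem_Iic.2 (min_le_right v c)) (mem_Iic.2 (min_le_right w c)) (min_le_min_right c h)
    simp only; linarith
  · intro v
    rcases le_total v c with h | h <;> simp [h]
  · intro v
    rcases le_total v c with h | h
    · simp [h]
    · simp [h]
  · intro v
    rcases le_total v c with h | h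
    · simp only [h, min_eq_left]; exact abs_sub _ _
    · simp only [h, min_eq_right, sub_self, abs_zero]; positivity

/-- The Kruzhkov flux in terms of the monotone parts of `f`. -/
theorem sign_mul_sub {p q : ℝ → ℝ} (hp : Monotone p) (hq : Antitone q)
    (hfpq : ∀ v, f v = p v + q v) (v k : ℝ) :
    Real.sign (v - k) * (f v - f k) = |p v - p k| - |q v - q k| := by
  rw [hfpq v, hfpq k]
  rcases lt_trichotomy v k with h | rfl | h
  · rw [Real.sign_of_neg (by linarith), abs_of_nonpos (by linarith [hp h.le]),
      abs_of_nonneg (by linarith [hq h.le])]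
    ring
  · simp
  · rw [Real.sign_of_pos (by linarith), abs_of_nonneg (by linarith [hp h.le]),
      abs_of_nonpos (by linarith [hq h.le])]
    ring

/-- From above, a convex function on a segment is at most its maximum at the endpoints; from below,
it lies above its tangent at `0`. This dominates `f` at thresholds between `0` and `u` when they go
to infinity. -/
theorem abs_le_of_mem_uIcc (hf : ConvexFlux f) {v k : ℝ} (hk : k ∈ uIcc 0 v) :
    |f k| ≤ 2 * |f 0| + |f v| + |deriv f 0| * |v| := by
  have h1 : f k ≤ max (f 0) (f v) := by
    refine hf.convexOn.le_max_of_mem_segment (mem_univ _) (mem_univ _) ?_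
    rwa [segment_eq_uIcc]
  have h2 := hf.tangent_le 0 k
  have h3 : |k| ≤ |v| := by
    rcases mem_uIcc.1 hk with h | h
    · rw [abs_of_nonneg h.1, abs_of_nonneg (h.1.trans h.2)]; exact h.2
    · rw [abs_of_nonpos h.2, abs_of_nonpos (h.1.trans h.2)]; linarith [h.1]
  have h4 : |deriv f 0 * k| ≤ |deriv f 0| * |v| := by
    rw [abs_mul]; exact mul_le_mul_of_nonneg_left h3 (abs_nonneg _)
  have h5 := neg_abs_le (deriv f 0 * k)
  have h6 : 0 ≤ |deriv f 0| * |v| := by positivity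
  rw [sub_zero] at h2
  rw [abs_le]
  constructor
  · linarith [neg_abs_le (f 0), abs_nonneg (f v), abs_nonneg (f 0)]
  · have : max (f 0) (f v) ≤ |f 0| + |f v| :=
      max_le (by linarith [le_abs_self (f 0), abs_nonneg (f v)])
        (by linarith [le_abs_self (f v), abs_nonneg (f 0)])
    linarith [abs_nonneg (f 0)]

theorem exists_lipschitz_zero (hf : ConvexFlux f) (K : ℝ) :
    ∃ C, 0 ≤ C ∧ ∀ v, |v| ≤ K → |f v - f 0| ≤ C * |v| := by
  have hdc : Continuous (deriv f) := hf.contDiff.continuous_deriv le_rfl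
  obtain ⟨C, hC⟩ := (isCompact_Icc (a := -K) (b := K)).exists_bound_of_continuousOn hdc.continuousOn
  refine ⟨max C 0, le_max_right _ _, fun v hv => ?_⟩
  have hv' := abs_le.1 hv
  have hK : 0 ≤ K := (abs_nonneg v).trans hv
  have := (convex_Icc (-K) K).norm_image_sub_le_of_norm_deriv_le (f := f) (C := max C 0)
    (fun x _ => hf.differentiable x) (fun x hx => (hC x hx).trans (le_max_left _ _))
    (show (0:ℝ) ∈ Icc (-K) K from ⟨by linarith, hK⟩) (show v ∈ Icc (-K) K from hv')
  simpa using this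

end ConvexFlux

/-- The flux of the half entropy `(v - k)⁺`. -/
noncomputable def upFlux (f : ℝ → ℝ) (k v : ℝ) : ℝ := if k < v then f v - f k else 0

/-- The half entropy of the play operator with threshold `k`. -/
noncomputable def halfEnt (a k v z : ℝ) : ℝ := max (v - k) 0 + max (z - k - a) 0

theorem halfEnt_nonneg (a k v z : ℝ) : 0 ≤ halfEnt a k v z :=
  add_nonneg (le_max_right _ _) (le_max_right _ _)

/-- For `k ≥ 1` one has `(v - k)⁺ ≤ v²`, and feasibility gives `z - k - a ≤ v - k`. The `L²` energy
bound thus becomes an `L¹` bound on half entropies. -/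
theorem halfEnt_le {a k v z : ℝ} (hk : 1 ≤ k) (h : |v - z| ≤ a) : halfEnt a k v z ≤ 2 * v ^ 2 := by
  have h' := abs_le.1 h
  have h1 : max (v - k) 0 ≤ v ^ 2 := max_le (by nlinarith [sq_nonneg (v - 1)]) (sq_nonneg _)
  have h2 : max (z - k - a) 0 ≤ max (v - k) 0 := max_le_max (by linarith) le_rfl
  unfold halfEnt; linarith

theorem abs_upFlux_le (f : ℝ → ℝ) (k v : ℝ) : |upFlux f k v| ≤ |f v| + |f k| := by
  unfold upFlux; split_ifs
  · exact abs_sub _ _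
  · simp; positivity

/-! ### Cutoffs and integrated entropy inequalities -/

/-- The bounded box `]-R, R[ × ]0, T[`. -/
def box (R T : ℝ) : Set (ℝ × ℝ) := Ioo (-R) R ×ˢ Ioo 0 T

theorem isOpen_box (R T : ℝ) : IsOpen (box R T) := isOpen_Ioo.prod isOpen_Ioo

theorem measurableSet_box (R T : ℝ) : MeasurableSet (box R T) := (isOpen_box R T).measurableSet

theorem restrict_box (R T : ℝ) : (volume : Measure (ℝ × ℝ)).restrict (box R T) =
    (volume.restrict (Ioo (-R) R)).prod (volume.restrict (Ioo 0 T)) := by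
  rw [box, Measure.prod_restrict, Measure.volume_eq_prod]

instance (R T : ℝ) : IsFiniteMeasure ((volume : Measure (ℝ × ℝ)).restrict (box R T)) := by
  rw [restrict_box]; infer_instance

theorem box_subset_strip (R T : ℝ) : box R T ⊆ univ ×ˢ Ioo 0 T :=
  prod_mono (subset_univ _) subset_rfl

theorem box_mono {R R' : ℝ} (h : R ≤ R') (T : ℝ) : box R T ⊆ box R' T :=
  prod_mono (Ioo_subset_Ioo (by linarith) h) subset_rfl

/-- Nonnegative functions of class `C¹` with compact support in `s`. -/
structure IsCutoff (s : Set ℝ) (ψ : ℝ → ℝ) : Prop where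
  contDiff : ContDiff ℝ 1 ψ
  hasCompactSupport : HasCompactSupport ψ
  tsupport_subset : tsupport ψ ⊆ s
  nonneg : ∀ x, 0 ≤ ψ x

namespace IsCutoff

variable {s : Set ℝ} {ψ θ : ℝ → ℝ}

theorem continuous (h : IsCutoff s ψ) : Continuous ψ := h.contDiff.continuous

theorem hasDerivAt (h : IsCutoff s ψ) (x : ℝ) : HasDerivAt ψ (deriv ψ x) x :=
  (h.contDiff.differentiable (by norm_num) x).hasDerivAt

theorem continuous_deriv (h : IsCutoff s ψ) : Continuous (deriv ψ) :=
  h.contDiff.continuous_deriv le_rfl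

theorem eq_zero (h : IsCutoff s ψ) {x : ℝ} (hx : x ∉ s) : ψ x = 0 :=
  image_eq_zero_of_notMem_tsupport fun h' => hx (h.tsupport_subset h')

theorem deriv_eq_zero (h : IsCutoff s ψ) {x : ℝ} (hx : x ∉ s) : deriv ψ x = 0 :=
  image_eq_zero_of_notMem_tsupport fun h' =>
    hx (h.tsupport_subset (tsupport_deriv_subset (𝕜 := ℝ) h'))

theorem bounded (h : IsCutoff s ψ) : ∃ C, ∀ x, ‖ψ x‖ ≤ C ∧ ‖deriv ψ x‖ ≤ C := by
  obtain ⟨C, hC⟩ := h.hasCompactSupport.exists_bound_of_continuous h.continuous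
  obtain ⟨D, hD⟩ := h.hasCompactSupport.deriv.exists_bound_of_continuous h.continuous_deriv
  exact ⟨max C D, fun x => ⟨(hC x).trans (le_max_left _ _), (hD x).trans (le_max_right _ _)⟩⟩

theorem integral_deriv (h : IsCutoff s ψ) : ∫ x in s, deriv ψ x = 0 := by
  rw [setIntegral_eq_integral_of_forall_compl_eq_zero fun x hx => h.deriv_eq_zero hx]
  exact integral_eq_zero_of_hasDerivAt_of_integrable h.hasDerivAt
    (h.continuous_deriv.integrable_of_hasCompactSupport h.hasCompactSupport.deriv)
    (h.continuous.integrable_of_hasCompactSupport h.hasCompactSupport)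

theorem mul_right (h : IsCutoff s ψ) (hθ : ContDiff ℝ 1 θ) (hθ0 : ∀ x, 0 ≤ θ x) :
    IsCutoff s fun x => ψ x * θ x where
  contDiff := h.contDiff.mul hθ
  hasCompactSupport := h.hasCompactSupport.mul_right
  tsupport_subset := (closure_mono (Function.support_mul_subset_left ψ θ)).trans h.tsupport_subset
  nonneg x := mul_nonneg (h.nonneg x) (hθ0 x)

theorem mono {s' : Set ℝ} (h : IsCutoff s ψ) (hs : s ⊆ s') : IsCutoff s' ψ :=
  ⟨h.contDiff, h.hasCompactSupport, h.tsupport_subset.trans hs, h.nonneg⟩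

end IsCutoff

/-- The weak form of `∂ₜ A + ∂ₓ B ≤ 0` in `ℝ × ]0, T[`, tested with products of cutoffs. -/
def SubSol (T : ℝ) (A B : ℝ × ℝ → ℝ) : Prop :=
  ∀ R : ℝ, ∀ ψ θ : ℝ → ℝ, IsCutoff (Ioo (-R) R) ψ → IsCutoff (Ioo 0 T) θ →
    0 ≤ ∫ p in box R T, (A p * (ψ p.1 * deriv θ p.2) + B p * (deriv ψ p.1 * θ p.2))

theorem integral_box_mul (R T : ℝ) (g h : ℝ → ℝ) :
    ∫ p in box R T, g p.1 * h p.2 = (∫ x in Ioo (-R) R, g x) * ∫ t in Ioo 0 T, h t := by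
  rw [restrict_box]; exact integral_prod_mul g h

/-- Continuous products of bounded functions are admissible weights. -/
theorem integrable_mul_weight {s : Set (ℝ × ℝ)} {A : ℝ × ℝ → ℝ} {g h : ℝ → ℝ} {C D : ℝ}
    (hA : IntegrableOn A s) (hg : Continuous g) (hh : Continuous h) (hC : ∀ x, ‖g x‖ ≤ C)
    (hD : ∀ x, ‖h x‖ ≤ D) : IntegrableOn (fun p => A p * (g p.1 * h p.2)) s := by
  refine hA.integrable.mul_bdd (c := C * D)
    ((hg.comp continuous_fst).mul (hh.comp continuous_snd)).aestronglyMeasurable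
    (Eventually.of_forall fun p => ?_)
  rw [norm_mul]
  exact mul_le_mul (hC _) (hD _) (norm_nonneg _) ((norm_nonneg _).trans (hC 0))

theorem IsCutoff.integrable_weight {R T : ℝ} {ψ θ : ℝ → ℝ} {s s' : Set ℝ} (hψ : IsCutoff s ψ)
    (hθ : IsCutoff s' θ) {A : ℝ × ℝ → ℝ} (hA : IntegrableOn A (box R T)) :
    IntegrableOn (fun p => A p * (ψ p.1 * deriv θ p.2)) (box R T) ∧
    IntegrableOn (fun p => A p * (deriv ψ p.1 * θ p.2)) (box R T) := by
  obtain ⟨C, hC⟩ := hψ.bounded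
  obtain ⟨D, hD⟩ := hθ.bounded
  exact ⟨integrable_mul_weight hA hψ.continuous hθ.continuous_deriv (fun x => (hC x).1)
      (fun x => (hD x).2),
    integrable_mul_weight hA hψ.continuous_deriv hθ.continuous (fun x => (hC x).2)
      (fun x => (hD x).1)⟩

/-- Constants may be added in an integrated inequality. -/
theorem SubSol.add_const {T : ℝ} {A B : ℝ × ℝ → ℝ} (hA : ∀ R, IntegrableOn A (box R T))
    (hB : ∀ R, IntegrableOn B (box R T)) (c d : ℝ) (h : SubSol T A B) :
    SubSol T (fun p => A p + c) (fun p => B p + d) := by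
  intro R ψ θ hψ hθ
  have i1 := (hψ.integrable_weight hθ (hA R)).1
  have i2 := (hψ.integrable_weight hθ (hB R)).2
  have hc : ∀ c : ℝ, IntegrableOn (fun _ : ℝ × ℝ => c) (box R T) := fun c => integrable_const c
  have i3 := (hψ.integrable_weight hθ (hc c)).1
  have i4 := (hψ.integrable_weight hθ (hc d)).2
  have e3 : ∫ p in box R T, c * (ψ p.1 * deriv θ p.2) = 0 := by
    rw [integral_const_mul, integral_box_mul, hθ.integral_deriv, mul_zero, mul_zero]
  have e4 : ∫ p in box R T, d * (deriv ψ p.1 * θ p.2) = 0 := by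
    rw [integral_const_mul, integral_box_mul, hψ.integral_deriv, zero_mul, mul_zero]
  have h0 := h R ψ θ hψ hθ
  have : ∫ p in box R T, ((A p + c) * (ψ p.1 * deriv θ p.2) + (B p + d) * (deriv ψ p.1 * θ p.2))
      = (∫ p in box R T, (A p * (ψ p.1 * deriv θ p.2) + B p * (deriv ψ p.1 * θ p.2)))
      + ((∫ p in box R T, c * (ψ p.1 * deriv θ p.2))
      + ∫ p in box R T, d * (deriv ψ p.1 * θ p.2)) := by
    have j1 : IntegrableOn (fun p => A p * (ψ p.1 * deriv θ p.2) + B p * (deriv ψ p.1 * θ p.2))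
      (box R T) := i1.add i2
    have j2 : IntegrableOn (fun p => c * (ψ p.1 * deriv θ p.2) + d * (deriv ψ p.1 * θ p.2))
      (box R T) := i3.add i4
    rw [← integral_add i3 i4, ← integral_add j1 j2]
    refine integral_congr_ae (Eventually.of_forall fun p => ?_)
    ring
  rw [this, e3, e4]; linarith

theorem SubSol.congr {T : ℝ} {A B A' B' : ℝ × ℝ → ℝ} (h : SubSol T A B)
    (hA : ∀ p, A p = A' p) (hB : ∀ p, B p = B' p) : SubSol T A' B' := by
  rw [← funext hA, ← funext hB]; exact h

/-- Nonnegative linear combinations of integrated inequalities. -/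
theorem SubSol.half_add {T : ℝ} {A B A' B' : ℝ × ℝ → ℝ} (hA : ∀ R, IntegrableOn A (box R T))
    (hB : ∀ R, IntegrableOn B (box R T)) (hA' : ∀ R, IntegrableOn A' (box R T))
    (hB' : ∀ R, IntegrableOn B' (box R T)) (h : SubSol T A B) (h' : SubSol T A' B') :
    SubSol T (fun p => (A p + A' p) / 2) (fun p => (B p + B' p) / 2) := by
  intro R ψ θ hψ hθ
  have i1 := (hψ.integrable_weight hθ (hA R)).1
  have i2 := (hψ.integrable_weight hθ (hB R)).2
  have i3 := (hψ.integrable_weight hθ (hA' R)).1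
  have i4 := (hψ.integrable_weight hθ (hB' R)).2
  have h0 := add_nonneg (h R ψ θ hψ hθ) (h' R ψ θ hψ hθ)
  have j1 : IntegrableOn (fun p => A p * (ψ p.1 * deriv θ p.2) + B p * (deriv ψ p.1 * θ p.2))
    (box R T) := i1.add i2
  have j2 : IntegrableOn (fun p => A' p * (ψ p.1 * deriv θ p.2) + B' p * (deriv ψ p.1 * θ p.2))
    (box R T) := i3.add i4
  rw [← integral_add j1 j2] at h0
  have := mul_nonneg (by norm_num : (0:ℝ) ≤ 1 / 2) h0
  rw [← integral_const_mul] at this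
  refine this.trans_eq (integral_congr_ae (Eventually.of_forall fun p => ?_))
  ring

end PlayHysteresis

namespace PlayHysteresis

/-! ### Solutions on a strip -/

/-- The properties of an entropy weak solution on `ℝ × ]0, T[` used in the uniqueness proof; `E`
bounds the energy. -/
structure StripSolution (a T E : ℝ) (f : ℝ → ℝ) (u w : ℝ × ℝ → ℝ) : Prop where
  meas_u : AEStronglyMeasurable u (volume.restrict (univ ×ˢ Ioo 0 T))
  meas_w : AEStronglyMeasurable w (volume.restrict (univ ×ˢ Ioo 0 T))
  energy : ∀ᵐ t ∂(volume.restrict (Ioo 0 T)), Integrable (fun x => u (x, t) ^ 2) ∧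
    Integrable (fun x => w (x, t) ^ 2) ∧ (∫ x, u (x, t) ^ 2) + (∫ x, w (x, t) ^ 2) ≤ E
  flux : ∀ R, IntegrableOn (fun p => f (u p)) (box R T)
  feasible : ∀ᵐ p ∂(volume.restrict (univ ×ˢ Ioo 0 T)), |u p - w p| ≤ a
  entropy : ∀ k k' : ℝ, |k - k'| ≤ a → SubSol T (fun p => |u p - k| + |w p - k'|)
    (fun p => Real.sign (u p - k) * (f (u p) - f k))

/-- The space integrals of `A` over `]-R, R[` are bounded by `C` at almost every time. -/
def SlabBound (R T C : ℝ) (A : ℝ × ℝ → ℝ) : Prop :=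
  ∀ᵐ t ∂(volume.restrict (Ioo 0 T)), ∫ x in Ioo (-R) R, A (x, t) ≤ C

theorem integrableOn_box_of_slices {R T C : ℝ} {A : ℝ × ℝ → ℝ}
    (hA : AEStronglyMeasurable A (volume.restrict (box R T))) (h0 : ∀ p, 0 ≤ A p)
    (hi : ∀ᵐ t ∂(volume.restrict (Ioo 0 T)), IntegrableOn (fun x => A (x, t)) (Ioo (-R) R))
    (hC : SlabBound R T C A) : IntegrableOn A (box R T) := by
  rw [restrict_box] at hA
  rw [IntegrableOn, restrict_box, integrable_prod_iff' hA]
  refine ⟨hi, Integrable.of_bound (C := C) hA.norm.prod_swap.integral_prod_right' ?_⟩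
  filter_upwards [hC] with t ht
  have e : ∫ x in Ioo (-R) R, ‖A (x, t)‖ = ∫ x in Ioo (-R) R, A (x, t) :=
    integral_congr_ae (Eventually.of_forall fun x => Real.norm_of_nonneg (h0 _))
  rw [e, Real.norm_of_nonneg (integral_nonneg fun x => h0 _)]
  exact ht

theorem ae_slice {R T : ℝ} {P : ℝ × ℝ → Prop} (h : ∀ᵐ p ∂(volume.restrict (box R T)), P p) :
    ∀ᵐ t ∂(volume.restrict (Ioo 0 T)), ∀ᵐ x ∂(volume.restrict (Ioo (-R) R)), P (x, t) := by
  rw [restrict_box] at h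
  have := (Measure.measurePreserving_swap (μ := volume.restrict (Ioo 0 T))
    (ν := volume.restrict (Ioo (-R) R))).quasiMeasurePreserving.ae h
  exact Measure.ae_ae_of_ae_prod this

theorem SlabBound.mono {R T C : ℝ} {A B : ℝ × ℝ → ℝ} (hB : SlabBound R T C B)
    (hA0 : ∀ p, 0 ≤ A p) (hBi : IntegrableOn B (box R T))
    (hAB : ∀ᵐ p ∂(volume.restrict (box R T)), A p ≤ B p) : SlabBound R T C A := by
  have hBi' : Integrable B ((volume.restrict (Ioo (-R) R)).prod (volume.restrict (Ioo 0 T))) := by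
    rw [← restrict_box]; exact hBi
  filter_upwards [hB, ae_slice hAB, hBi'.prod_left_ae] with t h1 h2 h3
  exact (integral_mono_of_nonneg (Eventually.of_forall fun x => hA0 _) h3 h2).trans h1

/-- Integrating a slab bounded function against a function of time. -/
theorem SlabBound.integral_mul_le {R T C : ℝ} {A : ℝ × ℝ → ℝ} {k : ℝ → ℝ} (hA : SlabBound R T C A)
    (hAk : IntegrableOn (fun p => A p * k p.2) (box R T))
    (hk : IntegrableOn k (Ioo 0 T)) (hk0 : ∀ t, 0 ≤ k t) :
    ∫ p in box R T, A p * k p.2 ≤ C * ∫ t in Ioo 0 T, k t := by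
  rw [IntegrableOn, restrict_box] at hAk
  rw [restrict_box, integral_prod_symm _ hAk, ← integral_const_mul]
  refine integral_mono_ae hAk.integral_prod_right (hk.const_mul C) ?_
  filter_upwards [hA] with t ht
  simp only [integral_mul_const]
  exact mul_le_mul_of_nonneg_right ht (hk0 t)

namespace StripSolution

variable {a T E : ℝ} {f : ℝ → ℝ} {u w : ℝ × ℝ → ℝ}

theorem meas_box (h : StripSolution a T E f u w) (R : ℝ) :
    AEStronglyMeasurable u (volume.restrict (box R T)) ∧
      AEStronglyMeasurable w (volume.restrict (box R T)) :=
  ⟨h.meas_u.mono_measure (Measure.restrict_mono (box_subset_strip R T) le_rfl),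
    h.meas_w.mono_measure (Measure.restrict_mono (box_subset_strip R T) le_rfl)⟩

theorem feasible_box (h : StripSolution a T E f u w) (R : ℝ) :
    ∀ᵐ p ∂(volume.restrict (box R T)), |u p - w p| ≤ a :=
  ae_restrict_of_ae_restrict_of_subset (box_subset_strip R T) h.feasible

theorem slab_sq (h : StripSolution a T E f u w) (R : ℝ) :
    SlabBound R T E fun p => u p ^ 2 + w p ^ 2 := by
  filter_upwards [h.energy] with t ht
  have hi : Integrable fun x => u (x, t) ^ 2 + w (x, t) ^ 2 := ht.1.add ht.2.1
  refine (setIntegral_le_integral hi (Eventually.of_forall fun x =>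
    add_nonneg (sq_nonneg _) (sq_nonneg _))).trans ?_
  rw [integral_add ht.1 ht.2.1]; exact ht.2.2

theorem integrable_sq (h : StripSolution a T E f u w) (R : ℝ) :
    IntegrableOn (fun p => u p ^ 2 + w p ^ 2) (box R T) := by
  refine integrableOn_box_of_slices (((h.meas_box R).1.pow 2).add ((h.meas_box R).2.pow 2))
    (fun p => add_nonneg (sq_nonneg _) (sq_nonneg _)) ?_ (h.slab_sq R)
  filter_upwards [h.energy] with t ht
  exact (ht.1.add ht.2.1).integrableOn

theorem integrable_u (h : StripSolution a T E f u w) (R : ℝ) : IntegrableOn u (box R T) := by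
  refine Integrable.mono' ((integrable_const (1:ℝ)).add (h.integrable_sq R)) (h.meas_box R).1
    (Eventually.of_forall fun p => ?_)
  simp only [Pi.add_apply, Real.norm_eq_abs]
  exact abs_le.2 ⟨by nlinarith [sq_nonneg (u p + 1), sq_nonneg (w p)],
    by nlinarith [sq_nonneg (u p - 1), sq_nonneg (w p)]⟩

theorem integrable_w (h : StripSolution a T E f u w) (R : ℝ) : IntegrableOn w (box R T) := by
  refine Integrable.mono' ((integrable_const (1:ℝ)).add (h.integrable_sq R)) (h.meas_box R).2
    (Eventually.of_forall fun p => ?_)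
  simp only [Pi.add_apply, Real.norm_eq_abs]
  exact abs_le.2 ⟨by nlinarith [sq_nonneg (w p + 1), sq_nonneg (u p)],
    by nlinarith [sq_nonneg (w p - 1), sq_nonneg (u p)]⟩

/-- The monotone parts of `f` are continuous and dominated by `|f| + C`, so writing the flux as
`|p(u) - p(k)| - |q(u) - q(k)|` settles both measurability and integrability without the sign
function. -/
theorem integrable_kruzhkov (h : StripSolution a T E f u w) (hf : ConvexFlux f) (k k' R : ℝ) :
    IntegrableOn (fun p => |u p - k| + |w p - k'|) (box R T) ∧
    IntegrableOn (fun p => Real.sign (u p - k) * (f (u p) - f k)) (box R T) := by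
  refine ⟨(((h.integrable_u R).integrable.sub (integrable_const k)).abs).add
    (((h.integrable_w R).integrable.sub (integrable_const k')).abs), ?_⟩
  obtain ⟨p, q, C, hpc, hqc, hp, hq, hfpq, hpf, hqf⟩ := hf.exists_monotone_add_antitone
  simp_rw [ConvexFlux.sign_mul_sub hp hq hfpq]
  have hb : Integrable (fun x => |f (u x)| + C) (volume.restrict (box R T)) :=
    ((h.flux R).integrable.abs).add (integrable_const C)
  have ip : Integrable (fun x => p (u x)) (volume.restrict (box R T)) :=
    hb.mono' (hpc.comp_aestronglyMeasurable (h.meas_box R).1) (Eventually.of_forall fun x => hpf _)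
  have iq : Integrable (fun x => q (u x)) (volume.restrict (box R T)) :=
    hb.mono' (hqc.comp_aestronglyMeasurable (h.meas_box R).1) (Eventually.of_forall fun x => hqf _)
  exact ((ip.sub (integrable_const _)).abs).sub ((iq.sub (integrable_const _)).abs)

/-- The balance law itself, obtained from the entropy inequalities with `k → ∓∞`. -/
theorem weak (h : StripSolution a T E f u w) (hf : ConvexFlux f) (ha : 0 ≤ a) {σ : ℝ}
    (hσ : σ = 1 ∨ σ = -1) :
    SubSol T (fun p => σ * (u p + w p)) (fun p => σ * f (u p)) := by
  intro R ψ θ hψ hθ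
  have hσσ : σ * σ = 1 := by rcases hσ with rfl | rfl <;> norm_num
  have hσa : |σ| = 1 := by rcases hσ with rfl | rfl <;> norm_num
  obtain ⟨C, hC⟩ := hψ.bounded
  obtain ⟨D, hD⟩ := hθ.bounded
  have hC0 : 0 ≤ C := (norm_nonneg _).trans (hC 0).1
  have hD0 : 0 ≤ D := (norm_nonneg _).trans (hD 0).1
  -- Both thresholds are `-σ j`. Where `|u|, |w| < j`, the entropy pair is affine in `u + w` and
  -- `f(u)`, and the added constants `-2j` and `σ f(-σ j)` turn it into exactly `σ (u + w)` and `σ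
  -- f(u)`.
  set Aj : ℕ → ℝ × ℝ → ℝ := fun j p => |u p - -(σ * j)| + |w p - -(σ * j)| + -(2 * (j:ℝ)) with hAj
  set Bj : ℕ → ℝ × ℝ → ℝ := fun j p =>
    Real.sign (u p - -(σ * j)) * (f (u p) - f (-(σ * j))) + σ * f (-(σ * j)) with hBj
  have hsub : ∀ j, SubSol T (Aj j) (Bj j) := fun j => by
    have hk := fun R => h.integrable_kruzhkov hf (-(σ * j)) (-(σ * j)) R
    exact (h.entropy (-(σ * j)) (-(σ * j)) (by simpa using ha)).add_const
      (fun R => (hk R).1) (fun R => (hk R).2) (-(2 * (j:ℝ))) (σ * f (-(σ * j)))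
  have key : ∀ (x : ℝ) (j : ℕ), |x| < j → |x - -(σ * j)| = σ * x + j := by
    intro x j hx
    have := abs_lt.1 hx
    rcases hσ with rfl | rfl
    · rw [abs_of_pos] <;> linarith
    · rw [abs_of_neg] <;> linarith
  have keyle : ∀ (x : ℝ) (j : ℕ), |(|x - -(σ * j)| - (j:ℝ))| ≤ |x| := by
    intro x j
    have hj : |σ * (j:ℝ)| = j := by rw [abs_mul, hσa, one_mul, Nat.abs_cast]
    calc |(|x - -(σ * j)| - (j:ℝ))| = |(|x - -(σ * j)| - |σ * (j:ℝ)|)| := by rw [hj]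
      _ ≤ |x - -(σ * j) - σ * (j:ℝ)| := abs_abs_sub_abs_le _ _
      _ = |x| := by congr 1; ring
  have keyB : ∀ (x : ℝ) (j : ℕ), |x| < j →
      Real.sign (x - -(σ * j)) * (f x - f (-(σ * j))) + σ * f (-(σ * j)) = σ * f x := by
    intro x j hx
    have := abs_lt.1 hx
    rcases hσ with rfl | rfl
    · rw [Real.sign_of_pos (by linarith)]; ring
    · rw [Real.sign_of_neg (by linarith)]; ring
  -- A bound independent of `j`: it is `|f(u)| + 2 |f(k)|` with `|f(k)|` estimated by
  -- `abs_le_of_mem_uIcc`.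
  set M : ℝ × ℝ → ℝ := fun p => 4 * |f 0| + 3 * |f (u p)| + 2 * |deriv f 0| * |u p| with hM
  have keyBle : ∀ p j, |Bj j p| ≤ M p := by
    intro p j
    by_cases hx : |u p| < j
    · have hB : Bj j p = σ * f (u p) := keyB _ _ hx
      rw [hB, abs_mul, hσa, one_mul, hM]
      have : 0 ≤ 2 * |deriv f 0| * |u p| := by positivity
      simp only
      linarith [abs_nonneg (f 0), abs_nonneg (f (u p))]
    · push Not at hx
      have hj : (0:ℝ) ≤ j := Nat.cast_nonneg j
      -- For `|u| ≥ j`, either the threshold lies between `0` and `u`, where convexity controls its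
      -- flux, or the sign is still `σ` or `u` equals the threshold, and then the value is `σ f(u)`
      -- again.
      have hcase : (-(σ * j) ∈ uIcc 0 (u p)) ∨ Real.sign (u p - -(σ * j)) = σ ∨
          u p = -(σ * j) := by
        rcases hσ with rfl | rfl
        · rcases lt_trichotomy (u p) (-(1 * (j:ℝ))) with h1 | h1 | h1
          · left; rw [mem_uIcc]; right; constructor <;> linarith
          · right; right; exact h1
          · right; left; rw [Real.sign_of_pos (by linarith)]
        · rcases lt_trichotomy (u p) (-(-1 * (j:ℝ))) with h1 | h1 | h1
          · right; left; rw [Real.sign_of_neg (by linarith)]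
          · right; right; exact h1
          · left; rw [mem_uIcc]; left; constructor <;> linarith
      have hpos : 0 ≤ 2 * |deriv f 0| * |u p| := by positivity
      rcases hcase with h1 | h1 | h1
      · have h2 := hf.abs_le_of_mem_uIcc h1
        have h3 : |Real.sign (u p - -(σ * j))| ≤ 1 := by
          rcases Real.sign_apply_eq (u p - -(σ * j)) with h | h | h <;> rw [h] <;> norm_num
        calc |Bj j p| ≤ |Real.sign (u p - -(σ * j)) * (f (u p) - f (-(σ * j)))|
              + |σ * f (-(σ * j))| := abs_add_le _ _
          _ ≤ 1 * (|f (u p)| + |f (-(σ * j))|) + 1 * |f (-(σ * j))| := by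
              rw [abs_mul, abs_mul, hσa]
              gcongr
              exact abs_sub _ _
          _ ≤ M p := by simp only [hM]; linarith
      · have hB : Bj j p = σ * f (u p) := by simp only [hBj]; rw [h1]; ring
        rw [hB, abs_mul, hσa, one_mul]
        simp only [hM]
        linarith [abs_nonneg (f 0), abs_nonneg (f (u p))]
      · have hB : Bj j p = σ * f (u p) := by simp only [hBj]; rw [← h1]; ring
        rw [hB, abs_mul, hσa, one_mul]
        simp only [hM]
        linarith [abs_nonneg (f 0), abs_nonneg (f (u p))]
  have hMi : IntegrableOn M (box R T) := by
    refine Integrable.add (Integrable.add (integrable_const _) ?_) ?_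
    · exact (h.flux R).integrable.abs.const_mul 3
    · exact (h.integrable_u R).integrable.abs.const_mul _
  refine ge_of_tendsto' (f := fun j : ℕ => ∫ p in box R T,
    (Aj j p * (ψ p.1 * deriv θ p.2) + Bj j p * (deriv ψ p.1 * θ p.2))) (x := atTop) ?_
    fun j => hsub j R ψ θ hψ hθ
  refine tendsto_integral_of_dominated_convergence
    (fun p => (|u p| + |w p|) * (C * D) + M p * (C * D)) ?_ ?_ ?_ ?_
  · intro j
    have hk := h.integrable_kruzhkov hf (-(σ * j)) (-(σ * j)) R
    have i1 : IntegrableOn (Aj j) (box R T) := hk.1.integrable.add (integrable_const _)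
    have i2 : IntegrableOn (Bj j) (box R T) := hk.2.integrable.add (integrable_const _)
    exact ((hψ.integrable_weight hθ i1).1.integrable.add (hψ.integrable_weight hθ i2).2.integrable).1
  · exact (((h.integrable_u R).integrable.abs.add (h.integrable_w R).integrable.abs).mul_const _).add
      (hMi.integrable.mul_const _)
  · intro j
    refine Eventually.of_forall fun p => ?_
    have hAle : |Aj j p| ≤ |u p| + |w p| := by
      have e : Aj j p = (|u p - -(σ * j)| - j) + (|w p - -(σ * j)| - j) := by
        simp only [hAj]; ring
      rw [e]
      exact (abs_add_le _ _).trans (add_le_add (keyle _ _) (keyle _ _))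
    refine (norm_add_le _ _).trans (add_le_add ?_ ?_)
    · rw [norm_mul, norm_mul]
      exact mul_le_mul hAle (mul_le_mul (hC _).1 (hD _).2 (norm_nonneg _) hC0) (by positivity)
        (by positivity)
    · rw [norm_mul, norm_mul]
      exact mul_le_mul (keyBle p j) (mul_le_mul (hC _).2 (hD _).1 (norm_nonneg _) hC0)
        (by positivity) ((abs_nonneg _).trans (keyBle p j))
  · refine Eventually.of_forall fun p => tendsto_const_nhds.congr' ?_
    filter_upwards [eventually_gt_atTop ⌈max |u p| |w p|⌉₊] with j hj
    have hj' : max |u p| |w p| < j := Nat.lt_of_ceil_lt hj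
    have e1 : Aj j p = σ * (u p + w p) := by
      simp only [hAj]
      rw [key _ _ ((le_max_left _ _).trans_lt hj'), key _ _ ((le_max_right _ _).trans_lt hj')]
      ring
    have e2 : Bj j p = σ * f (u p) := keyB _ _ ((le_max_left _ _).trans_lt hj')
    rw [e1, e2]

/-- The half entropy inequalities. -/
theorem half (h : StripSolution a T E f u w) (hf : ConvexFlux f) (ha : 0 ≤ a) {σ : ℝ}
    (hσ : σ = 1 ∨ σ = -1) (k : ℝ) :
    SubSol T (fun p => halfEnt a k (σ * u p) (σ * w p))
      (fun p => σ * upFlux (fun v => f (σ * v)) k (σ * u p)) := by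
  -- The pair `(σ k, σ (k + a))` lies on the boundary of the strip. Averaging its entropy inequality
  -- with the balance law produces positive parts through `r⁺ = (|r| + r) / 2`.
  have hka : |σ * k - σ * (k + a)| ≤ a := by
    rcases hσ with rfl | rfl
    · rw [abs_le]; constructor <;> linarith
    · rw [abs_le]; constructor <;> linarith
  have hk := h.integrable_kruzhkov hf (σ * k) (σ * (k + a))
  have hw := h.weak hf ha hσ
  have i1 : ∀ R, IntegrableOn (fun p => σ * (u p + w p)) (box R T) := fun R =>
    ((h.integrable_u R).integrable.add (h.integrable_w R).integrable).const_mul σ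
  have i2 : ∀ R, IntegrableOn (fun p => σ * f (u p)) (box R T) := fun R =>
    (h.flux R).integrable.const_mul σ
  have h1 := SubSol.half_add (fun R => (hk R).1) (fun R => (hk R).2) i1 i2
    (h.entropy _ _ hka) hw
  have h2 := SubSol.add_const
    (A := fun p => (|u p - σ * k| + |w p - σ * (k + a)| + σ * (u p + w p)) / 2)
    (B := fun p => (Real.sign (u p - σ * k) * (f (u p) - f (σ * k)) + σ * f (u p)) / 2)
    (fun R => ((hk R).1.integrable.add (i1 R).integrable).div_const 2)
    (fun R => ((hk R).2.integrable.add (i2 R).integrable).div_const 2)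
    (-(2 * k + a) / 2) (-(σ * f (σ * k)) / 2) h1
  have hmax : ∀ r : ℝ, max r 0 = (|r| + r) / 2 := fun r => by
    rcases le_total r 0 with h | h
    · rw [max_eq_right h, abs_of_nonpos h]; ring
    · rw [max_eq_left h, abs_of_nonneg h]; ring
  refine h2.congr (fun p => ?_) (fun p => ?_)
  · have e : ∀ x y : ℝ, |σ * x - y| = |x - σ * y| := fun x y => by
      rcases hσ with rfl | rfl
      · simp
      · rw [← abs_neg]; congr 1; ring
    rw [halfEnt, hmax, hmax, sub_sub (σ * w p), e, e]; ring
  · unfold upFlux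
    rcases hσ with rfl | rfl
    · simp only [one_mul]
      split_ifs with hlt
      · rw [Real.sign_of_pos (by linarith)]; ring
      · rcases (not_lt.1 hlt).lt_or_eq with h' | h'
        · rw [Real.sign_of_neg (by linarith)]; ring
        · rw [h']; simp; ring
    · simp only [neg_mul, one_mul, neg_neg]
      split_ifs with hlt
      · rw [Real.sign_of_neg (by linarith)]; ring
      · rcases (not_lt.1 hlt).lt_or_eq with h' | h'
        · rw [Real.sign_of_pos (by linarith)]; ring
        · rw [← h']; simp; ring

end StripSolution

end PlayHysteresis

namespace PlayHysteresis

/-! ### Doubling of variables -/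

/-- The square of the Lebesgue measure on a box. -/
noncomputable def box2 (R T : ℝ) : Measure ((ℝ × ℝ) × (ℝ × ℝ)) :=
  (volume.restrict (box R T)).prod (volume.restrict (box R T))

theorem integrable_mul_continuous {R T : ℝ} {F W : (ℝ × ℝ) × (ℝ × ℝ) → ℝ}
    (hF : Integrable F (box2 R T)) (hW : Continuous W) :
    Integrable (fun q => F q * W q) (box2 R T) := by
  set K : Set (ℝ × ℝ) := Icc (-R) R ×ˢ Icc 0 T
  have hK : IsCompact (K ×ˢ K) :=
    (isCompact_Icc.prod isCompact_Icc).prod (isCompact_Icc.prod isCompact_Icc)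
  obtain ⟨C, hC⟩ := hK.exists_bound_of_continuousOn hW.continuousOn
  refine hF.mul_bdd (c := C) hW.aestronglyMeasurable ?_
  rw [box2, Measure.prod_restrict]
  have hsub : box R T ×ˢ box R T ⊆ K ×ˢ K := by
    have : box R T ⊆ K := prod_mono Ioo_subset_Icc_self Ioo_subset_Icc_self
    exact prod_mono this this
  filter_upwards [ae_restrict_mem ((measurableSet_box R T).prod (measurableSet_box R T))] with q hq
  exact hC q (hsub hq)

theorem hasDerivAt_mul_sub {φ g : ℝ → ℝ} {φ' g' : ℝ} {c x y : ℝ} (hφ : HasDerivAt φ φ' x)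
    (hg : HasDerivAt g g' (x - y)) :
    HasDerivAt (fun x => φ x * (c * g (x - y))) (c * (φ' * g (x - y) + φ x * g')) x := by
  have := hφ.mul ((hg.comp_sub_const x y).const_mul c)
  convert! this using 1
  ring

theorem hasDerivAt_mul_sub_right {φ g : ℝ → ℝ} {φ' g' : ℝ} {c x y : ℝ} (hφ : HasDerivAt φ φ' y)
    (hg : HasDerivAt g g' (x - y)) :
    HasDerivAt (fun y => φ y * (c * g (x - y))) (c * (φ' * g (x - y) - φ y * g')) y := by
  have := hφ.mul ((hg.comp_const_sub x y).const_mul c)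
  convert! this using 1
  ring

/-- The doubling of variables for two families of integrated inequalities, with the test functions
`ψ(x) ψ(y) g(x - y) θ(t) θ(s) k(t - s)`. -/
theorem doubling {R T : ℝ} {η F₁ F₂ : (ℝ × ℝ) × (ℝ × ℝ) → ℝ} (iη : Integrable η (box2 R T))
    (i₁ : Integrable F₁ (box2 R T)) (i₂ : Integrable F₂ (box2 R T))
    (h₁ : ∀ᵐ Y ∂(volume.restrict (box R T)), SubSol T (fun X => η (X, Y)) (fun X => F₁ (X, Y)))
    (h₂ : ∀ᵐ X ∂(volume.restrict (box R T)), SubSol T (fun Y => η (X, Y)) (fun Y => F₂ (X, Y)))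
    {ψ θ g k : ℝ → ℝ} (hψ : IsCutoff (Ioo (-R) R) ψ) (hθ : IsCutoff (Ioo 0 T) θ)
    (hg : ContDiff ℝ 1 g) (hk : ContDiff ℝ 1 k) (hg0 : ∀ z, 0 ≤ g z) (hk0 : ∀ z, 0 ≤ k z) :
    0 ≤ ∫ q, (η q * (ψ q.1.1 * ψ q.2.1 * g (q.1.1 - q.2.1) *
        ((deriv θ q.1.2 * θ q.2.2 + θ q.1.2 * deriv θ q.2.2) * k (q.1.2 - q.2.2)))
      + F₁ q * ((deriv ψ q.1.1 * ψ q.2.1 * g (q.1.1 - q.2.1)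
          + ψ q.1.1 * ψ q.2.1 * deriv g (q.1.1 - q.2.1)) *
          (θ q.1.2 * θ q.2.2 * k (q.1.2 - q.2.2)))
      + F₂ q * ((ψ q.1.1 * deriv ψ q.2.1 * g (q.1.1 - q.2.1)
          - ψ q.1.1 * ψ q.2.1 * deriv g (q.1.1 - q.2.1)) *
          (θ q.1.2 * θ q.2.2 * k (q.1.2 - q.2.2)))) ∂(box2 R T) := by
  have cψ := hψ.continuous
  have cψ' := hψ.continuous_deriv
  have cθ := hθ.continuous
  have cθ' := hθ.continuous_deriv
  have cg := hg.continuous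
  have cg' := hg.continuous_deriv le_rfl
  have ck := hk.continuous
  have ck' := hk.continuous_deriv le_rfl
  have dg : ∀ z, HasDerivAt g (deriv g z) z := fun z =>
    (hg.differentiable (by norm_num) z).hasDerivAt
  have dk : ∀ z, HasDerivAt k (deriv k z) z := fun z =>
    (hk.differentiable (by norm_num) z).hasDerivAt
  set g₁ : (ℝ × ℝ) × (ℝ × ℝ) → ℝ := fun q =>
    η q * ((ψ q.1.1 * (ψ q.2.1 * g (q.1.1 - q.2.1))) *
      (θ q.2.2 * (deriv θ q.1.2 * k (q.1.2 - q.2.2) + θ q.1.2 * deriv k (q.1.2 - q.2.2))))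
    + F₁ q * ((ψ q.2.1 * (deriv ψ q.1.1 * g (q.1.1 - q.2.1) + ψ q.1.1 * deriv g (q.1.1 - q.2.1)))
      * (θ q.1.2 * (θ q.2.2 * k (q.1.2 - q.2.2)))) with hg₁
  set g₂ : (ℝ × ℝ) × (ℝ × ℝ) → ℝ := fun q =>
    η q * ((ψ q.2.1 * (ψ q.1.1 * g (q.1.1 - q.2.1))) *
      (θ q.1.2 * (deriv θ q.2.2 * k (q.1.2 - q.2.2) - θ q.2.2 * deriv k (q.1.2 - q.2.2))))
    + F₂ q * ((ψ q.1.1 * (deriv ψ q.2.1 * g (q.1.1 - q.2.1) - ψ q.2.1 * deriv g (q.1.1 - q.2.1)))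
      * (θ q.2.2 * (θ q.1.2 * k (q.1.2 - q.2.2)))) with hg₂
  have j₁ : Integrable g₁ (box2 R T) :=
    (integrable_mul_continuous iη (by fun_prop)).add (integrable_mul_continuous i₁ (by fun_prop))
  have j₂ : Integrable g₂ (box2 R T) :=
    (integrable_mul_continuous iη (by fun_prop)).add (integrable_mul_continuous i₂ (by fun_prop))
  -- For frozen `Y` the test function is a product of the cutoffs `ψ(x) (ψ(y) g(x - y))` and `θ(t)
  -- (θ(s) k(t - s))`; the inequality is then integrated in `Y`.
  have n₁ : 0 ≤ ∫ q, g₁ q ∂(box2 R T) := by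
    rw [box2] at j₁ ⊢
    rw [integral_prod_symm _ j₁]
    refine integral_nonneg_of_ae ?_
    filter_upwards [h₁] with Y hY
    have c1 : IsCutoff (Ioo (-R) R) fun x => ψ x * (ψ Y.1 * g (x - Y.1)) :=
      hψ.mul_right (contDiff_const.mul (hg.comp (contDiff_id.sub contDiff_const)))
        fun x => mul_nonneg (hψ.nonneg _) (hg0 _)
    have c2 : IsCutoff (Ioo 0 T) fun t => θ t * (θ Y.2 * k (t - Y.2)) :=
      hθ.mul_right (contDiff_const.mul (hk.comp (contDiff_id.sub contDiff_const)))
        fun x => mul_nonneg (hθ.nonneg _) (hk0 _)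
    refine (hY R _ _ c1 c2).trans_eq (integral_congr_ae (Eventually.of_forall fun X => ?_))
    simp only [hg₁]
    rw [(hasDerivAt_mul_sub (hψ.hasDerivAt X.1) (dg _)).deriv,
      (hasDerivAt_mul_sub (hθ.hasDerivAt X.2) (dk _)).deriv]
  have n₂ : 0 ≤ ∫ q, g₂ q ∂(box2 R T) := by
    rw [box2] at j₂ ⊢
    rw [integral_prod _ j₂]
    refine integral_nonneg_of_ae ?_
    filter_upwards [h₂] with X hX
    have c1 : IsCutoff (Ioo (-R) R) fun y => ψ y * (ψ X.1 * g (X.1 - y)) :=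
      hψ.mul_right (contDiff_const.mul (hg.comp (contDiff_const.sub contDiff_id)))
        fun x => mul_nonneg (hψ.nonneg _) (hg0 _)
    have c2 : IsCutoff (Ioo 0 T) fun s => θ s * (θ X.2 * k (X.2 - s)) :=
      hθ.mul_right (contDiff_const.mul (hk.comp (contDiff_const.sub contDiff_id)))
        fun x => mul_nonneg (hθ.nonneg _) (hk0 _)
    refine (hX R _ _ c1 c2).trans_eq (integral_congr_ae (Eventually.of_forall fun Y => ?_))
    simp only [hg₂]
    rw [(hasDerivAt_mul_sub_right (hψ.hasDerivAt Y.1) (dg _)).deriv,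
      (hasDerivAt_mul_sub_right (hθ.hasDerivAt Y.2) (dk _)).deriv]
  -- The terms with `k'` cancel, because both inequalities carry the same density `η`. The terms
  -- with `g'` survive in the form `(F₁ - F₂) g'`.
  have := add_nonneg n₁ n₂
  rw [← integral_add j₁ j₂] at this
  refine this.trans_eq (integral_congr_ae (Eventually.of_forall fun q => ?_))
  simp only [hg₁, hg₂]
  ring

/-! ### The Kato inequality -/

theorem integrable_sub_weight {s : Set (ℝ × ℝ)} {v₁ v₂ c₁ c₂ : ℝ × ℝ → ℝ} {M : ℝ}
    (h₁ : IntegrableOn v₁ s) (h₂ : IntegrableOn v₂ s) (hc₁ : Continuous c₁) (hc₂ : Continuous c₂)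
    (hM₁ : ∀ p, ‖c₁ p‖ ≤ M) (hM₂ : ∀ p, ‖c₂ p‖ ≤ M) :
    Integrable (fun p => |v₁ p - v₂ p| * (c₁ p * c₂ p)) (volume.restrict s) := by
  refine ((h₁.integrable.sub h₂.integrable).abs).mul_bdd (c := M * M)
    (hc₁.mul hc₂).aestronglyMeasurable (Eventually.of_forall fun p => ?_)
  rw [norm_mul]
  exact mul_le_mul (hM₁ _) (hM₂ _) (norm_nonneg _) ((norm_nonneg _).trans (hM₁ 0))

/-- Kruzhkov's doubling, where the constants for one solution are the values of the other,
admissible by feasibility. Both doubled fluxes are the same symmetric function, so the derivatives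
of the spatial mollifier cancel too. Splitting the flux into `|P(u₁) - P(u₂)| - |Q(u₁) - Q(u₂)|`
reduces the limit to mollifying differences of integrable functions, with no Lipschitz bound on `f`.
The squares of the cutoffs come from `ψ(x) ψ(y)` and `θ(t) θ(s)` on the diagonal. -/
theorem StripSolution.kato {a T E₁ E₂ : ℝ} {f : ℝ → ℝ} {u₁ w₁ u₂ w₂ : ℝ × ℝ → ℝ}
    (h₁ : StripSolution a T E₁ f u₁ w₁) (h₂ : StripSolution a T E₂ f u₂ w₂) (hf : ConvexFlux f)
    {R : ℝ} {ψ θ : ℝ → ℝ} (hψ : IsCutoff (Ioo (-R) R) ψ) (hθ : IsCutoff (Ioo 0 T) θ) :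
    0 ≤ ∫ p in box R T, ((|u₁ p - u₂ p| + |w₁ p - w₂ p|) * (ψ p.1 ^ 2 * (θ p.2 * deriv θ p.2))
      + Real.sign (u₁ p - u₂ p) * (f (u₁ p) - f (u₂ p)) * (ψ p.1 * deriv ψ p.1 * θ p.2 ^ 2)) := by
  obtain ⟨P, Q, C, hPc, hQc, hP, hQ, hfPQ, hPf, hQf⟩ := hf.exists_monotone_add_antitone
  have iPQ : ∀ {E : ℝ} {u w : ℝ × ℝ → ℝ}, StripSolution a T E f u w →
      IntegrableOn (fun p => P (u p)) (box R T) ∧ IntegrableOn (fun p => Q (u p)) (box R T) := by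
    intro E u w h
    have hb : Integrable (fun x => |f (u x)| + C) (volume.restrict (box R T)) :=
      ((h.flux R).integrable.abs).add (integrable_const C)
    exact ⟨hb.mono' (hPc.comp_aestronglyMeasurable (h.meas_box R).1)
        (Eventually.of_forall fun x => hPf _),
      hb.mono' (hQc.comp_aestronglyMeasurable (h.meas_box R).1)
        (Eventually.of_forall fun x => hQf _)⟩
  simp_rw [ConvexFlux.sign_mul_sub hP hQ hfPQ]
  have e₁ := h₁.entropy
  have e₂ := h₂.entropy
  simp_rw [ConvexFlux.sign_mul_sub hP hQ hfPQ] at e₁ e₂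
  obtain ⟨C₁, hC₁⟩ := hψ.bounded
  obtain ⟨C₂, hC₂⟩ := hθ.bounded
  have cψ := hψ.continuous
  have cψ' := hψ.continuous_deriv
  have cθ := hθ.continuous
  have cθ' := hθ.continuous_deriv
  set ca : ℝ × ℝ → ℝ := fun p => ψ p.1 * deriv θ p.2 with hca
  set cb : ℝ × ℝ → ℝ := fun p => ψ p.1 * θ p.2 with hcb
  set cc : ℝ × ℝ → ℝ := fun p => deriv ψ p.1 * θ p.2 with hcc
  have cca : Continuous ca := by fun_prop
  have ccb : Continuous cb := by fun_prop
  have ccc : Continuous cc := by fun_prop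
  have hC10 : 0 ≤ C₁ := (norm_nonneg _).trans (hC₁ 0).1
  have ba : ∀ p, ‖ca p‖ ≤ C₁ * C₂ := fun p => by
    rw [norm_mul]; exact mul_le_mul (hC₁ _).1 (hC₂ _).2 (norm_nonneg _) hC10
  have bb : ∀ p, ‖cb p‖ ≤ C₁ * C₂ := fun p => by
    rw [norm_mul]; exact mul_le_mul (hC₁ _).1 (hC₂ _).1 (norm_nonneg _) hC10
  have bc : ∀ p, ‖cc p‖ ≤ C₁ * C₂ := fun p => by
    rw [norm_mul]; exact mul_le_mul (hC₁ _).2 (hC₂ _).1 (norm_nonneg _) hC10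
  have hB := isOpen_box R T
  have U1 := tendsto_mollify_weighted hB (h₁.integrable_u R) (h₂.integrable_u R) cca ccb ba bb
  have U2 := tendsto_mollify_weighted hB (h₁.integrable_u R) (h₂.integrable_u R) ccb cca bb ba
  have W1 := tendsto_mollify_weighted hB (h₁.integrable_w R) (h₂.integrable_w R) cca ccb ba bb
  have W2 := tendsto_mollify_weighted hB (h₁.integrable_w R) (h₂.integrable_w R) ccb cca bb ba
  have P1 := tendsto_mollify_weighted hB (iPQ h₁).1 (iPQ h₂).1 ccc ccb bc bb
  have P2 := tendsto_mollify_weighted hB (iPQ h₁).1 (iPQ h₂).1 ccb ccc bb bc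
  have Q1 := tendsto_mollify_weighted hB (iPQ h₁).2 (iPQ h₂).2 ccc ccb bc bb
  have Q2 := tendsto_mollify_weighted hB (iPQ h₁).2 (iPQ h₂).2 ccb ccc bb bc
  have hlim := (((U1.2.add U2.2).add (W1.2.add W2.2)).add (P1.2.add P2.2)).sub (Q1.2.add Q2.2)
  have hge := ge_of_tendsto' hlim (b := 0) ?_
  · have s1 := integrable_sub_weight (h₁.integrable_u R) (h₂.integrable_u R) cca ccb ba bb
    have s2 := integrable_sub_weight (h₁.integrable_u R) (h₂.integrable_u R) ccb cca bb ba
    have s3 := integrable_sub_weight (h₁.integrable_w R) (h₂.integrable_w R) cca ccb ba bb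
    have s4 := integrable_sub_weight (h₁.integrable_w R) (h₂.integrable_w R) ccb cca bb ba
    have s5 := integrable_sub_weight (iPQ h₁).1 (iPQ h₂).1 ccc ccb bc bb
    have s6 := integrable_sub_weight (iPQ h₁).1 (iPQ h₂).1 ccb ccc bb bc
    have s7 := integrable_sub_weight (iPQ h₁).2 (iPQ h₂).2 ccc ccb bc bb
    have s8 := integrable_sub_weight (iPQ h₁).2 (iPQ h₂).2 ccb ccc bb bc
    rw [← integral_add' s1 s2, ← integral_add' s3 s4, ← integral_add' s5 s6, ← integral_add' s7 s8,
      ← integral_add' (s1.add s2) (s3.add s4),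
      ← integral_add' ((s1.add s2).add (s3.add s4)) (s5.add s6),
      ← integral_sub' (((s1.add s2).add (s3.add s4)).add (s5.add s6)) (s7.add s8)] at hge
    -- On the diagonal, the two weights coming from the product rule coincide, which yields a factor
    -- `2` to be removed.
    have := mul_nonneg (by norm_num : (0:ℝ) ≤ 1 / 2) hge
    rw [← integral_const_mul] at this
    refine this.trans_eq (integral_congr_ae (Eventually.of_forall fun p => ?_))
    simp only [hca, hcb, hcc, Pi.add_apply, Pi.sub_apply]
    ring
  · intro n
    have iu : Integrable (fun q : (ℝ × ℝ) × (ℝ × ℝ) => |u₁ q.1 - u₂ q.2|) (box2 R T) :=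
      (((h₁.integrable_u R).integrable.comp_fst _).sub
        ((h₂.integrable_u R).integrable.comp_snd _)).abs
    have iw : Integrable (fun q : (ℝ × ℝ) × (ℝ × ℝ) => |w₁ q.1 - w₂ q.2|) (box2 R T) :=
      (((h₁.integrable_w R).integrable.comp_fst _).sub
        ((h₂.integrable_w R).integrable.comp_snd _)).abs
    have ip : Integrable (fun q : (ℝ × ℝ) × (ℝ × ℝ) => |P (u₁ q.1) - P (u₂ q.2)|) (box2 R T) :=
      (((iPQ h₁).1.integrable.comp_fst _).sub ((iPQ h₂).1.integrable.comp_snd _)).abs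
    have iq : Integrable (fun q : (ℝ × ℝ) × (ℝ × ℝ) => |Q (u₁ q.1) - Q (u₂ q.2)|) (box2 R T) :=
      (((iPQ h₁).2.integrable.comp_fst _).sub ((iPQ h₂).2.integrable.comp_snd _)).abs
    have hd := doubling (iu.add iw) (ip.sub iq) (ip.sub iq) (R := R) (T := T) (g := rho n)
      (k := rho n) ?_ ?_ hψ hθ (rho_contDiff n) (rho_contDiff n) (rho_nonneg n) (rho_nonneg n)
    · rw [box2] at *
      have k1 := integrable_mul_kap U1.1 n
      have k2 := integrable_mul_kap U2.1 n
      have k3 := integrable_mul_kap W1.1 n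
      have k4 := integrable_mul_kap W2.1 n
      have k5 := integrable_mul_kap P1.1 n
      have k6 := integrable_mul_kap P2.1 n
      have k7 := integrable_mul_kap Q1.1 n
      have k8 := integrable_mul_kap Q2.1 n
      rw [← integral_add' k1 k2, ← integral_add' k3 k4, ← integral_add' k5 k6, ← integral_add' k7 k8,
        ← integral_add' (k1.add k2) (k3.add k4),
        ← integral_add' ((k1.add k2).add (k3.add k4)) (k5.add k6),
        ← integral_sub' (((k1.add k2).add (k3.add k4)).add (k5.add k6)) (k7.add k8)]
      refine hd.trans_eq (integral_congr_ae (Eventually.of_forall fun q => ?_))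
      simp only [hca, hcb, hcc, Pi.add_apply, Pi.sub_apply, kap, Prod.fst_sub, Prod.snd_sub]
      ring
    · filter_upwards [h₂.feasible_box R] with Y hY
      exact e₁ _ _ hY
    · filter_upwards [h₁.feasible_box R] with X hX
      refine (e₂ _ _ hX).congr (fun p => ?_) (fun p => ?_)
      · simp only [Pi.add_apply]; rw [abs_sub_comm, abs_sub_comm (w₂ p)]
      · simp only [Pi.sub_apply]; rw [abs_sub_comm, abs_sub_comm (Q (u₂ p))]

end PlayHysteresis

namespace PlayHysteresis

/-! ### The interaction estimate -/

theorem integral_rho_sub_le (n : ℕ) (s : Set ℝ) (t : ℝ) : ∫ r in s, rho n (t - r) ≤ 1 := by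
  rw [← rho_integral n, ← integral_sub_left_eq_self (rho n) volume t]
  exact setIntegral_le_integral ((rho_integrable n).comp_sub_left t)
    (Eventually.of_forall fun r => rho_nonneg n _)

theorem integrable_mul_mul_rho {R T : ℝ} {P A : ℝ × ℝ → ℝ} (hP : IntegrableOn P (box R T))
    (hA : IntegrableOn A (box R T)) (n : ℕ) :
    Integrable (fun q => P q.1 * A q.2 * rho n (q.1.2 - q.2.2)) (box2 R T) := by
  have := rho_continuous n
  exact integrable_mul_continuous (F := fun q => P q.1 * A q.2) (hP.integrable.mul_prod hA.integrable)
    (by fun_prop)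

/-- Averaging a slab bounded function in time against an integrable one. -/
theorem integral_mul_rho_le {R T C : ℝ} {P A : ℝ × ℝ → ℝ} (hP : IntegrableOn P (box R T))
    (hA : IntegrableOn A (box R T)) (hP0 : ∀ p, 0 ≤ P p) (hC : 0 ≤ C)
    (hAC : SlabBound R T C A) (n : ℕ) :
    ∫ q, P q.1 * A q.2 * rho n (q.1.2 - q.2.2) ∂(box2 R T) ≤ C * ∫ p in box R T, P p := by
  have hi := integrable_mul_mul_rho hP hA n
  rw [box2] at hi ⊢
  rw [integral_prod _ hi, ← integral_const_mul]
  refine integral_mono_ae hi.integral_prod_left (hP.integrable.const_mul C) ?_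
  have hc := rho_continuous n
  obtain ⟨M, hM⟩ := rho_bounded n
  refine Eventually.of_forall fun X => ?_
  simp only [mul_assoc]
  rw [integral_const_mul, mul_comm C]
  refine mul_le_mul_of_nonneg_left ?_ (hP0 X)
  have ik : IntegrableOn (fun p : ℝ × ℝ => A p * rho n (X.2 - p.2)) (box R T) :=
    hA.integrable.mul_bdd (c := M) (by fun_prop) (Eventually.of_forall fun p => hM _)
  have := hAC.integral_mul_le (k := fun s => rho n (X.2 - s)) ik
    ((rho_integrable n).comp_sub_left X.2).integrableOn fun t => rho_nonneg n _
  exact this.trans (mul_le_of_le_one_right hC (integral_rho_sub_le n _ _))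

theorem integral_mul_rho_le_swap {R T C : ℝ} {P A : ℝ × ℝ → ℝ} (hP : IntegrableOn P (box R T))
    (hA : IntegrableOn A (box R T)) (hP0 : ∀ p, 0 ≤ P p) (hC : 0 ≤ C)
    (hAC : SlabBound R T C A) (n : ℕ) :
    ∫ q, A q.1 * P q.2 * rho n (q.1.2 - q.2.2) ∂(box2 R T) ≤ C * ∫ p in box R T, P p := by
  refine le_trans (le_of_eq ?_) (integral_mul_rho_le hP hA hP0 hC hAC n)
  rw [box2, ← integral_prod_swap]
  refine integral_congr_ae (Eventually.of_forall fun q => ?_)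
  simp only [Prod.fst_swap, Prod.snd_swap]
  rw [rho_sub_comm, mul_comm (A q.2)]

variable {R T C : ℝ} {D E : ℝ × ℝ → ℝ} {ψ θ : ℝ → ℝ}

/-- Doubling with density `D(X) A(Y)` and fluxes `E(X) A(Y)` and `D(X) B(Y)`: each inequality is
multiplied by a frozen nonnegative factor. Only time is mollified; the spatial kernel `g` is merely
bounded by `1`, as for a smoothed indicator of `x < y`. The terms where a derivative falls on `θ` or
`ψ` are estimated by integrating the other factor in space first, where the slab bound is available.
What is left is the term with `g'`, which localises `E A - D B` near `x = y`. -/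
theorem interaction_pair {A B : ℝ × ℝ → ℝ} (hC : 0 ≤ C)
    (iD : IntegrableOn D (box R T)) (iE : IntegrableOn E (box R T))
    (iA : IntegrableOn A (box R T)) (iB : IntegrableOn B (box R T))
    (hD0 : ∀ p, 0 ≤ D p) (hA0 : ∀ p, 0 ≤ A p) (hDE : SubSol T D E) (hAB : SubSol T A B)
    (sD : SlabBound R T C D) (sA : SlabBound R T C A)
    (hψ : IsCutoff (Ioo (-R) R) ψ) (hθ : IsCutoff (Ioo 0 T) θ) (hψ1 : ∀ x, ψ x ≤ 1)
    (hθ1 : ∀ x, θ x ≤ 1) {g : ℝ → ℝ} (hg : ContDiff ℝ 1 g) (hg0 : ∀ z, 0 ≤ g z)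
    (hg1 : ∀ z, g z ≤ 1) (n : ℕ) :
    Integrable (fun q => (E q.1 * A q.2 - D q.1 * B q.2) * (ψ q.1.1 * ψ q.2.1 *
        (θ q.1.2 * θ q.2.2) * (deriv g (q.1.1 - q.2.1) * rho n (q.1.2 - q.2.2)))) (box2 R T) ∧
    - ∫ q, (E q.1 * A q.2 - D q.1 * B q.2) * (ψ q.1.1 * ψ q.2.1 *
        (θ q.1.2 * θ q.2.2) * (deriv g (q.1.1 - q.2.1) * rho n (q.1.2 - q.2.2))) ∂(box2 R T) ≤
      2 * C * (C * ∫ t in Ioo 0 T, |deriv θ t|) + C * (∫ p in box R T, |E p| * |deriv ψ p.1|)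
        + C * ∫ p in box R T, |B p| * |deriv ψ p.1| := by
  have cψ := hψ.continuous
  have cψ' := hψ.continuous_deriv
  have cθ := hθ.continuous
  have cθ' := hθ.continuous_deriv
  have cg := hg.continuous
  have cg' := hg.continuous_deriv le_rfl
  have ck := rho_continuous n
  obtain ⟨C₁, hC₁⟩ := hψ.bounded
  obtain ⟨C₂, hC₂⟩ := hθ.bounded
  have iDA : Integrable (fun q : (ℝ × ℝ) × (ℝ × ℝ) => D q.1 * A q.2) (box2 R T) :=
    iD.integrable.mul_prod iA.integrable
  have iEA : Integrable (fun q : (ℝ × ℝ) × (ℝ × ℝ) => E q.1 * A q.2) (box2 R T) :=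
    iE.integrable.mul_prod iA.integrable
  have iDB : Integrable (fun q : (ℝ × ℝ) × (ℝ × ℝ) => D q.1 * B q.2) (box2 R T) :=
    iD.integrable.mul_prod iB.integrable
  have hd := doubling iDA iEA iDB (k := rho n) (g := g) (ψ := ψ) (θ := θ) ?_ ?_ hψ hθ hg
    (rho_contDiff n) hg0 (rho_nonneg n)
  rotate_left
  · refine Eventually.of_forall fun Y => ?_
    intro R' ψ' θ' h1 h2
    have := mul_nonneg (hA0 Y) (hDE R' ψ' θ' h1 h2)
    rw [← integral_const_mul] at this
    refine this.trans_eq (integral_congr_ae (Eventually.of_forall fun p => ?_))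
    simp only; ring
  · refine Eventually.of_forall fun X => ?_
    intro R' ψ' θ' h1 h2
    have := mul_nonneg (hD0 X) (hAB R' ψ' θ' h1 h2)
    rw [← integral_const_mul] at this
    refine this.trans_eq (integral_congr_ae (Eventually.of_forall fun p => ?_))
    simp only; ring
  have iDθ : IntegrableOn (fun p => D p * |deriv θ p.2|) (box R T) :=
    iD.integrable.mul_bdd (c := C₂) (by fun_prop) (Eventually.of_forall fun p => by
      simpa using (hC₂ p.2).2)
  have iAθ : IntegrableOn (fun p => A p * |deriv θ p.2|) (box R T) :=
    iA.integrable.mul_bdd (c := C₂) (by fun_prop) (Eventually.of_forall fun p => by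
      simpa using (hC₂ p.2).2)
  have iEψ : IntegrableOn (fun p => |E p| * |deriv ψ p.1|) (box R T) :=
    iE.integrable.abs.mul_bdd (c := C₁) (by fun_prop) (Eventually.of_forall fun p => by
      simpa using (hC₁ p.1).2)
  have iBψ : IntegrableOn (fun p => |B p| * |deriv ψ p.1|) (box R T) :=
    iB.integrable.abs.mul_bdd (c := C₁) (by fun_prop) (Eventually.of_forall fun p => by
      simpa using (hC₁ p.1).2)
  have iθ : IntegrableOn (fun t => |deriv θ t|) (Ioo 0 T) :=
    (hθ.continuous_deriv.integrable_of_hasCompactSupport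
      hθ.hasCompactSupport.deriv).abs.integrableOn
  have l1 := integral_mul_rho_le iDθ iA (fun p => mul_nonneg (hD0 p) (abs_nonneg _)) hC sA n
  have l2 := integral_mul_rho_le_swap iAθ iD (fun p => mul_nonneg (hA0 p) (abs_nonneg _)) hC sD n
  have l3 := integral_mul_rho_le iEψ iA (fun p => mul_nonneg (abs_nonneg _) (abs_nonneg _)) hC sA n
  have l4 := integral_mul_rho_le_swap iBψ iD (fun p => mul_nonneg (abs_nonneg _) (abs_nonneg _))
    hC sD n
  have m1 := sD.integral_mul_le iDθ iθ fun t => abs_nonneg _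
  have m2 := sA.integral_mul_le iAθ iθ fun t => abs_nonneg _
  have j1 := integrable_mul_mul_rho iDθ iA n
  have j2 := integrable_mul_mul_rho iD iAθ n
  have j3 := integrable_mul_mul_rho iEψ iA n
  have j4 := integrable_mul_mul_rho iD iBψ n
  have j5 : Integrable (fun q => (E q.1 * A q.2 - D q.1 * B q.2) * (ψ q.1.1 * ψ q.2.1 *
      (θ q.1.2 * θ q.2.2) * (deriv g (q.1.1 - q.2.1) * rho n (q.1.2 - q.2.2)))) (box2 R T) :=
    integrable_mul_continuous (F := fun q => E q.1 * A q.2 - D q.1 * B q.2) (iEA.sub iDB)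
      (by fun_prop)
  refine ⟨j5, ?_⟩
  have hle := integral_mono (μ := box2 R T) (f := fun q => (D q.1 * A q.2 * (ψ q.1.1 * ψ q.2.1 * g (q.1.1 - q.2.1) *
        ((deriv θ q.1.2 * θ q.2.2 + θ q.1.2 * deriv θ q.2.2) * rho n (q.1.2 - q.2.2)))
      + E q.1 * A q.2 * ((deriv ψ q.1.1 * ψ q.2.1 * g (q.1.1 - q.2.1)
          + ψ q.1.1 * ψ q.2.1 * deriv g (q.1.1 - q.2.1)) *
          (θ q.1.2 * θ q.2.2 * rho n (q.1.2 - q.2.2)))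
      + D q.1 * B q.2 * ((ψ q.1.1 * deriv ψ q.2.1 * g (q.1.1 - q.2.1)
          - ψ q.1.1 * ψ q.2.1 * deriv g (q.1.1 - q.2.1)) *
          (θ q.1.2 * θ q.2.2 * rho n (q.1.2 - q.2.2))))) ?_
      ((((j1.add j2).add j3).add j4).add j5) ?_
  · have hsum := hd.trans hle
    rw [integral_add' (((j1.add j2).add j3).add j4) j5, integral_add' ((j1.add j2).add j3) j4,
      integral_add' (j1.add j2) j3, integral_add' j1 j2] at hsum
    have := mul_le_mul_of_nonneg_left m1 hC
    have := mul_le_mul_of_nonneg_left m2 hC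
    linarith
  · exact ((integrable_mul_continuous iDA (by fun_prop)).add
      (integrable_mul_continuous iEA (by fun_prop))).add
      (integrable_mul_continuous iDB (by fun_prop))
  · intro q
    simp only [Pi.add_apply]
    have a1 : ∀ {c d : ℝ}, 0 ≤ c → c ≤ 1 → 0 ≤ d → d ≤ 1 → 0 ≤ c * d ∧ c * d ≤ 1 :=
      fun h1 h2 h3 h4 => ⟨mul_nonneg h1 h3, mul_le_one₀ h2 h3 h4⟩
    have hx0 := hψ.nonneg q.1.1
    have hy0 := hψ.nonneg q.2.1
    have ht0 := hθ.nonneg q.1.2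
    have hs0 := hθ.nonneg q.2.2
    have hx1 := hψ1 q.1.1
    have hy1 := hψ1 q.2.1
    have ht1 := hθ1 q.1.2
    have hs1 := hθ1 q.2.2
    have hgn := hg0 (q.1.1 - q.2.1)
    have hgo := hg1 (q.1.1 - q.2.1)
    have hr := rho_nonneg n (q.1.2 - q.2.2)
    have hD := hD0 q.1
    have hA := hA0 q.2
    have b1 : ∀ {P c r : ℝ}, 0 ≤ c → c ≤ 1 → 0 ≤ r → P * c * r ≤ |P| * r := by
      intro P c r h1 h2 h3
      refine mul_le_mul_of_nonneg_right ?_ h3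
      calc P * c ≤ |P| * c := mul_le_mul_of_nonneg_right (le_abs_self P) h1
        _ ≤ |P| := mul_le_of_le_one_right (abs_nonneg _) h2
    have w1 := a1 (a1 (a1 hx0 hx1 hy0 hy1).1 (a1 hx0 hx1 hy0 hy1).2 hgn hgo).1
      (a1 (a1 hx0 hx1 hy0 hy1).1 (a1 hx0 hx1 hy0 hy1).2 hgn hgo).2 hs0 hs1
    have w2 := a1 (a1 (a1 hx0 hx1 hy0 hy1).1 (a1 hx0 hx1 hy0 hy1).2 hgn hgo).1
      (a1 (a1 hx0 hx1 hy0 hy1).1 (a1 hx0 hx1 hy0 hy1).2 hgn hgo).2 ht0 ht1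
    have w3 := a1 (a1 hy0 hy1 hgn hgo).1 (a1 hy0 hy1 hgn hgo).2 (a1 ht0 ht1 hs0 hs1).1
      (a1 ht0 ht1 hs0 hs1).2
    have w4 := a1 (a1 hx0 hx1 hgn hgo).1 (a1 hx0 hx1 hgn hgo).2 (a1 ht0 ht1 hs0 hs1).1
      (a1 ht0 ht1 hs0 hs1).2
    have v1 := b1 (P := D q.1 * A q.2 * deriv θ q.1.2) w1.1 w1.2 hr
    have v2 := b1 (P := D q.1 * A q.2 * deriv θ q.2.2) w2.1 w2.2 hr
    have v3 := b1 (P := E q.1 * A q.2 * deriv ψ q.1.1) w3.1 w3.2 hr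
    have v4 := b1 (P := D q.1 * B q.2 * deriv ψ q.2.1) w4.1 w4.2 hr
    simp only [abs_mul, abs_of_nonneg hD, abs_of_nonneg hA] at v1 v2 v3 v4
    linarith

/-- The interaction estimate: the quantity `E (A₁ - A₂) - D (B₁ - B₂)` is controlled by fluxes at the
lateral boundary. -/
theorem interaction {A₁ B₁ A₂ B₂ : ℝ × ℝ → ℝ} {M : ℝ} (hC : 0 ≤ C)
    (iD : IntegrableOn D (box R T)) (iE : IntegrableOn E (box R T))
    (iA₁ : IntegrableOn A₁ (box R T)) (iB₁ : IntegrableOn B₁ (box R T))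
    (iA₂ : IntegrableOn A₂ (box R T)) (iB₂ : IntegrableOn B₂ (box R T))
    (hD0 : ∀ p, 0 ≤ D p) (hA₁0 : ∀ p, 0 ≤ A₁ p) (hA₂0 : ∀ p, 0 ≤ A₂ p)
    (hDE : SubSol T D E) (hAB₁ : SubSol T A₁ B₁) (hAB₂ : SubSol T A₂ B₂)
    (sD : SlabBound R T C D) (sA₁ : SlabBound R T C A₁) (sA₂ : SlabBound R T C A₂)
    (hA : ∀ p, |A₁ p - A₂ p| ≤ M) (hB : ∀ p, |B₁ p - B₂ p| ≤ M)
    (hψ : IsCutoff (Ioo (-R) R) ψ) (hθ : IsCutoff (Ioo 0 T) θ) (hψ1 : ∀ x, ψ x ≤ 1)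
    (hθ1 : ∀ x, θ x ≤ 1) :
    ∫ p in box R T, (E p * (A₁ p - A₂ p) - D p * (B₁ p - B₂ p)) * (ψ p.1 * θ p.2) ^ 2 ≤
      2 * (2 * C * (C * ∫ t in Ioo 0 T, |deriv θ t|)
        + C * ∫ p in box R T, |E p| * |deriv ψ p.1|)
        + (C * (∫ p in box R T, |B₁ p| * |deriv ψ p.1|)
        + C * ∫ p in box R T, |B₂ p| * |deriv ψ p.1|) := by
  have hM0 : 0 ≤ M := (abs_nonneg _).trans (hA 0)
  have cψ := hψ.continuous
  have cθ := hθ.continuous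
  set c : ℝ × ℝ → ℝ := fun p => ψ p.1 * θ p.2 with hc
  have cc : Continuous c := by fun_prop
  have c0 : ∀ p, 0 ≤ c p := fun p => mul_nonneg (hψ.nonneg _) (hθ.nonneg _)
  have c1 : ∀ p, ‖c p‖ ≤ 1 := fun p => by
    rw [Real.norm_of_nonneg (c0 p)]; exact mul_le_one₀ (hψ1 _) (hθ.nonneg _) (hθ1 _)
  have ie : IntegrableOn (fun p => E p * c p) (box R T) :=
    iE.integrable.mul_bdd cc.aestronglyMeasurable (Eventually.of_forall c1)
  have id : IntegrableOn (fun p => D p * c p) (box R T) :=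
    iD.integrable.mul_bdd cc.aestronglyMeasurable (Eventually.of_forall c1)
  have bound : ∀ {r : ℝ} {p}, |r| ≤ M → ‖r * c p‖ ≤ M := fun {r p} h => by
    rw [norm_mul]
    exact (mul_le_mul h (c1 p) (norm_nonneg _) hM0).trans (mul_one M).le
  have ma : AEStronglyMeasurable (fun p => (A₁ p - A₂ p) * c p) (volume.restrict (box R T)) :=
    (iA₁.integrable.1.sub iA₂.integrable.1).mul cc.aestronglyMeasurable
  have mb : AEStronglyMeasurable (fun p => (B₁ p - B₂ p) * c p) (volume.restrict (box R T)) :=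
    (iB₁.integrable.1.sub iB₂.integrable.1).mul cc.aestronglyMeasurable
  have ba : ∀ᵐ p ∂(volume.restrict (box R T)), ‖(A₁ p - A₂ p) * c p‖ ≤ M :=
    Eventually.of_forall fun p => bound (hA p)
  have bb : ∀ᵐ p ∂(volume.restrict (box R T)), ‖(B₁ p - B₂ p) * c p‖ ≤ M :=
    Eventually.of_forall fun p => bound (hB p)
  -- `E` and `D` are merely integrable, so the mollification limit needs a bounded partner. The
  -- entropies `A₁`, `A₂` and the fluxes `B₁`, `B₂` need not be bounded, but their differences are;
  -- hence the two pairs.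
  have t1 := tendsto_mollify_mul (isOpen_box R T) ie ma ba
  have t2 := tendsto_mollify_mul (isOpen_box R T) id mb bb
  have j1 := ie.integrable.mul_bdd ma ba
  have j2 := id.integrable.mul_bdd mb bb
  have t3 := t1.sub t2
  rw [← integral_sub j1 j2] at t3
  refine le_trans (le_of_eq ?_) (le_of_tendsto' t3 (b := 2 * (2 * C * (C * ∫ t in Ioo 0 T, |deriv θ t|)
        + C * ∫ p in box R T, |E p| * |deriv ψ p.1|)
        + (C * (∫ p in box R T, |B₁ p| * |deriv ψ p.1|)
        + C * ∫ p in box R T, |B₂ p| * |deriv ψ p.1|)) fun n => ?_)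
  · refine integral_congr_ae (Eventually.of_forall fun p => ?_)
    simp only [hc]; ring
  -- With `z = x - y`, the kernels `heav n (-z)` and `1 - heav n (-z)` smooth the indicators of `x <
  -- y` and `x > y`. Their derivatives are `-rho n z` and `rho n z`, so adding the estimate for `A₁`
  -- with the first and that for `A₂` with the second produces the differences, mollified in both
  -- variables.
  · have dh : ∀ z, HasDerivAt (fun z => heav n (-z)) (-rho n z) z := fun z => by
      have := (heav_hasDerivAt n (-z)).comp z (hasDerivAt_neg z)
      rw [rho_neg] at this
      convert! this using 1; ring
    have dh' : ∀ z, HasDerivAt (fun z => 1 - heav n (-z)) (rho n z) z := fun z => by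
      convert! (dh z).const_sub 1 using 1; ring
    have ch : ContDiff ℝ 1 fun z => heav n (-z) := (heav_contDiff n).comp contDiff_neg
    obtain ⟨k1, p1⟩ := interaction_pair hC iD iE iA₁ iB₁ hD0 hA₁0 hDE hAB₁ sD sA₁ hψ hθ hψ1 hθ1
      (g := fun z => heav n (-z)) ch (fun z => heav_nonneg n _) (fun z => heav_le_one n _) n
    obtain ⟨k2, p2⟩ := interaction_pair hC iD iE iA₂ iB₂ hD0 hA₂0 hDE hAB₂ sD sA₂ hψ hθ hψ1 hθ1
      (g := fun z => 1 - heav n (-z)) (contDiff_const.sub ch)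
      (fun z => sub_nonneg.2 (heav_le_one n _)) (fun z => sub_le_self _ (heav_nonneg n _)) n
    simp only [(dh _).deriv, (dh' _).deriv] at k1 k2 p1 p2
    have i1 : Integrable (fun q : (ℝ × ℝ) × (ℝ × ℝ) => E q.1 * c q.1 * ((A₁ q.2 - A₂ q.2) * c q.2))
        (box2 R T) := (ie.integrable.comp_fst _).mul_bdd ma.comp_snd
          (Measure.quasiMeasurePreserving_snd.ae ba)
    have i2 : Integrable (fun q : (ℝ × ℝ) × (ℝ × ℝ) => D q.1 * c q.1 * ((B₁ q.2 - B₂ q.2) * c q.2))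
        (box2 R T) := (id.integrable.comp_fst _).mul_bdd mb.comp_snd
          (Measure.quasiMeasurePreserving_snd.ae bb)
    have heq : (∫ q, E q.1 * c q.1 * ((A₁ q.2 - A₂ q.2) * c q.2) * kap n (q.1 - q.2) ∂(box2 R T))
        - (∫ q, D q.1 * c q.1 * ((B₁ q.2 - B₂ q.2) * c q.2) * kap n (q.1 - q.2) ∂(box2 R T)) =
        -(∫ q, (E q.1 * A₁ q.2 - D q.1 * B₁ q.2) * (ψ q.1.1 * ψ q.2.1 *
        (θ q.1.2 * θ q.2.2) * (-rho n (q.1.1 - q.2.1) * rho n (q.1.2 - q.2.2))) ∂(box2 R T)) +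
        -(∫ q, (E q.1 * A₂ q.2 - D q.1 * B₂ q.2) * (ψ q.1.1 * ψ q.2.1 *
        (θ q.1.2 * θ q.2.2) * (rho n (q.1.1 - q.2.1) * rho n (q.1.2 - q.2.2))) ∂(box2 R T)) := by
      rw [← integral_sub (integrable_mul_kap i1 n) (integrable_mul_kap i2 n), ← integral_neg,
        ← integral_neg, ← integral_add k1.fun_neg k2.fun_neg]
      refine integral_congr_ae (Eventually.of_forall fun q => ?_)
      simp only [hc, kap, Prod.fst_sub, Prod.snd_sub]
      ring
    rw [box2] at heq p1 p2
    rw [heq]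
    linarith

end PlayHysteresis

namespace PlayHysteresis

/-! ### Explicit cutoffs -/

theorem IsCutoff.of_eq_zero {s : Set ℝ} {ψ : ℝ → ℝ} {c d : ℝ} (h : ContDiff ℝ 1 ψ)
    (h0 : ∀ x, 0 ≤ ψ x) (hs : Icc c d ⊆ s) (hz : ∀ x, x ∉ Icc c d → ψ x = 0) : IsCutoff s ψ where
  contDiff := h
  hasCompactSupport := HasCompactSupport.intro isCompact_Icc fun x hx => hz x hx
  tsupport_subset := (closure_minimal (fun x hx => by
    by_contra hx'; exact hx (hz x hx')) isClosed_Icc).trans hs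
  nonneg := h0

/-- A cutoff in space, equal to `1` on `[-S/2, S/2]` and supported in `[-S, S]`. -/
noncomputable def cut (S x : ℝ) : ℝ := bump 0 (x / S)

theorem cut_nonneg (S x : ℝ) : 0 ≤ cut S x := (bump 0).nonneg

theorem cut_le_one (S x : ℝ) : cut S x ≤ 1 := (bump 0).le_one

theorem cut_eq_one {S x : ℝ} (hS : 0 < S) (hx : |x| ≤ S / 2) : cut S x = 1 := by
  refine (bump 0).one_of_mem_closedBall ?_
  simp only [bump, mem_closedBall_zero_iff, Real.norm_eq_abs, abs_div, abs_of_pos hS]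
  rw [div_le_iff₀ hS]; norm_num; linarith

theorem cut_eq_zero {S x : ℝ} (hS : 0 < S) (hx : S ≤ |x|) : cut S x = 0 := by
  refine (bump 0).zero_of_le_dist ?_
  simp only [bump, dist_zero_right, Real.norm_eq_abs, abs_div, abs_of_pos hS]
  rw [le_div_iff₀ hS]; norm_num; linarith

theorem cut_isCutoff {S R : ℝ} (hS : 0 < S) (hR : S < R) : IsCutoff (Ioo (-R) R) (cut S) :=
  IsCutoff.of_eq_zero (c := -S) (d := S) ((bump 0).contDiff.comp (contDiff_id.div_const S))
    (cut_nonneg S) (Icc_subset_Ioo (by linarith) hR) fun x hx => cut_eq_zero hS <| by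
      by_contra h
      exact hx (abs_le.1 (not_le.1 h).le)

theorem exists_abs_deriv_cut_le : ∃ K, 0 ≤ K ∧ ∀ S x, 0 < S → |deriv (cut S) x| ≤ K / S := by
  have hb : ContDiff ℝ 1 (bump 0) := (bump 0).contDiff
  obtain ⟨K, hK⟩ := (bump 0).hasCompactSupport.deriv.exists_bound_of_continuous
    (hb.continuous_deriv le_rfl)
  refine ⟨K, (norm_nonneg _).trans (hK 0), fun S x hS => ?_⟩
  have hd : HasDerivAt (cut S) (deriv (bump 0) (x / S) * (1 / S)) x :=
    ((hb.differentiable (by norm_num) (x / S)).hasDerivAt).comp x ((hasDerivAt_id x).div_const S)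
  rw [hd.deriv, abs_mul, abs_of_pos (show 0 < 1 / S by positivity), mul_one_div]
  exact div_le_div_of_nonneg_right (hK _) hS.le

/-- A cutoff in time rising around `t₁` and falling around `t₂`. -/
noncomputable def ramp (n : ℕ) (t₁ t₂ t : ℝ) : ℝ := heav n (t - t₁) * (1 - heav n (t - t₂))

theorem ramp_hasDerivAt (n : ℕ) (t₁ t₂ t : ℝ) : HasDerivAt (ramp n t₁ t₂)
    (rho n (t - t₁) * (1 - heav n (t - t₂)) - heav n (t - t₁) * rho n (t - t₂)) t := by
  have h1 := (heav_hasDerivAt n (t - t₁)).comp_sub_const t t₁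
  have h2 := ((heav_hasDerivAt n (t - t₂)).comp_sub_const t t₂).const_sub 1
  convert! h1.mul h2 using 1; ring

theorem ramp_nonneg (n : ℕ) (t₁ t₂ t : ℝ) : 0 ≤ ramp n t₁ t₂ t :=
  mul_nonneg (heav_nonneg _ _) (sub_nonneg.2 (heav_le_one _ _))

theorem ramp_le_one (n : ℕ) (t₁ t₂ t : ℝ) : ramp n t₁ t₂ t ≤ 1 :=
  mul_le_one₀ (heav_le_one _ _) (sub_nonneg.2 (heav_le_one _ _)) (sub_le_self _ (heav_nonneg _ _))

theorem ramp_isCutoff {n : ℕ} {t₁ t₂ T : ℝ} (h₁ : rad n < t₁) (h₂ : t₂ + rad n < T) :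
    IsCutoff (Ioo 0 T) (ramp n t₁ t₂) := by
  refine IsCutoff.of_eq_zero (c := t₁ - rad n) (d := t₂ + rad n)
    (((heav_contDiff n).comp (contDiff_id.sub contDiff_const)).mul
      (contDiff_const.sub ((heav_contDiff n).comp (contDiff_id.sub contDiff_const))))
    (ramp_nonneg n t₁ t₂) (Icc_subset_Ioo (by linarith) h₂) fun t ht => ?_
  rw [mem_Icc, not_and_or, not_le, not_le] at ht
  rcases ht with ht | ht
  · rw [ramp, heav_eq_zero (by linarith), zero_mul]
  · rw [ramp, heav_eq_one (z := t - t₂) (by linarith), sub_self, mul_zero]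

theorem integral_abs_deriv_ramp_le (n : ℕ) (t₁ t₂ T : ℝ) :
    ∫ t in Ioo 0 T, |deriv (ramp n t₁ t₂) t| ≤ 2 := by
  have i1 : Integrable fun t => rho n (t - t₁) := (rho_integrable n).comp_sub_right t₁
  have i2 : Integrable fun t => rho n (t - t₂) := (rho_integrable n).comp_sub_right t₂
  calc ∫ t in Ioo 0 T, |deriv (ramp n t₁ t₂) t|
      ≤ ∫ t in Ioo 0 T, (rho n (t - t₁) + rho n (t - t₂)) := by
        refine integral_mono_of_nonneg (Eventually.of_forall fun t => abs_nonneg _)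
          (i1.add i2).integrableOn (Eventually.of_forall fun t => ?_)
        simp only [(ramp_hasDerivAt n t₁ t₂ t).deriv]
        refine (abs_sub _ _).trans (add_le_add ?_ ?_)
        · rw [abs_of_nonneg (mul_nonneg (rho_nonneg _ _) (sub_nonneg.2 (heav_le_one _ _)))]
          exact mul_le_of_le_one_right (rho_nonneg _ _) (sub_le_self _ (heav_nonneg _ _))
        · rw [abs_of_nonneg (mul_nonneg (heav_nonneg _ _) (rho_nonneg _ _))]
          exact mul_le_of_le_one_left (rho_nonneg _ _) (heav_le_one _ _)
    _ ≤ ∫ t, (rho n (t - t₁) + rho n (t - t₂)) :=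
        setIntegral_le_integral (i1.add i2) (Eventually.of_forall fun t =>
          add_nonneg (rho_nonneg _ _) (rho_nonneg _ _))
    _ = 2 := by
        rw [integral_add i1 i2, integral_sub_right_eq_self (rho n),
          integral_sub_right_eq_self (rho n), rho_integral]
        norm_num

/-- Time cutoffs exhausting `]0, T[`. -/
noncomputable def tcut (n : ℕ) (T t : ℝ) : ℝ := ramp n (2 * rad n) (T - 2 * rad n) t

theorem tcut_nonneg (n : ℕ) (T t : ℝ) : 0 ≤ tcut n T t := ramp_nonneg _ _ _ _

theorem tcut_le_one (n : ℕ) (T t : ℝ) : tcut n T t ≤ 1 := ramp_le_one _ _ _ _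

theorem tcut_isCutoff (n : ℕ) (T : ℝ) : IsCutoff (Ioo 0 T) (tcut n T) :=
  ramp_isCutoff (by linarith [rad_pos n]) (by linarith [rad_pos n])

theorem tendsto_tcut {T t : ℝ} (ht : t ∈ Ioo 0 T) : Tendsto (fun n => tcut n T t) atTop (𝓝 1) := by
  refine tendsto_const_nhds.congr' ?_
  have h1 : 0 < t / 3 := by linarith [ht.1]
  have h2 : 0 < (T - t) / 3 := by linarith [ht.2]
  filter_upwards [tendsto_rad.eventually (gt_mem_nhds h1),
    tendsto_rad.eventually (gt_mem_nhds h2)] with n hn1 hn2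
  rw [tcut, ramp, heav_eq_one (by linarith), heav_eq_zero (by linarith)]
  norm_num

/-- Uniform bounds with time cutoffs pass to the limit. -/
theorem integral_le_of_tcut {R T c : ℝ} {A : ℝ × ℝ → ℝ} (j : ℕ) (hA : IntegrableOn A (box R T))
    (h : ∀ n, ∫ p in box R T, A p * tcut n T p.2 ^ j ≤ c) : ∫ p in box R T, A p ≤ c := by
  refine le_of_tendsto' (x := atTop) ?_ h
  refine tendsto_integral_of_dominated_convergence (fun p => ‖A p‖) (fun n => ?_) hA.norm
    (fun n => Eventually.of_forall fun p => ?_) ?_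
  · have := (tcut_isCutoff n T).continuous
    exact hA.integrable.1.mul (by fun_prop)
  · rw [norm_mul]
    refine mul_le_of_le_one_right (norm_nonneg _) ?_
    rw [Real.norm_of_nonneg (pow_nonneg (tcut_nonneg n T p.2) _)]
    exact pow_le_one₀ (tcut_nonneg n T p.2) (tcut_le_one n T p.2)
  · filter_upwards [ae_restrict_mem (measurableSet_box R T)] with p hp
    simpa using ((tendsto_tcut hp.2).pow j).const_mul (A p)

/-! ### Growth of the flux -/

theorem integral_box_const {R T : ℝ} (hR : 0 ≤ R) (hT : 0 ≤ T) (c : ℝ) :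
    ∫ _p in box R T, c = c * (2 * R * T) := by
  have := integral_box_mul R T (fun _ => c) fun _ => 1
  simp only [mul_one] at this
  rw [this]
  simp only [integral_const, MeasurableSet.univ, measureReal_restrict_apply, univ_inter,
    Real.volume_real_Ioo_of_le (show -R ≤ R by linarith), Real.volume_real_Ioo_of_le hT,
    smul_eq_mul]
  ring

namespace StripSolution

variable {a T E : ℝ} {f : ℝ → ℝ} {u w : ℝ × ℝ → ℝ}

theorem integral_sq_le (h : StripSolution a T E f u w) (hT : 0 ≤ T) (R : ℝ) :
    ∫ p in box R T, (u p ^ 2 + w p ^ 2) ≤ E * T := by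
  have := (h.slab_sq R).integral_mul_le (k := fun _ => 1)
    (by simpa using h.integrable_sq R) (integrable_const _) (fun _ => zero_le_one)
  simpa [Real.volume_real_Ioo_of_le hT] using this

theorem abs_le_young {l x : ℝ} (hl : 0 < l) : |x| ≤ l + x ^ 2 / l := by
  rw [← sq_abs, ← sub_nonneg]
  have : l + |x| ^ 2 / l - |x| = ((l - |x|) ^ 2 + l * |x|) / l := by field_simp; ring
  rw [this]; positivity

theorem integral_abs_le (h : StripSolution a T E f u w) (hT : 0 ≤ T) {R l : ℝ} (hR : 0 ≤ R)
    (hl : 0 < l) : ∫ p in box R T, |u p| ≤ l * (2 * R * T) + E * T / l := by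
  have i := h.integrable_sq R
  calc ∫ p in box R T, |u p| ≤ ∫ p in box R T, (l + (u p ^ 2 + w p ^ 2) / l) := by
        refine integral_mono (h.integrable_u R).integrable.abs
          ((integrable_const l).add (i.integrable.div_const l)) fun p => ?_
        refine (abs_le_young hl).trans (add_le_add_right ?_ _)
        exact div_le_div_of_nonneg_right (by nlinarith [sq_nonneg (w p)]) hl.le
    _ = l * (2 * R * T) + (∫ p in box R T, (u p ^ 2 + w p ^ 2)) / l := by
        rw [integral_add (integrable_const l) (i.integrable.div_const l), integral_box_const hR hT,
          integral_div]
    _ ≤ _ := by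
        have := div_le_div_of_nonneg_right (h.integral_sq_le hT R) hl.le
        linarith

/-- The parameter `l` balances length against energy in `|x| ≤ l + x² / l`. On lengths of order `N²`
the choice `l = 1 / N` makes both contributions `O(N)`. -/
theorem slab_abs (h : StripSolution a T E f u w) {R l : ℝ} (hR : 0 ≤ R) (hl : 0 < l) :
    SlabBound R T (2 * l * (2 * R) + E / l) fun p => |u p| + |w p| := by
  have hs := h.slab_sq R
  have hi : IntegrableOn (fun p => 2 * l + (u p ^ 2 + w p ^ 2) / l) (box R T) :=
    (integrable_const _).add ((h.integrable_sq R).integrable.div_const l)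
  have hs' : SlabBound R T (2 * l * (2 * R) + E / l)
      fun p => 2 * l + (u p ^ 2 + w p ^ 2) / l := by
    filter_upwards [hs, h.energy] with t ht he
    have i1 : IntegrableOn (fun x => u (x, t) ^ 2 + w (x, t) ^ 2) (Ioo (-R) R) :=
      (he.1.add he.2.1).integrableOn
    rw [integral_add (integrable_const _) (i1.integrable.div_const l), integral_div]
    have := div_le_div_of_nonneg_right ht hl.le
    simp only [integral_const, MeasurableSet.univ, measureReal_restrict_apply, univ_inter,
      Real.volume_real_Ioo_of_le (show -R ≤ R by linarith), smul_eq_mul]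
    linarith
  refine hs'.mono (fun p => by positivity) hi (Eventually.of_forall fun p => ?_)
  have h1 := abs_le_young (x := u p) hl
  have h2 := abs_le_young (x := w p) hl
  rw [add_div]; linarith

theorem weak_eq (h : StripSolution a T E f u w) (hf : ConvexFlux f) (ha : 0 ≤ a) {R : ℝ}
    {ψ θ : ℝ → ℝ} (hψ : IsCutoff (Ioo (-R) R) ψ) (hθ : IsCutoff (Ioo 0 T) θ) :
    ∫ p in box R T, ((u p + w p) * (ψ p.1 * deriv θ p.2) + f (u p) * (deriv ψ p.1 * θ p.2)) = 0 := by
  have h1 := h.weak hf ha (Or.inl rfl) R ψ θ hψ hθ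
  have h2 := h.weak hf ha (Or.inr rfl) R ψ θ hψ hθ
  simp only [one_mul] at h1
  refine le_antisymm ?_ h1
  have : ∀ p : ℝ × ℝ, -1 * (u p + w p) * (ψ p.1 * deriv θ p.2) + -1 * f (u p) * (deriv ψ p.1 * θ p.2)
      = -((u p + w p) * (ψ p.1 * deriv θ p.2) + f (u p) * (deriv ψ p.1 * θ p.2)) := fun p => by ring
  simp_rw [this] at h2
  rw [integral_neg] at h2
  linarith

/-- The balance law with a spatial test function of arbitrary sign. -/
theorem weak_eq_signed (h : StripSolution a T E f u w) (hf : ConvexFlux f) (ha : 0 ≤ a) {S : ℝ}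
    (hS : 0 < S) {ψ θ : ℝ → ℝ} (hψ : ContDiff ℝ 1 ψ) (hψS : ∀ x, |ψ x| ≤ S)
    (hψ0 : ∀ x, S ≤ |x| → ψ x = 0) (hθ : IsCutoff (Ioo 0 T) θ) :
    ∫ p in box (4 * S) T,
      ((u p + w p) * (ψ p.1 * deriv θ p.2) + f (u p) * (deriv ψ p.1 * θ p.2)) = 0 := by
  -- The signed function is the difference of the nonnegative cutoffs `S χ + ψ` and `S χ`, where `χ`
  -- equals `1` for `|x| ≤ S`, a set outside of which `ψ` vanishes.
  have hχ : IsCutoff (Ioo (-(4 * S)) (4 * S)) (cut (2 * S)) :=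
    cut_isCutoff (by linarith) (by linarith)
  have hχS : IsCutoff (Ioo (-(4 * S)) (4 * S)) fun x => cut (2 * S) x * S :=
    hχ.mul_right contDiff_const fun _ => hS.le
  have hψχ : IsCutoff (Ioo (-(4 * S)) (4 * S)) fun x => cut (2 * S) x * S + ψ x := by
    refine IsCutoff.of_eq_zero (c := -(2 * S)) (d := 2 * S) (hχS.contDiff.add hψ) (fun x => ?_)
      (Icc_subset_Ioo (by linarith) (by linarith)) fun x hx => ?_
    · by_cases hx : |x| ≤ S
      · rw [cut_eq_one (by linarith) (by linarith), one_mul]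
        linarith [neg_abs_le (ψ x), hψS x]
      · rw [hψ0 x (not_le.1 hx).le, add_zero]; exact hχS.nonneg x
    · have : 2 * S ≤ |x| := by
        by_contra h'
        exact hx (abs_le.1 (not_le.1 h').le)
      rw [cut_eq_zero (by linarith) this, hψ0 x (by linarith)]; ring
  have e1 := h.weak_eq hf ha hχS hθ
  have e2 := h.weak_eq hf ha hψχ hθ
  have iu : IntegrableOn (fun p => u p + w p) (box (4 * S) T) :=
    (h.integrable_u _).integrable.add (h.integrable_w _).integrable
  have i1 := hχS.integrable_weight hθ iu
  have i2 := hχS.integrable_weight hθ (h.flux (4 * S))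
  have i3 := hψχ.integrable_weight hθ iu
  have i4 := hψχ.integrable_weight hθ (h.flux (4 * S))
  have hd : ∀ x, deriv (fun x => cut (2 * S) x * S + ψ x) x =
      deriv (fun x => cut (2 * S) x * S) x + deriv ψ x := fun x =>
    ((hχS.hasDerivAt x).add (hψ.differentiable (by norm_num) x).hasDerivAt).deriv
  have := congrArg₂ (· - ·) e2 e1
  simp only [sub_zero] at this
  have i5 : IntegrableOn (fun p => (u p + w p) * ((cut (2 * S) p.1 * S + ψ p.1) * deriv θ p.2) +
      f (u p) * (deriv (fun x => cut (2 * S) x * S + ψ x) p.1 * θ p.2)) (box (4 * S) T) :=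
    i3.1.integrable.add i4.2.integrable
  have i6 : IntegrableOn (fun p => (u p + w p) * (cut (2 * S) p.1 * S * deriv θ p.2) +
      f (u p) * (deriv (fun x => cut (2 * S) x * S) p.1 * θ p.2)) (box (4 * S) T) :=
    i1.1.integrable.add i2.2.integrable
  rw [← integral_sub i5 i6] at this
  rw [← this]
  refine integral_congr_ae (Eventually.of_forall fun p => ?_)
  simp only [hd]
  ring

end StripSolution

end PlayHysteresis

namespace PlayHysteresis

theorem exists_rho_zero : ∃ c K : ℝ, 0 < c ∧ 0 ≤ K ∧ (∀ x, rho 0 x ≤ K) ∧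
    ∀ x, |x| ≤ 1 / 2 → c ≤ rho 0 x := by
  obtain ⟨K, hK⟩ := rho_bounded 0
  refine ⟨1 / ∫ x, bump 0 x, K, one_div_pos.2 (bump 0).integral_pos, (norm_nonneg _).trans (hK 0),
    fun x => (le_abs_self _).trans (hK x), fun x hx => ?_⟩
  rw [rho, ContDiffBump.normed_def, (bump 0).one_of_mem_closedBall]
  simpa [bump] using hx

theorem rad_zero : rad 0 = 1 := by simp [rad]

namespace StripSolution

variable {a T E : ℝ} {f : ℝ → ℝ} {u w : ℝ × ℝ → ℝ}

/-- The first growth estimate for the flux, integrated against a cutoff. -/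
theorem growth_weighted (h : StripSolution a T E f u w) (hf : ConvexFlux f) (ha : 0 ≤ a)
    {S l K : ℝ} (hS : 1 ≤ S) (hl : 0 < l) (hK : ∀ x, rho 0 x ≤ K) (hK0 : 0 ≤ K)
    {θ : ℝ → ℝ} (hθ : IsCutoff (Ioo 0 T) θ) (hθ1 : ∀ t, θ t ≤ 1)
    (hθ2 : ∫ t in Ioo 0 T, |deriv θ t| ≤ 2) (hE : 0 ≤ E) :
    ∫ p in box (4 * S) T, f (u p) * (rho 0 (p.1 / S) * θ p.2) ≤
      S * (K * ∫ p in box 1 T, |f (u p)|) + S * ((2 * l * (2 * (4 * S)) + E / l) * 2) := by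
  have hS0 : 0 < S := by linarith
  -- The derivative `ρ(x / S) - S ρ(x)` has mean zero, so `ψ` has compact support. It compares the
  -- flux averaged at scale `S` with the flux in `box 1 T`.
  set ψ : ℝ → ℝ := fun x => S * (heav 0 (x / S) - heav 0 x) with hψ
  have hψd : ∀ x, HasDerivAt ψ (rho 0 (x / S) - S * rho 0 x) x := fun x => by
    have h1 := (heav_hasDerivAt 0 (x / S)).comp x ((hasDerivAt_id x).div_const S)
    have h2 := (h1.sub (heav_hasDerivAt 0 x)).const_mul S
    convert! h2 using 1
    field_simp
  have hψc : ContDiff ℝ 1 ψ := contDiff_const.mul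
    (((heav_contDiff 0).comp (contDiff_id.div_const S)).sub (heav_contDiff 0))
  have hψS : ∀ x, |ψ x| ≤ S := fun x => by
    rw [hψ, abs_mul, abs_of_pos hS0]
    refine mul_le_of_le_one_right hS0.le (abs_le.2 ⟨?_, ?_⟩) <;>
    linarith [heav_nonneg 0 (x / S), heav_le_one 0 (x / S), heav_nonneg 0 x, heav_le_one 0 x]
  have hψ0 : ∀ x, S ≤ |x| → ψ x = 0 := fun x hx => by
    rcases le_abs.1 hx with hx | hx
    · have : 1 ≤ x / S := by rwa [le_div_iff₀ hS0, one_mul]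
      simp only [hψ]
      rw [heav_eq_one (by rw [rad_zero]; exact this), heav_eq_one (by rw [rad_zero]; linarith)]
      ring
    · have : x / S ≤ -1 := by rw [div_le_iff₀ hS0]; linarith
      simp only [hψ]
      rw [heav_eq_zero (by rw [rad_zero]; exact this), heav_eq_zero (by rw [rad_zero]; linarith)]
      ring
  have key := h.weak_eq_signed hf ha hS0 hψc hψS hψ0 hθ
  obtain ⟨Cθ, hCθ⟩ := hθ.bounded
  have cρ := rho_continuous 0
  have cθ := hθ.continuous
  have cθ' := hθ.continuous_deriv
  have cψ := hψc.continuous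
  have if' := h.flux (4 * S)
  have iu := h.integrable_u (4 * S)
  have iw := h.integrable_w (4 * S)
  have i1 : IntegrableOn (fun p => (u p + w p) * (ψ p.1 * deriv θ p.2)) (box (4 * S) T) :=
    integrable_mul_weight (iu.integrable.add iw.integrable) cψ cθ' hψS fun t => (hCθ t).2
  have hρK : ∀ x, ‖rho 0 x‖ ≤ K := fun x => by rw [Real.norm_of_nonneg (rho_nonneg 0 x)]; exact hK x
  have i2 : IntegrableOn (fun p => f (u p) * (rho 0 (p.1 / S) * θ p.2)) (box (4 * S) T) :=
    integrable_mul_weight if' (g := fun x => rho 0 (x / S)) (by fun_prop) cθ (fun x => hρK _)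
      fun t => (hCθ t).1
  have i3 : IntegrableOn (fun p => f (u p) * (rho 0 p.1 * θ p.2)) (box (4 * S) T) :=
    integrable_mul_weight if' cρ cθ hρK fun t => (hCθ t).1
  have e1 : ∫ p in box (4 * S) T, ((u p + w p) * (ψ p.1 * deriv θ p.2)
      + f (u p) * (deriv ψ p.1 * θ p.2)) = (∫ p in box (4 * S) T, (u p + w p) * (ψ p.1 * deriv θ p.2))
      + ((∫ p in box (4 * S) T, f (u p) * (rho 0 (p.1 / S) * θ p.2))
      - S * ∫ p in box (4 * S) T, f (u p) * (rho 0 p.1 * θ p.2)) := by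
    have i4 : IntegrableOn (fun p => f (u p) * (rho 0 (p.1 / S) * θ p.2) -
        S * (f (u p) * (rho 0 p.1 * θ p.2))) (box (4 * S) T) :=
      i2.integrable.sub (i3.integrable.const_mul S)
    rw [← integral_const_mul, ← integral_sub i2 (i3.integrable.const_mul S),
      ← integral_add i1 i4]
    refine integral_congr_ae (Eventually.of_forall fun p => ?_)
    simp only [(hψd _).deriv]
    ring
  rw [e1] at key
  have b1 : ∫ p in box (4 * S) T, f (u p) * (rho 0 p.1 * θ p.2) ≤ K * ∫ p in box 1 T, |f (u p)| := by
    have hsub : box 1 T ⊆ box (4 * S) T := box_mono (by linarith) T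
    rw [setIntegral_eq_of_subset_of_forall_sdiff_eq_zero (measurableSet_box _ _) hsub,
      ← integral_const_mul]
    · refine integral_mono (i3.mono_set hsub).integrable ((h.flux 1).integrable.abs.const_mul K)
        fun p => ?_
      calc f (u p) * (rho 0 p.1 * θ p.2) ≤ |f (u p)| * (rho 0 p.1 * θ p.2) :=
            mul_le_mul_of_nonneg_right (le_abs_self _) (mul_nonneg (rho_nonneg _ _) (hθ.nonneg _))
        _ ≤ |f (u p)| * (K * 1) := by
            refine mul_le_mul_of_nonneg_left ?_ (abs_nonneg _)
            exact mul_le_mul (hK _) (hθ1 _) (hθ.nonneg _) hK0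
        _ = K * |f (u p)| := by ring
    · intro p hp
      have : 1 ≤ |p.1| := by
        by_contra hlt
        refine hp.2 ⟨?_, hp.1.2⟩
        rw [mem_Ioo, ← abs_lt]; linarith
      rw [rho_eq_zero (by rw [rad_zero]; exact this)]; ring
  have b2 : |∫ p in box (4 * S) T, (u p + w p) * (ψ p.1 * deriv θ p.2)| ≤
      S * ((2 * l * (2 * (4 * S)) + E / l) * 2) := by
    have iθ : IntegrableOn (fun t => |deriv θ t|) (Ioo 0 T) :=
      (hθ.continuous_deriv.integrable_of_hasCompactSupport
        hθ.hasCompactSupport.deriv).abs.integrableOn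
    have i4 : IntegrableOn (fun p => (|u p| + |w p|) * |deriv θ p.2|) (box (4 * S) T) :=
      (iu.integrable.abs.add iw.integrable.abs).mul_bdd (c := Cθ) (by fun_prop)
        (Eventually.of_forall fun p => by simpa using (hCθ p.2).2)
    have hsl := (h.slab_abs (R := 4 * S) (by linarith) hl).integral_mul_le i4 iθ
      fun t => abs_nonneg _
    have hC0 : 0 ≤ 2 * l * (2 * (4 * S)) + E / l := by positivity
    calc |∫ p in box (4 * S) T, (u p + w p) * (ψ p.1 * deriv θ p.2)|
        ≤ ∫ p in box (4 * S) T, |(u p + w p) * (ψ p.1 * deriv θ p.2)| :=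
          abs_integral_le_integral_abs
      _ ≤ ∫ p in box (4 * S) T, S * ((|u p| + |w p|) * |deriv θ p.2|) := by
          refine integral_mono i1.integrable.abs (i4.integrable.const_mul S) fun p => ?_
          simp only [abs_mul]
          calc |u p + w p| * (|ψ p.1| * |deriv θ p.2|) ≤ (|u p| + |w p|) * (S * |deriv θ p.2|) :=
                mul_le_mul (abs_add_le _ _) (mul_le_mul_of_nonneg_right (hψS _) (abs_nonneg _))
                  (by positivity) (by positivity)
            _ = S * ((|u p| + |w p|) * |deriv θ p.2|) := by ring
      _ ≤ S * ((2 * l * (2 * (4 * S)) + E / l) * 2) := by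
          rw [integral_const_mul]
          exact mul_le_mul_of_nonneg_left (hsl.trans (mul_le_mul_of_nonneg_left hθ2 hC0)) hS0.le
  have b3 := neg_abs_le (∫ p in box (4 * S) T, (u p + w p) * (ψ p.1 * deriv θ p.2))
  have b4 := mul_le_mul_of_nonneg_left b1 hS0.le
  linarith

/-- The flux over large boxes grows slower than the square of their size. -/
theorem growth (h : StripSolution a T E f u w) (hf : ConvexFlux f) (ha : 0 ≤ a) (hT : 0 ≤ T)
    (hE : 0 ≤ E) : ∃ C, 0 ≤ C ∧ ∀ N : ℝ, 1 ≤ N → ∫ p in box (N ^ 2) T, |f (u p)| ≤ C * N ^ 3 := by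
  obtain ⟨c₀, K, hc₀, hK0, hK, hcρ⟩ := exists_rho_zero
  set m := |f 0| + |deriv f 0| with hm
  have hm0 : 0 ≤ m := by positivity
  -- The tangent at `0` bounds `f` below by a quadratic, whose integral the energy controls. Hence
  -- an upper bound for a weighted integral of `f(u)` is also one for `|f(u)|`.
  have hlow : ∀ v, -(m * (2 + v ^ 2)) ≤ f v := fun v => by
    have h1 := hf.tangent_le 0 v
    rw [sub_zero] at h1
    have h2 : |deriv f 0 * v| ≤ |deriv f 0| * (2 + v ^ 2) := by
      rw [abs_mul]
      refine mul_le_mul_of_nonneg_left ?_ (abs_nonneg _)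
      nlinarith [sq_nonneg (|v| - 1), sq_abs v]
    have h3 : |f 0| * 1 ≤ |f 0| * (2 + v ^ 2) :=
      mul_le_mul_of_nonneg_left (by nlinarith [sq_nonneg v]) (abs_nonneg _)
    have h4 := neg_abs_le (f 0)
    have h5 := neg_abs_le (deriv f 0 * v)
    rw [hm, add_mul]; linarith
  set F := ∫ p in box 1 T, |f (u p)| with hF
  have hF0 : 0 ≤ F := integral_nonneg fun p => abs_nonneg _
  refine ⟨(2 * (K * F) + 2 * ((32 + E) * 2) + 2 * m * K * (32 * T + E * T)) / c₀, by positivity,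
    fun N hN => ?_⟩
  rw [div_mul_eq_mul_div, le_div_iff₀ hc₀, ← integral_mul_const]
  -- On the box of half-width `N²` one has `|x / S| ≤ 1 / 2`, where `rho 0` is at least `c₀`.
  set S := 2 * N ^ 2 with hS
  have hS1 : 1 ≤ S := by nlinarith
  have hN0 : 0 < N := by linarith
  refine integral_le_of_tcut (T := T) 1 ((h.flux _).integrable.abs.mul_const c₀) fun n => ?_
  have hθ := tcut_isCutoff n T
  -- With `l = 1 / N` the slab bound for `|u| + |w|` is `(32 + E) N`; multiplied by the size `S = 2
  -- N²` of the test function it gives the order `N³`.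
  have hg := h.growth_weighted hf ha hS1 (l := 1 / N) (by positivity) hK hK0 hθ
    (tcut_le_one n T) (integral_abs_deriv_ramp_le n _ _ T) hE
  have cρ := rho_continuous 0
  have cθ := hθ.continuous
  obtain ⟨Cθ, hCθ⟩ := hθ.bounded
  have hρK : ∀ x, ‖rho 0 x‖ ≤ K := fun x => by rw [Real.norm_of_nonneg (rho_nonneg 0 x)]; exact hK x
  have isq : IntegrableOn (fun p => 2 + (u p ^ 2 + w p ^ 2)) (box (4 * S) T) :=
    (integrable_const _).add (h.integrable_sq _).integrable
  have i2 : IntegrableOn (fun p => f (u p) * (rho 0 (p.1 / S) * tcut n T p.2)) (box (4 * S) T) :=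
    integrable_mul_weight (h.flux _) (g := fun x => rho 0 (x / S)) (by fun_prop) cθ (fun x => hρK _)
      fun t => (hCθ t).1
  have i3 : IntegrableOn (fun p => 2 * m * (2 + (u p ^ 2 + w p ^ 2)) *
      (rho 0 (p.1 / S) * tcut n T p.2)) (box (4 * S) T) :=
    integrable_mul_weight (isq.integrable.const_mul (2 * m)) (g := fun x => rho 0 (x / S))
      (by fun_prop) cθ (fun x => hρK _) fun t => (hCθ t).1
  have hsub : box (N ^ 2) T ⊆ box (4 * S) T := box_mono (by nlinarith) T
  have hpos : ∀ p, |f (u p)| ≤ f (u p) + 2 * m * (2 + (u p ^ 2 + w p ^ 2)) := fun p => by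
    have h1 := hlow (u p)
    have h2 : 0 ≤ m * w p ^ 2 := by positivity
    have h3 : 0 ≤ m * (2 + u p ^ 2) := by positivity
    rw [abs_le]; constructor <;> nlinarith
  have hw0 : ∀ p : ℝ × ℝ, 0 ≤ rho 0 (p.1 / S) * tcut n T p.2 := fun p =>
    mul_nonneg (rho_nonneg _ _) (tcut_nonneg _ _ _)
  have hsum : IntegrableOn (fun p => (f (u p) + 2 * m * (2 + (u p ^ 2 + w p ^ 2))) *
      (rho 0 (p.1 / S) * tcut n T p.2)) (box (4 * S) T) := by
    refine (i2.integrable.add i3.integrable).congr (Eventually.of_forall fun p => ?_)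
    simp only [Pi.add_apply]; ring
  have hsq : ∫ p in box (4 * S) T, (2 + (u p ^ 2 + w p ^ 2)) ≤ 2 * (2 * (4 * S) * T) + E * T := by
    rw [integral_add (integrable_const _) (h.integrable_sq _).integrable,
      integral_box_const (by linarith) hT]
    linarith [h.integral_sq_le hT (4 * S)]
  calc ∫ p in box (N ^ 2) T, |f (u p)| * c₀ * tcut n T p.2 ^ 1
      ≤ ∫ p in box (N ^ 2) T, (f (u p) + 2 * m * (2 + (u p ^ 2 + w p ^ 2))) *
          (rho 0 (p.1 / S) * tcut n T p.2) := by
        refine integral_mono_of_nonneg (Eventually.of_forall fun p => ?_)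
          (hsum.mono_set hsub).integrable ?_
        · exact mul_nonneg (by positivity) (pow_nonneg (tcut_nonneg _ _ _) _)
        · filter_upwards [ae_restrict_mem (measurableSet_box _ _)] with p hp
          rw [pow_one, mul_assoc]
          refine mul_le_mul (hpos p) (mul_le_mul_of_nonneg_right (hcρ _ ?_) (tcut_nonneg _ _ _))
            (mul_nonneg hc₀.le (tcut_nonneg _ _ _)) ((abs_nonneg _).trans (hpos p))
          rw [abs_div, abs_of_pos (show 0 < S by linarith), div_le_iff₀ (by linarith)]
          have := abs_lt.2 (mem_Ioo.1 hp.1)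
          rw [hS]; linarith
    _ ≤ ∫ p in box (4 * S) T, (f (u p) + 2 * m * (2 + (u p ^ 2 + w p ^ 2))) *
          (rho 0 (p.1 / S) * tcut n T p.2) :=
        setIntegral_mono_set hsum (Eventually.of_forall fun p =>
          mul_nonneg ((abs_nonneg _).trans (hpos p)) (hw0 p)) hsub.eventuallyLE
    _ = (∫ p in box (4 * S) T, f (u p) * (rho 0 (p.1 / S) * tcut n T p.2)) +
        ∫ p in box (4 * S) T, 2 * m * (2 + (u p ^ 2 + w p ^ 2)) *
          (rho 0 (p.1 / S) * tcut n T p.2) := by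
        rw [← integral_add i2 i3]
        refine integral_congr_ae (Eventually.of_forall fun p => ?_)
        simp only; ring
    _ ≤ (S * (K * F) + S * ((2 * (1 / N) * (2 * (4 * S)) + E / (1 / N)) * 2)) +
        2 * m * K * (2 * (2 * (4 * S) * T) + E * T) := by
        refine add_le_add hg ?_
        calc ∫ p in box (4 * S) T, 2 * m * (2 + (u p ^ 2 + w p ^ 2)) *
              (rho 0 (p.1 / S) * tcut n T p.2)
            ≤ ∫ p in box (4 * S) T, 2 * m * K * (2 + (u p ^ 2 + w p ^ 2)) := by
              refine integral_mono i3 (isq.integrable.const_mul _) fun p => ?_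
              have h1 : rho 0 (p.1 / S) * tcut n T p.2 ≤ K * 1 :=
                mul_le_mul (hK _) (tcut_le_one _ _ _) (tcut_nonneg _ _ _) hK0
              have h2 : 0 ≤ 2 * m * (2 + (u p ^ 2 + w p ^ 2)) := by positivity
              have := mul_le_mul_of_nonneg_left h1 h2
              simp only; linarith
          _ ≤ _ := by
              rw [integral_const_mul]
              exact mul_le_mul_of_nonneg_left hsq (by positivity)
    _ ≤ (2 * (K * F) + 2 * ((32 + E) * 2) + 2 * m * K * (32 * T + E * T)) * N ^ 3 := by
        have e1 : (2 * (1 / N) * (2 * (4 * S)) + E / (1 / N)) = (32 + E) * N := by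
          rw [hS]; field_simp; ring
        rw [e1]
        have hN3 : N ^ 2 ≤ N ^ 3 := pow_le_pow_right₀ hN (by norm_num)
        have hN1 : 1 ≤ N ^ 3 := one_le_pow₀ hN
        have a1 : S * (K * F) ≤ 2 * (K * F) * N ^ 3 := by
          rw [hS]; nlinarith [mul_nonneg hK0 hF0]
        have a2 : S * ((32 + E) * N * 2) = 2 * ((32 + E) * 2) * N ^ 3 := by rw [hS]; ring
        have a3 : 2 * (2 * (4 * S) * T) + E * T ≤ (32 * T + E * T) * N ^ 3 := by
          have : 0 ≤ E * T := by positivity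
          rw [hS]; nlinarith
        have a4 := mul_le_mul_of_nonneg_left a3 (show 0 ≤ 2 * m * K by positivity)
        linarith

end StripSolution

end PlayHysteresis

/-! ### Tails of the flux through commutators of half entropies -/

namespace PlayHysteresis

theorem measurable_upFlux {f : ℝ → ℝ} (hf : Continuous f) (k : ℝ) : Measurable (upFlux f k) :=
  Measurable.ite (measurableSet_lt measurable_const measurable_id)
    (hf.measurable.sub measurable_const) measurable_const

theorem abs_halfEnt_sub_le (a k l v z : ℝ) :
    |halfEnt a k v z - halfEnt a l v z| ≤ 2 * |k - l| := by
  have h1 := abs_max_sub_max_le_abs (v - k) (v - l) 0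
  have h2 := abs_max_sub_max_le_abs (z - k - a) (z - l - a) 0
  have e1 : v - k - (v - l) = -(k - l) := by ring
  have e2 : z - k - a - (z - l - a) = -(k - l) := by ring
  rw [e1, abs_neg] at h1
  rw [e2, abs_neg] at h2
  unfold halfEnt
  calc _ = |(max (v - k) 0 - max (v - l) 0) + (max (z - k - a) 0 - max (z - l - a) 0)| := by
        congr 1; ring
    _ ≤ _ := (abs_add_le _ _).trans (by linarith)

/-- The difference is a truncation: zero below `k`, nondecreasing from `0` to `g l - g k` between
`k` and `l`, constant above `l`. -/
theorem abs_upFlux_sub_le {g : ℝ → ℝ} {k l : ℝ} (hg : MonotoneOn g (Ici k)) (hkl : k ≤ l) (v : ℝ) :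
    |upFlux g k v - upFlux g l v| ≤ g l - g k := by
  have h0 : g k ≤ g l := hg (mem_Ici.2 le_rfl) (mem_Ici.2 hkl) hkl
  unfold upFlux
  split_ifs with h1 h2 h2
  · rw [abs_of_nonneg] <;> linarith
  · have h3 := hg (mem_Ici.2 h1.le) (mem_Ici.2 hkl) (not_lt.1 h2)
    have h4 := hg (mem_Ici.2 le_rfl) (mem_Ici.2 h1.le) h1.le
    rw [abs_of_nonneg] <;> linarith
  · linarith
  · simpa using h0

/-- Above the threshold `l + 2 a`, half entropies differ by constants. -/
theorem halfEnt_commutator {a k l v z : ℝ} {g : ℝ → ℝ} (ha : 0 ≤ a) (hkl : k ≤ l)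
    (h : |v - z| ≤ a) :
    upFlux g (l + 2 * a) v * (halfEnt a k v z - halfEnt a l v z) -
      halfEnt a (l + 2 * a) v z * (upFlux g k v - upFlux g l v) =
    2 * (l - k) * upFlux g (l + 2 * a) v - halfEnt a (l + 2 * a) v z * (g l - g k) := by
  have h' := abs_le.1 h
  by_cases hv : l + 2 * a < v
  -- From `v > l + 2 a` and `|v - z| ≤ a` follows `z > l + a`, so all four positive parts are
  -- active. In the other case, feasibility makes both the high entropy and its flux vanish.
  · have e1 : halfEnt a k v z - halfEnt a l v z = 2 * (l - k) := by
      unfold halfEnt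
      rw [max_eq_left, max_eq_left, max_eq_left, max_eq_left] <;> linarith
    have e2 : upFlux g k v - upFlux g l v = g l - g k := by
      unfold upFlux
      rw [if_pos (by linarith), if_pos (by linarith)]; ring
    rw [e1, e2]; ring
  · have e1 : upFlux g (l + 2 * a) v = 0 := if_neg hv
    have e2 : halfEnt a (l + 2 * a) v z = 0 := by
      unfold halfEnt
      rw [max_eq_right, max_eq_right] <;> linarith
    rw [e1, e2]; ring

namespace StripSolution

variable {a T E : ℝ} {f : ℝ → ℝ} {u w : ℝ × ℝ → ℝ}

theorem integrable_upFlux (h : StripSolution a T E f u w) (hf : ConvexFlux f) {σ : ℝ}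
    (hσ : σ = 1 ∨ σ = -1) (k R : ℝ) :
    IntegrableOn (fun p => σ * upFlux (fun v => f (σ * v)) k (σ * u p)) (box R T) := by
  have hσσ : σ * σ = 1 := by rcases hσ with rfl | rfl <;> norm_num
  refine Integrable.const_mul ?_ σ
  have hb : Integrable (fun p => |f (u p)| + |f (σ * k)|) (volume.restrict (box R T)) :=
    (h.flux R).integrable.abs.add (integrable_const _)
  refine hb.mono' ?_ (Eventually.of_forall fun p => ?_)
  · exact ((measurable_upFlux (hf.comp_mul σ).continuous k).comp_aemeasurable
      ((h.meas_box R).1.aemeasurable.const_mul σ)).aestronglyMeasurable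
  · have := abs_upFlux_le (fun v => f (σ * v)) k (σ * u p)
    rwa [← mul_assoc, hσσ, one_mul] at this

theorem integrable_halfEnt (h : StripSolution a T E f u w) (σ k R : ℝ) :
    IntegrableOn (fun p => halfEnt a k (σ * u p) (σ * w p)) (box R T) :=
  ((((h.integrable_u R).integrable.const_mul σ).sub (integrable_const k)).pos_part).add
    (((((h.integrable_w R).integrable.const_mul σ).sub (integrable_const k)).sub
      (integrable_const a)).pos_part)

theorem halfEnt_le_sq (h : StripSolution a T E f u w) {σ : ℝ} (hσ : σ = 1 ∨ σ = -1) {k : ℝ}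
    (hk : 1 ≤ k) (R : ℝ) : ∀ᵐ p ∂(volume.restrict (box R T)),
      halfEnt a k (σ * u p) (σ * w p) ≤ 2 * (u p ^ 2 + w p ^ 2) := by
  filter_upwards [h.feasible_box R] with p hp
  have : |σ * u p - σ * w p| ≤ a := by
    rw [← mul_sub, abs_mul]; rcases hσ with rfl | rfl <;> simpa using hp
  refine (halfEnt_le hk this).trans ?_
  rcases hσ with rfl | rfl <;> nlinarith [sq_nonneg (w p)]

theorem slab_halfEnt (h : StripSolution a T E f u w) {σ : ℝ} (hσ : σ = 1 ∨ σ = -1) {k : ℝ}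
    (hk : 1 ≤ k) (R : ℝ) :
    SlabBound R T (2 * E) fun p => halfEnt a k (σ * u p) (σ * w p) := by
  have hs : SlabBound R T (2 * E) fun p => 2 * (u p ^ 2 + w p ^ 2) := by
    filter_upwards [h.slab_sq R] with t ht
    rw [integral_const_mul]; linarith
  exact hs.mono (fun p => halfEnt_nonneg _ _ _ _) ((h.integrable_sq R).integrable.const_mul 2)
    (h.halfEnt_le_sq hσ hk R)

/-- The flux integrated against the derivative of a wide cutoff. -/
theorem upFlux_mul_deriv_cut (h : StripSolution a T E f u w) (hf : ConvexFlux f) (ha : 0 ≤ a)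
    (hT : 0 ≤ T) (hE : 0 ≤ E) {σ : ℝ} (hσ : σ = 1 ∨ σ = -1) (k : ℝ) :
    ∃ C, 0 ≤ C ∧ ∀ N : ℝ, 1 ≤ N → ∫ p in box ((2 * N) ^ 2) T,
      |σ * upFlux (fun v => f (σ * v)) k (σ * u p)| * |deriv (cut (2 * N ^ 2)) p.1| ≤ C * N := by
  have hσσ : σ * σ = 1 := by rcases hσ with rfl | rfl <;> norm_num
  have hσa : |σ| = 1 := by rcases hσ with rfl | rfl <;> norm_num
  obtain ⟨Cg, hCg, hg⟩ := h.growth hf ha hT hE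
  obtain ⟨K, hK0, hK⟩ := exists_abs_deriv_cut_le
  refine ⟨K * (4 * Cg + 4 * |f (σ * k)| * T), by positivity, fun N hN => ?_⟩
  have hN0 : 0 < N := by linarith
  have iF : IntegrableOn (fun p => (|f (u p)| + |f (σ * k)|) * (K / (2 * N ^ 2)))
      (box ((2 * N) ^ 2) T) :=
    ((h.flux _).integrable.abs.add (integrable_const _)).mul_const _
  calc _ ≤ ∫ p in box ((2 * N) ^ 2) T, (|f (u p)| + |f (σ * k)|) * (K / (2 * N ^ 2)) := by
        refine integral_mono_of_nonneg (Eventually.of_forall fun p => by positivity) iF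
          (Eventually.of_forall fun p => ?_)
        have h1 := abs_upFlux_le (fun v => f (σ * v)) k (σ * u p)
        rw [← mul_assoc, hσσ, one_mul] at h1
        have h2 := hK (2 * N ^ 2) p.1 (by positivity)
        simp only [abs_mul, hσa, one_mul]
        exact mul_le_mul h1 h2 (abs_nonneg _) (by positivity)
    _ = ((∫ p in box ((2 * N) ^ 2) T, |f (u p)|) + |f (σ * k)| * (2 * (2 * N) ^ 2 * T)) *
          (K / (2 * N ^ 2)) := by
        rw [integral_mul_const, integral_add (h.flux _).integrable.abs (integrable_const _),
          integral_box_const (by positivity) hT]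
    -- The crude growth `N³` against a cutoff derivative of order `N⁻²` leaves a single power of
    -- `N`.
    _ ≤ (Cg * (2 * N) ^ 3 + |f (σ * k)| * (2 * (2 * N) ^ 2 * T)) * (K / (2 * N ^ 2)) := by
        refine mul_le_mul_of_nonneg_right ?_ (by positivity)
        exact add_le_add_left (hg (2 * N) (by linarith)) _
    _ = K * (4 * Cg * N + 4 * |f (σ * k)| * T) := by field_simp; ring
    _ ≤ K * (4 * Cg + 4 * |f (σ * k)| * T) * N := by
        rw [mul_assoc K]
        refine mul_le_mul_of_nonneg_left ?_ hK0
        have : 0 ≤ 4 * |f (σ * k)| * T := by positivity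
        nlinarith

/-- The interaction estimate is applied with the high threshold `l + 2 a` and the low thresholds
`k₀` and `l = k₀ + 1`. By `halfEnt_commutator` its left-hand side is twice the flux above the high
threshold minus `c` times the high half entropy, with `c = g l - g k₀ ≥ 0`. The entropy is
integrable by the energy bound, and the lateral terms are `O(N)`. Monotonicity makes the flux
nonnegative, so its absolute value is controlled. -/
theorem upFlux_tail_of_monotone (h : StripSolution a T E f u w) (hf : ConvexFlux f) (ha : 0 ≤ a)
    (hT : 0 ≤ T) (hE : 0 ≤ E) {σ : ℝ} (hσ : σ = 1 ∨ σ = -1) {k₀ : ℝ} (hk₀ : 1 ≤ k₀)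
    (hmono : MonotoneOn (fun v => f (σ * v)) (Ici k₀)) :
    ∃ C, ∀ N : ℝ, 1 ≤ N → ∫ p in box (N ^ 2) T,
      |upFlux (fun v => f (σ * v)) (k₀ + 1 + 2 * a) (σ * u p)| ≤ C * N := by
  have hσσ : σ * σ = 1 := by rcases hσ with rfl | rfl <;> norm_num
  have hσa : |σ| = 1 := by rcases hσ with rfl | rfl <;> norm_num
  set g : ℝ → ℝ := fun v => f (σ * v) with hg
  set l := k₀ + 1 with hl
  set K := l + 2 * a with hK
  set c := g l - g k₀ with hc
  have hc0 : 0 ≤ c := sub_nonneg.2 (hmono (mem_Ici.2 le_rfl) (mem_Ici.2 (by linarith)) (by linarith))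
  -- For `σ = -1` the flux of the half entropy is minus `upFlux`; exchanging the two low thresholds
  -- restores the sign of the commutator.
  obtain ⟨k₁, k₂, hk₁, hk₂, hkk⟩ : ∃ k₁ k₂ : ℝ, 1 ≤ k₁ ∧ 1 ≤ k₂ ∧
      ((σ = 1 ∧ k₁ = k₀ ∧ k₂ = l) ∨ (σ = -1 ∧ k₁ = l ∧ k₂ = k₀)) := by
    rcases hσ with h | h
    · exact ⟨k₀, l, hk₀, by linarith, Or.inl ⟨h, rfl, rfl⟩⟩
    · exact ⟨l, k₀, by linarith, hk₀, Or.inr ⟨h, rfl, rfl⟩⟩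
  have hK1 : 1 ≤ K := by linarith
  obtain ⟨C₀, hC₀, h₀⟩ := h.upFlux_mul_deriv_cut hf ha hT hE hσ K
  obtain ⟨C₁, hC₁, h₁⟩ := h.upFlux_mul_deriv_cut hf ha hT hE hσ k₁
  obtain ⟨C₂, hC₂, h₂⟩ := h.upFlux_mul_deriv_cut hf ha hT hE hσ k₂
  set D : ℝ → ℝ × ℝ → ℝ := fun k p => halfEnt a k (σ * u p) (σ * w p) with hD
  set Q : ℝ → ℝ × ℝ → ℝ := fun k p => σ * upFlux g k (σ * u p) with hQ
  have hQ0 : ∀ p, 0 ≤ upFlux g K (σ * u p) := fun p => by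
    unfold upFlux
    split_ifs with hlt
    · exact sub_nonneg.2 (hmono (mem_Ici.2 (by linarith)) (mem_Ici.2 (by linarith)) hlt.le)
    · exact le_rfl
  have hA : ∀ p, |D k₁ p - D k₂ p| ≤ max 2 c := fun p => by
    refine (abs_halfEnt_sub_le _ _ _ _ _).trans (le_trans (le_of_eq ?_) (le_max_left 2 c))
    rcases hkk with ⟨_, rfl, rfl⟩ | ⟨_, rfl, rfl⟩ <;> simp [hl]
  have hB : ∀ p, |Q k₁ p - Q k₂ p| ≤ max 2 c := fun p => by
    have hs := abs_upFlux_sub_le hmono (show k₀ ≤ l by linarith) (σ * u p)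
    refine le_trans ?_ (le_max_right 2 c)
    simp only [hQ]
    rw [← mul_sub, abs_mul, hσa, one_mul]
    rcases hkk with ⟨_, e1, e2⟩ | ⟨_, e1, e2⟩
    · rw [e1, e2]; exact hs
    · rw [e1, e2, abs_sub_comm]; exact hs
  have hcomm : ∀ R, ∀ᵐ p ∂(volume.restrict (box R T)),
      Q K p * (D k₁ p - D k₂ p) - D K p * (Q k₁ p - Q k₂ p) =
        2 * upFlux g K (σ * u p) - c * D K p := fun R => by
    filter_upwards [h.feasible_box R] with p hp
    have hp' : |σ * u p - σ * w p| ≤ a := by rw [← mul_sub, abs_mul, hσa, one_mul]; exact hp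
    have := halfEnt_commutator (g := g) ha (show k₀ ≤ l by linarith) hp'
    have hs : l - k₀ = 1 := by rw [hl]; ring
    rw [hs, ← hK, ← hc] at this
    simp only [hD, hQ]
    rcases hkk with ⟨e0, e1, e2⟩ | ⟨e0, e1, e2⟩
    · rw [e1, e2]
      linear_combination this + (upFlux g K (σ * u p) * (halfEnt a k₀ (σ * u p) (σ * w p) -
        halfEnt a l (σ * u p) (σ * w p)) - halfEnt a K (σ * u p) (σ * w p) *
        (upFlux g k₀ (σ * u p) - upFlux g l (σ * u p))) * e0
    · rw [e1, e2]
      linear_combination this - (upFlux g K (σ * u p) * (halfEnt a k₀ (σ * u p) (σ * w p) -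
        halfEnt a l (σ * u p) (σ * w p)) - halfEnt a K (σ * u p) (σ * w p) *
        (upFlux g k₀ (σ * u p) - upFlux g l (σ * u p))) * e0
  -- Here `2 * E` is the slab bound of the half entropies and the innermost `2` bounds the integral
  -- of `|θ'|`. The division by `2` removes the factor `2 (l - k₀) = 2` of the commutator; terms
  -- without `N` are absorbed by `N ≥ 1`.
  refine ⟨(2 * (2 * (2 * E) * (2 * E * 2) + 2 * E * C₀) + (2 * E * C₁ + 2 * E * C₂)
    + c * (2 * (E * T))) / 2, fun N hN => ?_⟩
  have hN0 : 0 < N := by linarith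
  have hNN : 2 * N ^ 2 < (2 * N) ^ 2 := by nlinarith
  have iQ := fun k R => h.integrable_upFlux hf hσ k R
  have iD := fun k R => h.integrable_halfEnt σ k R
  have iU : ∀ R, IntegrableOn (fun p => upFlux g K (σ * u p)) (box R T) := fun R => by
    refine ((iQ K R).integrable.const_mul σ).congr (Eventually.of_forall fun p => ?_)
    simp only [← mul_assoc, hσσ, one_mul, hg]
  refine integral_le_of_tcut 2 (iU _).integrable.abs fun n => ?_
  have hψ := cut_isCutoff (S := 2 * N ^ 2) (R := (2 * N) ^ 2) (by positivity) hNN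
  have hθ := tcut_isCutoff n T
  have key := interaction (show 0 ≤ 2 * E by linarith) (iD K ((2 * N) ^ 2)) (iQ K _) (iD k₁ _)
    (iQ k₁ _) (iD k₂ _) (iQ k₂ _) (fun p => halfEnt_nonneg _ _ _ _)
    (fun p => halfEnt_nonneg _ _ _ _) (fun p => halfEnt_nonneg _ _ _ _) (h.half hf ha hσ K)
    (h.half hf ha hσ k₁) (h.half hf ha hσ k₂) (h.slab_halfEnt hσ hK1 _)
    (h.slab_halfEnt hσ hk₁ _) (h.slab_halfEnt hσ hk₂ _) hA hB hψ hθ (cut_le_one _)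
    (tcut_le_one n T)
  have hcont : Continuous fun p : ℝ × ℝ => (cut (2 * N ^ 2) p.1 * tcut n T p.2) ^ 2 :=
    ((hψ.continuous.comp continuous_fst).mul (hθ.continuous.comp continuous_snd)).pow 2
  have hw0 : ∀ p : ℝ × ℝ, 0 ≤ (cut (2 * N ^ 2) p.1 * tcut n T p.2) ^ 2 := fun p => sq_nonneg _
  have hw1 : ∀ p : ℝ × ℝ, (cut (2 * N ^ 2) p.1 * tcut n T p.2) ^ 2 ≤ 1 := fun p =>
    pow_le_one₀ (mul_nonneg (cut_nonneg _ _) (tcut_nonneg _ _ _))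
      (mul_le_one₀ (cut_le_one _ _) (tcut_nonneg _ _ _) (tcut_le_one _ _ _))
  have hwn : ∀ p : ℝ × ℝ, ‖(cut (2 * N ^ 2) p.1 * tcut n T p.2) ^ 2‖ ≤ 1 := fun p => by
    rw [Real.norm_of_nonneg (hw0 p)]; exact hw1 p
  have jU : IntegrableOn (fun p => upFlux g K (σ * u p) * (cut (2 * N ^ 2) p.1 * tcut n T p.2) ^ 2)
      (box ((2 * N) ^ 2) T) :=
    (iU _).integrable.mul_bdd hcont.aestronglyMeasurable (Eventually.of_forall hwn)
  have jD : IntegrableOn (fun p => D K p * (cut (2 * N ^ 2) p.1 * tcut n T p.2) ^ 2)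
      (box ((2 * N) ^ 2) T) :=
    (iD K _).integrable.mul_bdd hcont.aestronglyMeasurable (Eventually.of_forall hwn)
  have e1 : ∫ p in box ((2 * N) ^ 2) T, (Q K p * (D k₁ p - D k₂ p) - D K p * (Q k₁ p - Q k₂ p)) *
      (cut (2 * N ^ 2) p.1 * tcut n T p.2) ^ 2 =
      2 * (∫ p in box ((2 * N) ^ 2) T,
        upFlux g K (σ * u p) * (cut (2 * N ^ 2) p.1 * tcut n T p.2) ^ 2)
      - c * ∫ p in box ((2 * N) ^ 2) T, D K p * (cut (2 * N ^ 2) p.1 * tcut n T p.2) ^ 2 := by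
    rw [← integral_const_mul, ← integral_const_mul,
      ← integral_sub (jU.integrable.const_mul 2) (jD.integrable.const_mul c)]
    refine integral_congr_ae ?_
    filter_upwards [hcomm ((2 * N) ^ 2)] with p hp
    rw [hp]; ring
  have hDle : ∫ p in box ((2 * N) ^ 2) T, D K p * (cut (2 * N ^ 2) p.1 * tcut n T p.2) ^ 2 ≤
      2 * (E * T) := by
    calc _ ≤ ∫ p in box ((2 * N) ^ 2) T, 2 * (u p ^ 2 + w p ^ 2) := by
          refine integral_mono_ae jD ((h.integrable_sq _).integrable.const_mul 2) ?_
          filter_upwards [h.halfEnt_le_sq hσ hK1 ((2 * N) ^ 2)] with p hp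
          exact (mul_le_of_le_one_right (halfEnt_nonneg _ _ _ _) (hw1 p)).trans hp
      _ ≤ _ := by
          rw [integral_const_mul]
          exact mul_le_mul_of_nonneg_left (h.integral_sq_le hT _) (by norm_num)
  have hθ' : ∫ t in Ioo 0 T, |deriv (tcut n T) t| ≤ 2 := integral_abs_deriv_ramp_le n _ _ T
  have hsub : ∫ p in box (N ^ 2) T, |upFlux g K (σ * u p)| * tcut n T p.2 ^ 2 ≤
      ∫ p in box ((2 * N) ^ 2) T,
        upFlux g K (σ * u p) * (cut (2 * N ^ 2) p.1 * tcut n T p.2) ^ 2 := by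
    have hss : box (N ^ 2) T ⊆ box ((2 * N) ^ 2) T := box_mono (by nlinarith) T
    calc _ = ∫ p in box (N ^ 2) T,
          upFlux g K (σ * u p) * (cut (2 * N ^ 2) p.1 * tcut n T p.2) ^ 2 := by
          refine setIntegral_congr_fun (measurableSet_box _ _) fun p hp => ?_
          have : |p.1| ≤ 2 * N ^ 2 / 2 := by
            have := abs_lt.2 (mem_Ioo.1 hp.1); linarith
          rw [cut_eq_one (by positivity) this, one_mul, abs_of_nonneg (hQ0 p)]
      _ ≤ _ := setIntegral_mono_set jU (Eventually.of_forall fun p =>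
          mul_nonneg (hQ0 p) (hw0 p)) hss.eventuallyLE
  rw [e1] at key
  have b0 := mul_le_mul_of_nonneg_left (h₀ N hN) (show 0 ≤ 2 * E by linarith)
  have b1 := mul_le_mul_of_nonneg_left (h₁ N hN) (show 0 ≤ 2 * E by linarith)
  have b2 := mul_le_mul_of_nonneg_left (h₂ N hN) (show 0 ≤ 2 * E by linarith)
  have b3 := mul_le_mul_of_nonneg_left hθ' (show 0 ≤ 2 * (2 * E) * (2 * E) by positivity)
  have b4 := mul_le_mul_of_nonneg_left hDle hc0
  refine hsub.trans ?_
  have hconst : 0 ≤ 2 * (2 * (2 * E) * (2 * E * 2)) + c * (2 * (E * T)) := by positivity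
  have hgrow := mul_le_mul_of_nonneg_left hN hconst
  linarith

/-- If the reflected flux has a nonnegative slope somewhere on `[1, ∞[`, convexity makes it
nondecreasing from there on and the commutator estimate applies. Otherwise it decreases on `[1, ∞[`
while staying above its tangent at `1`, so it is at most quadratic and the energy bound suffices. -/
theorem upFlux_tail (h : StripSolution a T E f u w) (hf : ConvexFlux f) (ha : 0 ≤ a)
    (hT : 0 ≤ T) (hE : 0 ≤ E) {σ : ℝ} (hσ : σ = 1 ∨ σ = -1) :
    ∃ K C : ℝ, 1 ≤ K ∧ ∀ N : ℝ, 1 ≤ N → ∫ p in box (N ^ 2) T,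
      |upFlux (fun v => f (σ * v)) K (σ * u p)| ≤ C * N := by
  have hσσ : σ ^ 2 = 1 := by rcases hσ with rfl | rfl <;> norm_num
  have hg := hf.comp_mul σ
  by_cases hex : ∃ k₀ : ℝ, 1 ≤ k₀ ∧ 0 ≤ deriv (fun v => f (σ * v)) k₀
  · obtain ⟨k₀, hk₀, hd⟩ := hex
    obtain ⟨C, hC⟩ := h.upFlux_tail_of_monotone hf ha hT hE hσ hk₀ (hg.monotoneOn hd)
    exact ⟨_, C, by linarith, hC⟩
  · push Not at hex
    set g : ℝ → ℝ := fun v => f (σ * v) with hgdef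
    have hdm := hg.convexOn.monotoneOn_deriv fun x _ => hg.differentiable x
    have hle : ∀ v, |upFlux g 1 v| ≤ |deriv g 1| * v ^ 2 := fun v => by
      unfold upFlux
      split_ifs with hv
      · have h1 := hg.tangent_le 1 v
        have h2 : g v ≤ g 1 := hg.antitoneOn (hex v hv.le).le (mem_Iic.2 hv.le) (mem_Iic.2 le_rfl)
          hv.le
        have h3 : deriv g 1 * (v - 1) ≥ -(|deriv g 1| * v ^ 2) := by
          rw [abs_of_neg (hex 1 le_rfl)]
          nlinarith [hex 1 le_rfl, sq_nonneg (v - 1)]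
        have h4 : 0 ≤ |deriv g 1| * v ^ 2 := by positivity
        rw [abs_le]; constructor <;> linarith
      · rw [abs_zero]; positivity
    refine ⟨1, |deriv g 1| * (E * T), le_rfl, fun N hN => ?_⟩
    calc _ ≤ ∫ p in box (N ^ 2) T, |deriv g 1| * (u p ^ 2 + w p ^ 2) := by
          refine integral_mono_of_nonneg (Eventually.of_forall fun p => abs_nonneg _)
            ((h.integrable_sq _).integrable.const_mul _) (Eventually.of_forall fun p => ?_)
          refine (hle _).trans (mul_le_mul_of_nonneg_left ?_ (abs_nonneg _))
          rw [mul_pow, hσσ]; nlinarith [sq_nonneg (w p)]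
      _ ≤ |deriv g 1| * (E * T) := by
          rw [integral_const_mul]
          exact mul_le_mul_of_nonneg_left (h.integral_sq_le hT _) (abs_nonneg _)
      _ ≤ _ := le_mul_of_one_le_right (by positivity) hN

/-- The flux differs from its value at `0` by little over large boxes. -/
theorem flux_tail (h : StripSolution a T E f u w) (hf : ConvexFlux f) (ha : 0 ≤ a)
    (hT : 0 ≤ T) (hE : 0 ≤ E) :
    ∃ C : ℝ, ∀ N : ℝ, 1 ≤ N → ∫ p in box (N ^ 2) T, |f (u p) - f 0| ≤ C * N := by
  obtain ⟨K₁, C₁, hK₁, h₁⟩ := h.upFlux_tail hf ha hT hE (Or.inl rfl)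
  obtain ⟨K₂, C₂, hK₂, h₂⟩ := h.upFlux_tail hf ha hT hE (Or.inr rfl)
  simp only [one_mul, neg_mul] at h₁ h₂
  obtain ⟨L, hL, hlip⟩ := hf.exists_lipschitz_zero (max K₁ K₂)
  -- Between `-K₂` and `K₁` the flux is Lipschitz from `0`; beyond a threshold it is the value there
  -- plus the corresponding `upFlux`. The linear term is again `O(N)` on the box, with `l = 1 / N`.
  have hpt : ∀ v, |f v - f 0| ≤ L * |v| +
      (|upFlux f K₁ v| + |upFlux (fun v => f (-v)) K₂ (-v)|) := fun v => by
    have p1 := abs_nonneg (upFlux f K₁ v)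
    have p2 := abs_nonneg (upFlux (fun v => f (-v)) K₂ (-v))
    by_cases c1 : K₁ < v
    · have l1 := hlip K₁ (by rw [abs_of_nonneg (by linarith)]; exact le_max_left _ _)
      have e1 : upFlux f K₁ v = f v - f K₁ := if_pos c1
      have l2 : L * |K₁| ≤ L * |v| := by
        rw [abs_of_nonneg (by linarith : 0 ≤ K₁), abs_of_nonneg (by linarith : 0 ≤ v)]
        exact mul_le_mul_of_nonneg_left c1.le hL
      have l3 := abs_sub_le (f v) (f K₁) (f 0)
      rw [e1] at p1 ⊢; linarith
    · by_cases c2 : K₂ < -v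
      · have l1 := hlip (-K₂) (by rw [abs_neg, abs_of_nonneg (by linarith)]; exact le_max_right _ _)
        have e1 : upFlux (fun v => f (-v)) K₂ (-v) = f v - f (-K₂) := by
          rw [upFlux, if_pos c2, neg_neg]
        have l2 : L * |(-K₂)| ≤ L * |v| := by
          rw [abs_neg, abs_of_nonneg (by linarith : 0 ≤ K₂), abs_of_nonpos (by linarith : v ≤ 0)]
          exact mul_le_mul_of_nonneg_left c2.le hL
        have l3 := abs_sub_le (f v) (f (-K₂)) (f 0)
        rw [e1] at p2 ⊢; linarith
      · have := hlip v (abs_le.2 ⟨by linarith [le_max_right K₁ K₂], by linarith [le_max_left K₁ K₂]⟩)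
        linarith
  refine ⟨L * (2 * T + E * T) + (C₁ + C₂), fun N hN => ?_⟩
  have hN0 : 0 < N := by linarith
  have iu := (h.integrable_u (N ^ 2)).integrable.abs.const_mul L
  have i1 := (h.integrable_upFlux hf (Or.inl rfl) K₁ (N ^ 2)).integrable.abs
  have i2 := (h.integrable_upFlux hf (Or.inr rfl) K₂ (N ^ 2)).integrable.abs
  simp only [one_mul, neg_mul, abs_neg] at i1 i2
  calc _ ≤ ∫ p in box (N ^ 2) T, (L * |u p| + (|upFlux f K₁ (u p)| +
          |upFlux (fun v => f (-v)) K₂ (-u p)|)) :=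
        integral_mono_of_nonneg (Eventually.of_forall fun p => abs_nonneg _) (iu.add (i1.add i2))
          (Eventually.of_forall fun p => hpt _)
    _ = L * (∫ p in box (N ^ 2) T, |u p|) + ((∫ p in box (N ^ 2) T, |upFlux f K₁ (u p)|) +
          ∫ p in box (N ^ 2) T, |upFlux (fun v => f (-v)) K₂ (-u p)|) := by
        have i12 : IntegrableOn (fun p => |upFlux f K₁ (u p)| +
          |upFlux (fun v => f (-v)) K₂ (-u p)|) (box (N ^ 2) T) := i1.add i2
        rw [integral_add iu i12, integral_add i1 i2, integral_const_mul]
    _ ≤ L * (1 / N * (2 * N ^ 2 * T) + E * T / (1 / N)) + (C₁ * N + C₂ * N) :=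
        add_le_add (mul_le_mul_of_nonneg_left
          (h.integral_abs_le hT (by positivity) (by positivity)) hL) (add_le_add (h₁ N hN) (h₂ N hN))
    _ = _ := by field_simp

end StripSolution

end PlayHysteresis

/-! ### Product test functions and reduction to strip solutions -/

namespace PlayHysteresis

theorem hasFDerivAt_mul_prod {ψ θ : ℝ → ℝ} (hψ : ContDiff ℝ 1 ψ) (hθ : ContDiff ℝ 1 θ)
    (p : ℝ × ℝ) : dx (fun q => ψ q.1 * θ q.2) p = deriv ψ p.1 * θ p.2 ∧
      dt (fun q => ψ q.1 * θ q.2) p = ψ p.1 * deriv θ p.2 := by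
  have h1 := ((hψ.differentiable (by norm_num) p.1).hasDerivAt.hasFDerivAt).comp p hasFDerivAt_fst
  have h2 := ((hθ.differentiable (by norm_num) p.2).hasDerivAt.hasFDerivAt).comp p hasFDerivAt_snd
  have h3 := (h1.mul h2).fderiv
  unfold dx dt
  simp only [Function.comp_def, Pi.mul_def] at h3
  rw [h3]
  constructor <;> simp [mul_comm]

theorem isTestFunction_mul {T : ℝ} {s : Set ℝ} {ψ θ : ℝ → ℝ} (hψ : IsCutoff s ψ)
    (hθ : IsCutoff (Iio T) θ) : IsTestFunction T fun p => ψ p.1 * θ p.2 := by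
  have hsub : Function.support (fun p : ℝ × ℝ => ψ p.1 * θ p.2) ⊆ tsupport ψ ×ˢ tsupport θ :=
    fun p hp => ⟨subset_tsupport _ (left_ne_zero_of_mul hp),
      subset_tsupport _ (right_ne_zero_of_mul hp)⟩
  have hcl : tsupport (fun p : ℝ × ℝ => ψ p.1 * θ p.2) ⊆ tsupport ψ ×ˢ tsupport θ :=
    closure_minimal hsub ((isClosed_tsupport ψ).prod (isClosed_tsupport θ))
  exact
  { contDiff := (hψ.contDiff.comp contDiff_fst).mul (hθ.contDiff.comp contDiff_snd)
    hasCompactSupport := (hψ.hasCompactSupport.prod hθ.hasCompactSupport).of_isClosed_subset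
      (isClosed_tsupport _) hcl
    tsupport_subset := hcl.trans (prod_mono (subset_univ _) hθ.tsupport_subset)
    nonneg := fun x t _ => mul_nonneg (hψ.nonneg x) (hθ.nonneg t) }

namespace IsEntropyWeakSolution

variable {a T : ℝ} {f u₀ w₀ : ℝ → ℝ} {u w : ℝ → ℝ → ℝ}

/-- The dissipation has a favourable sign, so the energy inequality is an `L²` bound by the initial
energy, uniform in time. -/
theorem energy (h : IsEntropyWeakSolution a T f u₀ w₀ u w) (ha : 0 ≤ a) :
    ∀ᵐ t ∂(volume.restrict (Ioo 0 T)), Integrable (fun x => u x t ^ 2) ∧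
      Integrable (fun x => w x t ^ 2) ∧
      (∫ x, u x t ^ 2) + (∫ x, w x t ^ 2) ≤ (∫ x, u₀ x ^ 2) + ∫ x, w₀ x ^ 2 := by
  obtain ⟨h1, μ, -, h2⟩ := h.hysteresis
  filter_upwards [h1, h2] with t ht1 ht2
  refine ⟨ht1.1.integrable_sq, ht1.2.integrable_sq, ?_⟩
  have : 0 ≤ a * (μ.totalVariation (univ ×ˢ Ioo 0 t)).toReal := by positivity
  linarith

/-- The entropy inequality for products of cutoffs. -/
theorem entropy_mul (h : IsEntropyWeakSolution a T f u₀ w₀ u w) {s : Set ℝ} {ψ θ : ℝ → ℝ}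
    (hψ : IsCutoff s ψ) (hθ : IsCutoff (Iio T) θ) {k k' : ℝ} (hk : |k - k'| ≤ a) :
    0 ≤ (∫ p in univ ×ˢ Ioo 0 T, ((|u p.1 p.2 - k| + |w p.1 p.2 - k'|) * (ψ p.1 * deriv θ p.2)
        + Real.sign (u p.1 p.2 - k) * (f (u p.1 p.2) - f k) * (deriv ψ p.1 * θ p.2)))
      + ∫ x, (|u₀ x - k| + |w₀ x - k'|) * (ψ x * θ 0) := by
  have := h.entropy _ (isTestFunction_mul hψ hθ) k k' hk
  simpa only [hasFDerivAt_mul_prod hψ.contDiff hθ.contDiff] using this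

/-- Stopping at `T' < T` keeps the closed boxes compact in `ℝ × [0, T[`, where `f(u)` is integrable.
Time cutoffs supported in `]0, T'[` remove the initial term. -/
theorem stripSolution (h : IsEntropyWeakSolution a T f u₀ w₀ u w) (ha : 0 ≤ a) {T' : ℝ}
    (hT' : T' < T) :
    StripSolution a T' ((∫ x, u₀ x ^ 2) + ∫ x, w₀ x ^ 2) f (fun p => u p.1 p.2)
      fun p => w p.1 p.2 := by
  have hsub : Ioo 0 T' ⊆ Ioo 0 T := Ioo_subset_Ioo_right hT'.le
  have hsub' : (univ : Set ℝ) ×ˢ Ioo 0 T' ⊆ univ ×ˢ Ico 0 T :=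
    prod_mono subset_rfl (hsub.trans Ioo_subset_Ico_self)
  refine ⟨h.cont_u.aestronglyMeasurable.mono_measure (Measure.restrict_mono hsub' le_rfl),
    h.cont_w.aestronglyMeasurable.mono_measure (Measure.restrict_mono hsub' le_rfl),
    ae_restrict_of_ae_restrict_of_subset hsub (h.energy ha), fun R => ?_,
    ae_restrict_of_ae_restrict_of_subset hsub' h.feasible, fun k k' hk R ψ θ hψ hθ => ?_⟩
  · have hc : IsCompact (Icc (-R) R ×ˢ Icc 0 T') := isCompact_Icc.prod isCompact_Icc
    refine (h.flux_locallyIntegrable.integrableOn_compact_subset ?_ hc).mono_set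
      (prod_mono Ioo_subset_Icc_self Ioo_subset_Icc_self)
    exact prod_mono (subset_univ _) fun t ht => ⟨ht.1, ht.2.trans_lt hT'⟩
  · have hθ' : IsCutoff (Iio T) θ := hθ.mono fun t ht => ht.2.trans hT'
    have h0 := h.entropy_mul hψ hθ' hk
    rw [hθ.eq_zero (x := 0) (by simp)] at h0
    simp only [mul_zero, integral_zero, add_zero] at h0
    rwa [setIntegral_eq_of_subset_of_forall_sdiff_eq_zero
      (MeasurableSet.univ.prod measurableSet_Ioo)
      ((box_subset_strip R T').trans (prod_mono subset_rfl hsub))] at h0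
    intro p hp
    by_cases h1 : p.1 ∈ Ioo (-R) R
    · have h2 : p.2 ∉ Ioo 0 T' := fun h2 => hp.2 ⟨h1, h2⟩
      rw [hθ.eq_zero h2, hθ.deriv_eq_zero h2]; ring
    · rw [hψ.eq_zero h1, hψ.deriv_eq_zero h1]; ring

end IsEntropyWeakSolution

end PlayHysteresis

namespace PlayHysteresis

/-! ### Continuity in time of weighted distances -/

/-- An approximate identity in which `m` is only asked to converge within `s`, so that `t₀` may be
an endpoint of the interval, as needed at the initial time. -/
theorem tendsto_setIntegral_weight {s : Set ℝ} (hs : MeasurableSet s) (hsf : volume s ≠ ⊤)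
    {m : ℝ → ℝ} {t₀ b : ℝ} (hm : Tendsto m (𝓝[s] t₀) (𝓝 b)) (hmi : IntegrableOn m s)
    {k : ℕ → ℝ → ℝ} {r : ℕ → ℝ} (hr : Tendsto r atTop (𝓝 0)) (hk0 : ∀ n t, 0 ≤ k n t)
    (hkz : ∀ n t, r n ≤ |t - t₀| → k n t = 0) (hkc : ∀ n, Continuous (k n))
    (hk1 : ∀ᶠ n in atTop, ∫ t in s, k n t = 1) :
    Tendsto (fun n => ∫ t in s, k n t * m t) atTop (𝓝 b) := by
  refine tendsto_setIntegral_peak_smul_of_integrableOn_of_tendsto hs hs subset_rfl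
    self_mem_nhdsWithin hsf (Eventually.of_forall fun n t _ => hk0 n t) (fun U hU h0 => ?_)
    (tendsto_const_nhds.congr' (hk1.mono fun n hn => hn.symm))
    (Eventually.of_forall fun n => (hkc n).aestronglyMeasurable) hmi hm
  obtain ⟨ε, hε, hb⟩ := Metric.isOpen_iff.1 hU t₀ h0
  rw [Metric.tendstoUniformlyOn_iff]
  intro δ hδ
  filter_upwards [hr.eventually (gt_mem_nhds hε)] with n hn t ht
  have : ε ≤ |t - t₀| := by
    by_contra hlt
    exact ht.2 (hb (by rw [Metric.mem_ball, Real.dist_eq]; linarith))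
  rw [hkz n t (hn.le.trans this)]
  simpa using hδ

namespace IsContL1loc

variable {T : ℝ} {v v₁ v₂ : ℝ → ℝ → ℝ}

theorem const (T c : ℝ) : IsContL1loc T fun _ _ => c where
  aestronglyMeasurable := aestronglyMeasurable_const
  locallyIntegrable _ _ := locallyIntegrable_const c
  continuous t _ R := by simpa using tendsto_const_nhds

theorem integrable_mul_cutoff (h₁ : IsContL1loc T v₁) (h₂ : IsContL1loc T v₂) {t : ℝ}
    (ht : t ∈ Ico 0 T) {s : Set ℝ} {ψ : ℝ → ℝ} (hψ : IsCutoff s ψ) :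
    Integrable fun x => |v₁ x t - v₂ x t| * ψ x := by
  have h : LocallyIntegrable fun x => |v₁ x t - v₂ x t| := fun x =>
    ((h₁.locallyIntegrable t ht).sub (h₂.locallyIntegrable t ht) x).norm
  have := h.integrable_smul_left_of_hasCompactSupport hψ.continuous hψ.hasCompactSupport
  refine this.congr (Eventually.of_forall fun x => ?_)
  simp [mul_comm]

theorem continuousOn_integral (h₁ : IsContL1loc T v₁) (h₂ : IsContL1loc T v₂) {R : ℝ} {ψ : ℝ → ℝ}
    (hψ : IsCutoff (Ioo (-R) R) ψ) :
    ContinuousOn (fun t => ∫ x, |v₁ x t - v₂ x t| * ψ x) (Ico 0 T) := by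
  intro t ht
  obtain ⟨C, hC⟩ := hψ.bounded
  have hlim := ((h₁.continuous t ht R).add (h₂.continuous t ht R)).const_mul C
  rw [add_zero, mul_zero] at hlim
  rw [ContinuousWithinAt, tendsto_iff_norm_sub_tendsto_zero]
  refine squeeze_zero' (Eventually.of_forall fun _ => norm_nonneg _) ?_ hlim
  filter_upwards [self_mem_nhdsWithin] with s hs
  have i : ∀ {v : ℝ → ℝ → ℝ}, IsContL1loc T v →
      Integrable (fun x => |v x s - v x t|) (volume.restrict (Icc (-R) R)) := fun {v} h =>
    (((h.locallyIntegrable s hs).sub (h.locallyIntegrable t ht)).integrableOn_isCompact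
      isCompact_Icc).norm
  have i1 := h₁.integrable_mul_cutoff h₂ hs hψ
  have i2 := h₁.integrable_mul_cutoff h₂ ht hψ
  rw [← integral_sub i1 i2, ← integral_add (i h₁) (i h₂), ← integral_const_mul]
  have hz : ∀ x, x ∉ Icc (-R) R → |v₁ x s - v₂ x s| * ψ x - |v₁ x t - v₂ x t| * ψ x = 0 :=
    fun x hx => by rw [hψ.eq_zero fun h => hx (Ioo_subset_Icc_self h)]; ring
  rw [← setIntegral_eq_integral_of_forall_compl_eq_zero hz]
  refine (norm_integral_le_integral_norm _).trans (integral_mono_of_nonneg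
    (Eventually.of_forall fun x => norm_nonneg _) (((i h₁).add (i h₂)).const_mul C)
    (Eventually.of_forall fun x => ?_))
  simp only
  rw [← sub_mul, norm_mul, mul_comm]
  refine mul_le_mul (hC x).1 ?_ (norm_nonneg _) ((norm_nonneg _).trans (hC x).1)
  have e : |v₁ x s - v₂ x s - (v₁ x t - v₂ x t)| ≤ |v₁ x s - v₁ x t| + |v₂ x s - v₂ x t| := by
    rw [sub_sub_sub_comm]
    exact abs_sub _ _
  exact (abs_abs_sub_abs_le _ _).trans e

end IsContL1loc

theorem integral_box_slice {R T : ℝ} {A : ℝ × ℝ → ℝ} (hA : IntegrableOn A (box R T)) {ψ k : ℝ → ℝ}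
    (hψ : IsCutoff (Ioo (-R) R) ψ) (hk : Continuous k) {D : ℝ} (hD : ∀ t, ‖k t‖ ≤ D) :
    ∫ p in box R T, A p * (ψ p.1 * k p.2) = ∫ t in Ioo 0 T, k t * ∫ x, A (x, t) * ψ x := by
  obtain ⟨C, hC⟩ := hψ.bounded
  have i := integrable_mul_weight hA hψ.continuous hk (fun x => (hC x).1) hD
  rw [IntegrableOn, restrict_box] at i
  rw [restrict_box, integral_prod_symm _ i]
  refine integral_congr_ae (Eventually.of_forall fun t => ?_)
  simp only
  rw [← integral_const_mul, setIntegral_eq_integral_of_forall_compl_eq_zero]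
  · refine integral_congr_ae (Eventually.of_forall fun x => ?_)
    simp only; ring
  · intro x hx
    rw [hψ.eq_zero hx]; ring

/-- A locally integrable function with nonpositive integrals against cutoffs is nonpositive. -/
theorem ae_nonpos_of_integral_mul_cutoff {d : ℝ → ℝ} (hd : LocallyIntegrable d)
    (h : ∀ R ψ, IsCutoff (Ioo (-R) R) ψ → ∫ x, ψ x * d x ≤ 0) : ∀ᵐ x, d x ≤ 0 := by
  have hK : ∀ᶠ n in atTop, (bump n).rOut ≤ 2 * (bump n).rIn := Eventually.of_forall fun n => by
    refine le_of_eq ?_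
    simp only [bump]
    field_simp
  filter_upwards [ContDiffBump.ae_convolution_tendsto_right_of_locallyIntegrable (φ := bump)
    (l := atTop) (K := 2) tendsto_rad hK hd] with x hx
  refine le_of_tendsto' hx fun n => ?_
  rw [convolution_lsmul_swap]
  -- The value at `x` of the mollified function is the integral of `d` against `y ↦ rho n (x - y)`,
  -- itself a cutoff; almost everywhere these values converge to `d x`.
  refine h (|x| + 2) (fun y => rho n (x - y)) ?_
  refine IsCutoff.of_eq_zero (c := x - 1) (d := x + 1)
    ((rho_contDiff n).comp (contDiff_const.sub contDiff_id)) (fun y => rho_nonneg _ _)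
    (fun y hy => ⟨by linarith [hy.1, neg_abs_le x], by linarith [hy.2, le_abs_self x]⟩)
    fun y hy => rho_eq_zero ?_
  by_contra hlt
  have h1 := abs_lt.1 (not_le.1 hlt)
  exact hy ⟨by linarith [rad_le_one n, h1.2], by linarith [rad_le_one n, h1.1]⟩

/-! ### Attainment of the initial data -/

namespace IsEntropyWeakSolution

variable {a T : ℝ} {f u₀ w₀ : ℝ → ℝ} {u w : ℝ → ℝ → ℝ}

/-- The time cutoffs equal `1` at `t = 0` and drop to `0` by time `2 rad n`. The flux term
disappears in the limit, the time derivative concentrates at `0` from the right, and continuity in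
`L¹_loc` identifies the limit with the slice at `t = 0`. -/
theorem trace_integral_le (h : IsEntropyWeakSolution a T f u₀ w₀ u w) (hf : ConvexFlux f)
    (ha : 0 ≤ a) (hT : 0 < T) {R : ℝ} {ψ : ℝ → ℝ} (hψ : IsCutoff (Ioo (-R) R) ψ) {k k' : ℝ}
    (hk : |k - k'| ≤ a) :
    ∫ x, (|u x 0 - k| + |w x 0 - k'|) * ψ x ≤ ∫ x, (|u₀ x - k| + |w₀ x - k'|) * ψ x := by
  set T' := T / 2 with hT'
  have hS := h.stripSolution ha (show T' < T by linarith)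
  obtain ⟨iA, iB⟩ := hS.integrable_kruzhkov hf k k' R
  have cku := IsContL1loc.const T k
  have ckw := IsContL1loc.const T k'
  set m : ℝ → ℝ := fun t => ∫ x, (|u x t - k| + |w x t - k'|) * ψ x with hm
  have hmc : ContinuousOn m (Ico 0 T) := by
    refine ((h.cont_u.continuousOn_integral cku hψ).add
      (h.cont_w.continuousOn_integral ckw hψ)).congr fun t ht => ?_
    rw [Pi.add_apply, ← integral_add (h.cont_u.integrable_mul_cutoff cku ht hψ)
      (h.cont_w.integrable_mul_cutoff ckw ht hψ)]
    simp only [hm, add_mul]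
  have hsub : Ioo 0 T' ⊆ Ico 0 T := fun t ht => ⟨ht.1.le, by linarith [ht.2]⟩
  have hmi : IntegrableOn m (Ioo 0 T') :=
    ((hmc.mono fun t ht => ⟨ht.1, by linarith [ht.2]⟩ : ContinuousOn m (Icc 0 T')).integrableOn_Icc
      ).mono_set Ioo_subset_Icc_self
  -- The kernel is shifted by `rad n`, so that its whole mass lies in `[0, 2 rad n]`.
  have hlim1 : Tendsto (fun n => ∫ t in Ioo 0 T', rho n (t - rad n) * m t) atTop (𝓝 (m 0)) := by
    refine tendsto_setIntegral_weight measurableSet_Ioo (by simp)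
      ((hmc 0 ⟨le_rfl, hT⟩).mono hsub) hmi (r := fun n => 2 * rad n)
      (by simpa using tendsto_rad.const_mul 2) (fun n t => rho_nonneg _ _) (fun n t ht => ?_)
      (fun n => (rho_continuous n).comp (continuous_id.sub continuous_const)) ?_
    · refine rho_eq_zero ?_
      rw [sub_zero] at ht
      have := abs_sub_abs_le_abs_sub t (rad n)
      rw [abs_of_pos (rad_pos n)] at this
      linarith
    · filter_upwards [tendsto_rad.eventually (gt_mem_nhds (show 0 < T' / 2 by linarith))] with n hn
      rw [setIntegral_eq_integral_of_forall_compl_eq_zero, integral_sub_right_eq_self (rho n),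
        rho_integral]
      intro t ht
      refine rho_eq_zero ?_
      by_contra hlt
      have := abs_lt.1 (not_le.1 hlt)
      exact ht ⟨by linarith, by linarith⟩
  set B : ℝ × ℝ → ℝ := fun p => Real.sign (u p.1 p.2 - k) * (f (u p.1 p.2) - f k) with hB
  -- The rise around `t = -2` only provides compact support; as `rad n ≤ 1`, it is over before `t =
  -- 0`.
  set θ : ℕ → ℝ → ℝ := fun n t => ramp n (-2) (rad n) t with hθ
  have hθc : ∀ n, ContDiff ℝ 1 (θ n) := fun n =>
    ((heav_contDiff n).comp (contDiff_id.sub contDiff_const)).mul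
      (contDiff_const.sub ((heav_contDiff n).comp (contDiff_id.sub contDiff_const)))
  have hθz : ∀ n t, 2 * rad n ≤ t → θ n t = 0 := fun n t ht => by
    simp only [hθ, ramp]
    rw [heav_eq_one (z := t - rad n) (by linarith)]; ring
  have hθd : ∀ n t, 0 ≤ t → deriv (θ n) t = -rho n (t - rad n) := fun n t ht => by
    have h1 := (ramp_hasDerivAt n (-2) (rad n) t).deriv
    have h2 : rho n (t - -2) = 0 := rho_eq_zero (by
      rw [abs_of_nonneg (by linarith)]; linarith [rad_le_one n])
    rw [heav_eq_one (z := t - -2) (by linarith [rad_le_one n]), h2] at h1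
    exact h1.trans (by ring)
  have hθ0 : ∀ n, θ n 0 = 1 := fun n => by
    simp only [hθ, ramp]
    rw [heav_eq_one (by linarith [rad_le_one n]), heav_eq_zero (by linarith)]; ring
  obtain ⟨C, hC⟩ := hψ.bounded
  have hlim2 : Tendsto (fun n => ∫ p in box R T', B p * (deriv ψ p.1 * θ n p.2)) atTop (𝓝 0) := by
    have : ∫ p in box R T', (0 : ℝ) = 0 := integral_zero _ _
    rw [← this]
    refine tendsto_integral_of_dominated_convergence (fun p => ‖B p‖ * C) (fun n => ?_)
      (iB.integrable.norm.mul_const C) (fun n => Eventually.of_forall fun p => ?_) ?_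
    · exact iB.integrable.1.mul ((hψ.continuous_deriv.comp continuous_fst).mul
        ((hθc n).continuous.comp continuous_snd)).aestronglyMeasurable
    · rw [norm_mul]
      refine mul_le_mul_of_nonneg_left ?_ (norm_nonneg _)
      rw [norm_mul, Real.norm_of_nonneg (ramp_nonneg _ _ _ _)]
      exact (mul_le_of_le_one_right (norm_nonneg _) (ramp_le_one _ _ _ _)).trans (hC _).2
    · filter_upwards [ae_restrict_mem (measurableSet_box _ _)] with p hp
      refine tendsto_const_nhds.congr' ?_
      filter_upwards [tendsto_rad.eventually (gt_mem_nhds (show 0 < p.2 / 2 by linarith [hp.2.1]))]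
        with n hn
      rw [hθz n _ (by linarith)]; ring
  have hlim := hlim2.sub hlim1
  rw [zero_sub] at hlim
  suffices hs : -(∫ x, (|u₀ x - k| + |w₀ x - k'|) * ψ x) ≤ -m 0 by
    simp only [hm] at hs; linarith
  refine ge_of_tendsto hlim ?_
  filter_upwards [tendsto_rad.eventually (gt_mem_nhds (show 0 < T' / 2 by linarith))] with n hn
  have hcut : IsCutoff (Iio T) (θ n) := by
    refine IsCutoff.of_eq_zero (c := -3) (d := 2 * rad n) (hθc n) (ramp_nonneg _ _ _)
      (fun t ht => by rw [mem_Iio]; linarith [ht.2]) fun t ht => ?_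
    rw [mem_Icc, not_and_or, not_le, not_le] at ht
    rcases ht with ht | ht
    · simp only [hθ, ramp]
      rw [heav_eq_zero (z := t - -2) (by linarith [rad_le_one n])]; ring
    · exact hθz n t ht.le
  have h0 := h.entropy_mul hψ hcut hk
  simp only [hθ0, mul_one] at h0
  rw [setIntegral_eq_of_subset_of_forall_sdiff_eq_zero (MeasurableSet.univ.prod measurableSet_Ioo)
    (s := box R T') ((box_subset_strip R T').trans (prod_mono subset_rfl
      (Ioo_subset_Ioo_right (by linarith))))] at h0
  · have e1 : ∫ p in box R T', ((|u p.1 p.2 - k| + |w p.1 p.2 - k'|) * (ψ p.1 * deriv (θ n) p.2)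
        + B p * (deriv ψ p.1 * θ n p.2)) = (∫ p in box R T', B p * (deriv ψ p.1 * θ n p.2))
        - ∫ t in Ioo 0 T', rho n (t - rad n) * m t := by
      obtain ⟨D, hD⟩ := rho_bounded n
      have cρ : Continuous fun t => rho n (t - rad n) :=
        (rho_continuous n).comp (continuous_id.sub continuous_const)
      obtain ⟨D', hD'⟩ := hcut.bounded
      have j1 := integrable_mul_weight iA hψ.continuous cρ (fun x => (hC x).1) fun t => hD _
      have j2 := integrable_mul_weight iB hψ.continuous_deriv (hθc n).continuous
        (fun x => (hC x).2) fun t => (hD' t).1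
      rw [← integral_box_slice iA hψ cρ fun t => hD _, ← integral_sub j2 j1]
      refine setIntegral_congr_fun (measurableSet_box _ _) fun p hp => ?_
      simp only [hθd n p.2 hp.2.1.le, hB]
      ring
    rw [e1] at h0
    linarith
  · intro p hp
    by_cases h1 : p.1 ∈ Ioo (-R) R
    · have h2 : T' ≤ p.2 := by
        by_contra hlt
        exact hp.2 ⟨h1, hp.1.2.1, not_le.1 hlt⟩
      have h3 : rho n (p.2 - rad n) = 0 := rho_eq_zero (by
        rw [abs_of_nonneg] <;> linarith)
      rw [hθz n _ (by linarith), hθd n _ (by linarith), h3]; ring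
    · rw [hψ.eq_zero h1, hψ.deriv_eq_zero h1]; ring

/-- The initial data are attained. -/
theorem initial (h : IsEntropyWeakSolution a T f u₀ w₀ u w) (hf : ConvexFlux f) (ha : 0 ≤ a)
    (hT : 0 < T) (hu₀ : Integrable u₀) (hw₀ : Integrable w₀)
    (h₀ : ∀ᵐ x, (u₀ x, w₀ x) ∈ strip a) : ∀ᵐ x, u x 0 = u₀ x ∧ w x 0 = w₀ x := by
  have h00 : (0 : ℝ) ∈ Ico 0 T := ⟨le_rfl, hT⟩
  have hd : ∀ k k' : ℝ, |k - k'| ≤ a →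
      ∀ᵐ x, |u x 0 - k| + |w x 0 - k'| - (|u₀ x - k| + |w₀ x - k'|) ≤ 0 := fun k k' hk => by
    have hl : ∀ {v : ℝ → ℝ} (c : ℝ), LocallyIntegrable v → LocallyIntegrable fun x => |v x - c| :=
      fun c hv x => (hv.sub (locallyIntegrable_const c) x).norm
    have l1 := (hl k (h.cont_u.locallyIntegrable 0 h00)).add
      (hl k' (h.cont_w.locallyIntegrable 0 h00))
    have l2 := (hl k hu₀.locallyIntegrable).add (hl k' hw₀.locallyIntegrable)
    refine ae_nonpos_of_integral_mul_cutoff (l1.sub l2) fun R ψ hψ => ?_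
    have i1 := l1.integrable_smul_left_of_hasCompactSupport hψ.continuous hψ.hasCompactSupport
    have i2 := l2.integrable_smul_left_of_hasCompactSupport hψ.continuous hψ.hasCompactSupport
    simp only [smul_eq_mul, Pi.add_apply] at i1 i2
    have := h.trace_integral_le hf ha hT hψ hk
    simp only [mul_sub]
    rw [integral_sub i1 i2]
    simp only [mul_comm (ψ _)]
    linarith
  -- The exceptional null set depends on the constants, so a countable dense subset of the strip is
  -- used first and continuity extends the inequality to the whole strip. The choice `(k, k') = (u₀
  -- x, w₀ x)` is then allowed and makes the right-hand side vanish.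
  have : Nonempty (strip a) := ⟨⟨(0, 0), by simpa [strip] using ha⟩⟩
  have hall : ∀ᵐ x, ∀ n, |u x 0 - (TopologicalSpace.denseSeq (strip a) n).1.1|
      + |w x 0 - (TopologicalSpace.denseSeq (strip a) n).1.2|
      - (|u₀ x - (TopologicalSpace.denseSeq (strip a) n).1.1|
      + |w₀ x - (TopologicalSpace.denseSeq (strip a) n).1.2|) ≤ 0 :=
    ae_all_iff.2 fun n => hd _ _ (TopologicalSpace.denseSeq (strip a) n).2
  filter_upwards [hall, h₀] with x hx hx0
  have key : ∀ q : strip a, |u x 0 - q.1.1| + |w x 0 - q.1.2| - (|u₀ x - q.1.1| + |w₀ x - q.1.2|)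
      ≤ 0 := fun q => by
    refine (TopologicalSpace.denseRange_denseSeq (strip a)).induction_on q ?_ hx
    exact isClosed_le (by fun_prop) continuous_const
  have := key ⟨_, hx0⟩
  simp only [sub_self, abs_zero, add_zero, sub_zero] at this
  have a1 := abs_nonneg (u x 0 - u₀ x)
  have a2 := abs_nonneg (w x 0 - w₀ x)
  exact ⟨sub_eq_zero.1 (abs_eq_zero.1 (by linarith)), sub_eq_zero.1 (abs_eq_zero.1 (by linarith))⟩

end IsEntropyWeakSolution

end PlayHysteresis

namespace PlayHysteresis

/-! ### The contraction property -/

/-- The integrand is the derivative of `heav n ^ 2`, which rises from `0` to `1`. -/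
theorem heav_mul_rho_integral (n : ℕ) : ∫ s, 2 * heav n s * rho n s = 1 := by
  obtain ⟨C, hC⟩ := rho_bounded n
  have hi : Integrable fun s => 2 * heav n s * rho n s :=
    (rho_integrable n).bdd_mul (c := 2) ((heav_contDiff n).continuous.const_mul
      2).aestronglyMeasurable (Eventually.of_forall fun s => by
        rw [Real.norm_of_nonneg (by linarith [heav_nonneg n s])]; linarith [heav_le_one n s])
  have hd : ∀ s, HasDerivAt (fun s => heav n s ^ 2) (2 * heav n s * rho n s) s := fun s => by
    simpa using (heav_hasDerivAt n s).fun_pow 2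
  have hb : Tendsto (fun s => heav n s ^ 2) atBot (𝓝 0) := by
    refine tendsto_const_nhds.congr' ?_
    filter_upwards [eventually_le_atBot (-rad n)] with s hs
    rw [heav_eq_zero hs]; norm_num
  have ht : Tendsto (fun s => heav n s ^ 2) atTop (𝓝 1) := by
    refine tendsto_const_nhds.congr' ?_
    filter_upwards [eventually_ge_atTop (rad n)] with s hs
    rw [heav_eq_one hs]; norm_num
  rw [integral_of_hasDerivAt_of_tendsto hd hi hb ht]; norm_num

theorem one_sub_heav_mul_rho_integral (n : ℕ) : ∫ s, 2 * (1 - heav n s) * rho n s = 1 := by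
  have h1 := heav_mul_rho_integral n
  have hi : Integrable fun s => 2 * heav n s * rho n s := by
    by_contra h
    rw [integral_undef h] at h1; norm_num at h1
  have : ∫ s, 2 * (1 - heav n s) * rho n s = 2 * (∫ s, rho n s) - ∫ s, 2 * heav n s * rho n s := by
    rw [← integral_const_mul, ← integral_sub ((rho_integrable n).const_mul 2) hi]
    exact integral_congr_ae (Eventually.of_forall fun s => by simp only; ring)
  rw [this, h1, rho_integral]; norm_num

/-- The Kato inequality carries the time weight `θ θ'`. As the rise and the fall do not overlap,
twice this weight is a kernel of unit mass near `t₁` minus one near `t₂`. -/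
theorem ramp_mul_deriv {n : ℕ} {t₁ t₂ : ℝ} (h : t₁ + 2 * rad n ≤ t₂) (t : ℝ) :
    2 * (ramp n t₁ t₂ t * deriv (ramp n t₁ t₂) t) =
      2 * heav n (t - t₁) * rho n (t - t₁) - 2 * (1 - heav n (t - t₂)) * rho n (t - t₂) := by
  rw [(ramp_hasDerivAt n t₁ t₂ t).deriv, ramp]
  have e1 : rho n (t - t₁) = 0 ∨ heav n (t - t₂) = 0 := by
    rcases le_total (t₁ + rad n) t with h' | h'
    · left; exact rho_eq_zero (by rw [abs_of_nonneg] <;> linarith [rad_pos n])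
    · right; exact heav_eq_zero (by linarith)
  have e2 : rho n (t - t₂) = 0 ∨ heav n (t - t₁) = 1 := by
    rcases le_total t (t₂ - rad n) with h' | h'
    · left; exact rho_eq_zero (by rw [abs_of_nonpos] <;> linarith [rad_pos n])
    · right; exact heav_eq_one (by linarith)
  rcases e1 with e1 | e1 <;> rcases e2 with e2 | e2 <;> rw [e1, e2] <;> ring

/-- Weights concentrating in the interior of an interval. -/
theorem tendsto_setIntegral_interior {T t₀ : ℝ} (ht : t₀ ∈ Ioo 0 T) {m : ℝ → ℝ}
    (hm : ContinuousOn m (Icc 0 T)) {k : ℕ → ℝ → ℝ} (hk0 : ∀ n t, 0 ≤ k n t)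
    (hkz : ∀ n s, rad n ≤ |s| → k n s = 0) (hkc : ∀ n, Continuous (k n))
    (hk1 : ∀ n, ∫ s, k n s = 1) :
    Tendsto (fun n => ∫ t in Ioo 0 T, k n (t - t₀) * m t) atTop (𝓝 (m t₀)) := by
  refine tendsto_setIntegral_weight measurableSet_Ioo (by simp)
    ((hm t₀ (Ioo_subset_Icc_self ht)).mono Ioo_subset_Icc_self)
    (hm.integrableOn_Icc.mono_set Ioo_subset_Icc_self) tendsto_rad (fun n t => hk0 _ _)
    (fun n t h => hkz _ _ h) (fun n => (hkc n).comp (continuous_id.sub continuous_const)) ?_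
  filter_upwards [tendsto_rad.eventually (gt_mem_nhds ht.1),
    tendsto_rad.eventually (gt_mem_nhds (sub_pos.2 ht.2))] with n h1 h2
  rw [setIntegral_eq_integral_of_forall_compl_eq_zero, integral_sub_right_eq_self (k n), hk1]
  intro t ht'
  refine hkz _ _ ?_
  by_contra hlt
  have := abs_lt.1 (not_le.1 hlt)
  exact ht' ⟨by linarith, by linarith⟩

section Contraction

variable {a T : ℝ} {f u₀₁ w₀₁ u₀₂ w₀₂ : ℝ → ℝ} {u₁ w₁ u₂ w₂ : ℝ → ℝ → ℝ}

theorem continuousOn_dist (h₁ : IsEntropyWeakSolution a T f u₀₁ w₀₁ u₁ w₁)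
    (h₂ : IsEntropyWeakSolution a T f u₀₂ w₀₂ u₂ w₂) {R : ℝ} {ψ : ℝ → ℝ}
    (hψ : IsCutoff (Ioo (-R) R) ψ) :
    ContinuousOn (fun t => ∫ x, (|u₁ x t - u₂ x t| + |w₁ x t - w₂ x t|) * ψ x) (Ico 0 T) := by
  refine ((h₁.cont_u.continuousOn_integral h₂.cont_u hψ).add
    (h₁.cont_w.continuousOn_integral h₂.cont_w hψ)).congr fun t ht => ?_
  rw [Pi.add_apply, ← integral_add (h₁.cont_u.integrable_mul_cutoff h₂.cont_u ht hψ)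
    (h₁.cont_w.integrable_mul_cutoff h₂.cont_w ht hψ)]
  simp only [add_mul]

/-- The Kato inequality with a time ramp: in the limit, `2 θ θ'` becomes a point mass at `t₁` minus
one at `t₂`, evaluated by continuity in time. The flux term is bounded by its absolute value, with
the other cutoff factors at most `1`. -/
theorem dist_le_dist_add (h₁ : IsEntropyWeakSolution a T f u₀₁ w₀₁ u₁ w₁)
    (h₂ : IsEntropyWeakSolution a T f u₀₂ w₀₂ u₂ w₂) (hf : ConvexFlux f) (ha : 0 ≤ a)
    {R T' t₁ t₂ : ℝ} (hT' : T' < T) (ht₁ : 0 < t₁) (ht : t₁ < t₂) (ht₂ : t₂ < T') {ψ : ℝ → ℝ}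
    (hψ : IsCutoff (Ioo (-R) R) ψ) (hψ1 : ∀ x, ψ x ≤ 1) :
    ∫ x, (|u₁ x t₂ - u₂ x t₂| + |w₁ x t₂ - w₂ x t₂|) * ψ x ^ 2 ≤
      (∫ x, (|u₁ x t₁ - u₂ x t₁| + |w₁ x t₁ - w₂ x t₁|) * ψ x ^ 2) +
      2 * ∫ p in box R T', |f (u₁ p.1 p.2) - f (u₂ p.1 p.2)| * |deriv ψ p.1| := by
  have s₁ := h₁.stripSolution ha hT'
  have s₂ := h₂.stripSolution ha hT'
  have hψ2 : IsCutoff (Ioo (-R) R) fun x => ψ x ^ 2 := by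
    simpa only [sq] using hψ.mul_right hψ.contDiff hψ.nonneg
  set m : ℝ → ℝ := fun t => ∫ x, (|u₁ x t - u₂ x t| + |w₁ x t - w₂ x t|) * ψ x ^ 2 with hm
  have hmc : ContinuousOn m (Icc 0 T') :=
    (continuousOn_dist h₁ h₂ hψ2).mono fun t ht => ⟨ht.1, ht.2.trans_lt hT'⟩
  have cρ := rho_continuous
  have ch := fun n => (heav_contDiff n).continuous
  have l1 := tendsto_setIntegral_interior (T := T') ⟨ht₁, ht.trans ht₂⟩ hmc
    (k := fun n s => 2 * heav n s * rho n s)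
    (fun n t => mul_nonneg (mul_nonneg zero_le_two (heav_nonneg _ _)) (rho_nonneg _ _))
    (fun n s h => by rw [rho_eq_zero h, mul_zero])
    (fun n => ((ch n).const_mul 2).mul (cρ n)) heav_mul_rho_integral
  have l2 := tendsto_setIntegral_interior (T := T') ⟨ht₁.trans ht, ht₂⟩ hmc
    (k := fun n s => 2 * (1 - heav n s) * rho n s)
    (fun n t => mul_nonneg (mul_nonneg zero_le_two (sub_nonneg.2 (heav_le_one _ _)))
      (rho_nonneg _ _))
    (fun n s h => by rw [rho_eq_zero h, mul_zero])
    (fun n => ((continuous_const.sub (ch n)).const_mul 2).mul (cρ n)) one_sub_heav_mul_rho_integral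
  have l3 := l2.sub l1
  have hgoal : m t₂ - m t₁ ≤
      2 * ∫ p in box R T', |f (u₁ p.1 p.2) - f (u₂ p.1 p.2)| * |deriv ψ p.1| := by
    refine le_of_tendsto l3 ?_
    filter_upwards [tendsto_rad.eventually (gt_mem_nhds ht₁),
      tendsto_rad.eventually (gt_mem_nhds (sub_pos.2 ht₂)),
      tendsto_rad.eventually (gt_mem_nhds (show 0 < (t₂ - t₁) / 2 by linarith))] with n n1 n2 n3
    have hθ : IsCutoff (Ioo 0 T') (ramp n t₁ t₂) := ramp_isCutoff n1 (by linarith)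
    have key := s₁.kato s₂ hf hψ hθ
    obtain ⟨C, hC⟩ := hψ.bounded
    obtain ⟨D, hD⟩ := hθ.bounded
    have iη : IntegrableOn (fun p : ℝ × ℝ => |u₁ p.1 p.2 - u₂ p.1 p.2| + |w₁ p.1 p.2 - w₂ p.1 p.2|)
        (box R T') :=
      (((s₁.integrable_u R).integrable.sub (s₂.integrable_u R).integrable).abs).add
        (((s₁.integrable_w R).integrable.sub (s₂.integrable_w R).integrable).abs)
    have cθθ : Continuous fun t => ramp n t₁ t₂ t * deriv (ramp n t₁ t₂) t :=
      hθ.continuous.mul hθ.continuous_deriv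
    have bθθ : ∀ t, ‖ramp n t₁ t₂ t * deriv (ramp n t₁ t₂) t‖ ≤ D * D := fun t => by
      rw [norm_mul]
      exact mul_le_mul (hD t).1 (hD t).2 (norm_nonneg _) ((norm_nonneg _).trans (hD t).1)
    obtain ⟨C2, hC2⟩ := hψ2.bounded
    have j1 := integrable_mul_weight iη hψ2.continuous cθθ (fun x => (hC2 x).1) bθθ
    have iF : IntegrableOn (fun p => |f (u₁ p.1 p.2) - f (u₂ p.1 p.2)| * |deriv ψ p.1|)
        (box R T') :=
      (((s₁.flux R).integrable.sub (s₂.flux R).integrable).abs).mul_bdd (c := C)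
        (hψ.continuous_deriv.comp continuous_fst).abs.aestronglyMeasurable
        (Eventually.of_forall fun p => by simpa using (hC p.1).2)
    have e1 := integral_box_slice iη hψ2 cθθ bθθ
    have e2 : 2 * ∫ t in Ioo 0 T', (ramp n t₁ t₂ t * deriv (ramp n t₁ t₂) t) * m t =
        (∫ t in Ioo 0 T', 2 * heav n (t - t₁) * rho n (t - t₁) * m t) -
        ∫ t in Ioo 0 T', 2 * (1 - heav n (t - t₂)) * rho n (t - t₂) * m t := by
      have ii : ∀ g : ℝ → ℝ, Continuous g → IntegrableOn (fun t => g t * m t) (Ioo 0 T') :=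
        fun g hg => ((hg.continuousOn.mul hmc).integrableOn_Icc).mono_set Ioo_subset_Icc_self
      have chn := ch n
      have cρn := cρ n
      have c1 : Continuous fun t => 2 * heav n (t - t₁) * rho n (t - t₁) := by fun_prop
      have c2 : Continuous fun t => 2 * (1 - heav n (t - t₂)) * rho n (t - t₂) := by fun_prop
      rw [← integral_const_mul, ← integral_sub (ii _ c1) (ii _ c2)]
      refine integral_congr_ae (Eventually.of_forall fun t => ?_)
      simp only
      rw [← mul_assoc, ramp_mul_deriv (by linarith)]; ring
    have hup : ∫ p in box R T', ((|u₁ p.1 p.2 - u₂ p.1 p.2| + |w₁ p.1 p.2 - w₂ p.1 p.2|) *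
          (ψ p.1 ^ 2 * (ramp n t₁ t₂ p.2 * deriv (ramp n t₁ t₂) p.2))
        + Real.sign (u₁ p.1 p.2 - u₂ p.1 p.2) * (f (u₁ p.1 p.2) - f (u₂ p.1 p.2)) *
          (ψ p.1 * deriv ψ p.1 * ramp n t₁ t₂ p.2 ^ 2)) ≤
        (∫ p in box R T', (|u₁ p.1 p.2 - u₂ p.1 p.2| + |w₁ p.1 p.2 - w₂ p.1 p.2|) *
          (ψ p.1 ^ 2 * (ramp n t₁ t₂ p.2 * deriv (ramp n t₁ t₂) p.2))) +
        ∫ p in box R T', |f (u₁ p.1 p.2) - f (u₂ p.1 p.2)| * |deriv ψ p.1| := by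
      have hpt : ∀ p : ℝ × ℝ, |Real.sign (u₁ p.1 p.2 - u₂ p.1 p.2) *
          (f (u₁ p.1 p.2) - f (u₂ p.1 p.2)) * (ψ p.1 * deriv ψ p.1 * ramp n t₁ t₂ p.2 ^ 2)| ≤
          |f (u₁ p.1 p.2) - f (u₂ p.1 p.2)| * |deriv ψ p.1| := fun p => by
        have b1 : |Real.sign (u₁ p.1 p.2 - u₂ p.1 p.2)| ≤ 1 := by
          rcases Real.sign_apply_eq (u₁ p.1 p.2 - u₂ p.1 p.2) with h | h | h <;> rw [h] <;> norm_num
        have b2 : ψ p.1 * ramp n t₁ t₂ p.2 ^ 2 ≤ 1 :=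
          mul_le_one₀ (hψ1 _) (sq_nonneg _) (pow_le_one₀ (ramp_nonneg _ _ _ _) (ramp_le_one _ _ _ _))
        have b0 : 0 ≤ ψ p.1 * ramp n t₁ t₂ p.2 ^ 2 := mul_nonneg (hψ.nonneg _) (sq_nonneg _)
        calc _ = |Real.sign (u₁ p.1 p.2 - u₂ p.1 p.2)| * (ψ p.1 * ramp n t₁ t₂ p.2 ^ 2) *
              (|f (u₁ p.1 p.2) - f (u₂ p.1 p.2)| * |deriv ψ p.1|) := by
              rw [← abs_of_nonneg b0, ← abs_mul, ← abs_mul, ← abs_mul]; congr 1; ring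
          _ ≤ _ := mul_le_of_le_one_left (by positivity) (mul_le_one₀ b1 b0 b2)
      have hsign : Measurable Real.sign :=
        Measurable.ite measurableSet_Iio measurable_const
          (Measurable.ite measurableSet_Ioi measurable_const measurable_const)
      have iS : IntegrableOn (fun p : ℝ × ℝ => Real.sign (u₁ p.1 p.2 - u₂ p.1 p.2) *
          (f (u₁ p.1 p.2) - f (u₂ p.1 p.2)) * (ψ p.1 * deriv ψ p.1 * ramp n t₁ t₂ p.2 ^ 2))
          (box R T') := by
        refine Integrable.mono' iF ?_ (Eventually.of_forall hpt)
        have c0 : Continuous fun p : ℝ × ℝ => ψ p.1 * deriv ψ p.1 * ramp n t₁ t₂ p.2 ^ 2 :=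
          ((hψ.continuous.comp continuous_fst).mul
            (hψ.continuous_deriv.comp continuous_fst)).mul
            ((hθ.continuous.comp continuous_snd).pow 2)
        exact ((hsign.comp_aemeasurable ((s₁.meas_box R).1.sub
          (s₂.meas_box R).1).aemeasurable).aestronglyMeasurable.mul
          ((s₁.flux R).1.sub (s₂.flux R).1)).mul c0.aestronglyMeasurable
      rw [integral_add j1 iS]
      exact add_le_add_right (integral_mono iS iF fun p => (le_abs_self _).trans (hpt p)) _
    rw [e1] at hup
    simp only [hm] at e2
    linarith
  linarith

/-- The `L¹` contraction at positive times. -/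
theorem contraction_of_pos (h₁ : IsEntropyWeakSolution a T f u₀₁ w₀₁ u₁ w₁)
    (h₂ : IsEntropyWeakSolution a T f u₀₂ w₀₂ u₂ w₂) (hf : ConvexFlux f) (ha : 0 ≤ a)
    (h₀ : ∀ᵐ x, (u₁ x 0 = u₀₁ x ∧ w₁ x 0 = w₀₁ x) ∧ (u₂ x 0 = u₀₂ x ∧ w₂ x 0 = w₀₂ x))
    (hi : Integrable fun x => |u₀₁ x - u₀₂ x| + |w₀₁ x - w₀₂ x|) {t : ℝ} (ht : t ∈ Ioo 0 T) :
    Integrable (fun x => |u₁ x t - u₂ x t| + |w₁ x t - w₂ x t|) ∧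
      ∫ x, (|u₁ x t - u₂ x t| + |w₁ x t - w₂ x t|) ≤ ∫ x, (|u₀₁ x - u₀₂ x| + |w₀₁ x - w₀₂ x|) := by
  obtain ⟨T', ht', hT'⟩ := exists_between ht.2
  have ht0 : t ∈ Ico 0 T := ⟨ht.1.le, ht.2⟩
  have hT'0 : 0 ≤ T' := ht.1.le.trans ht'.le
  have s₁ := h₁.stripSolution ha hT'
  have s₂ := h₂.stripSolution ha hT'
  have hE : ∀ v z : ℝ → ℝ, 0 ≤ (∫ x, v x ^ 2) + ∫ x, z x ^ 2 := fun v z =>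
    add_nonneg (integral_nonneg fun x => sq_nonneg _) (integral_nonneg fun x => sq_nonneg _)
  obtain ⟨C₁, hC₁⟩ := s₁.flux_tail hf ha hT'0 (hE _ _)
  obtain ⟨C₂, hC₂⟩ := s₂.flux_tail hf ha hT'0 (hE _ _)
  obtain ⟨K, hK0, hK⟩ := exists_abs_deriv_cut_le
  set I := ∫ x, (|u₀₁ x - u₀₂ x| + |w₀₁ x - w₀₂ x|) with hI
  have hl : LocallyIntegrable fun x => |u₁ x t - u₂ x t| + |w₁ x t - w₂ x t| := by
    have h1 : LocallyIntegrable fun x => |u₁ x t - u₂ x t| := fun x =>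
      ((h₁.cont_u.locallyIntegrable t ht0).sub (h₂.cont_u.locallyIntegrable t ht0) x).norm
    have h2 : LocallyIntegrable fun x => |w₁ x t - w₂ x t| := fun x =>
      ((h₁.cont_w.locallyIntegrable t ht0).sub (h₂.cont_w.locallyIntegrable t ht0) x).norm
    exact h1.add h2
  have main : ∀ N : ℝ, 1 ≤ N → ∫ x in Ioo (-N ^ 2) (N ^ 2),
      (|u₁ x t - u₂ x t| + |w₁ x t - w₂ x t|) ≤ I + 2 * (K * (C₁ + C₂)) / N := fun N hN => by
    have hN0 : 0 < N := by linarith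
    set ψ := cut (2 * N ^ 2) with hψd
    have hψ : IsCutoff (Ioo (-((2 * N) ^ 2)) ((2 * N) ^ 2)) ψ :=
      cut_isCutoff (by positivity) (by nlinarith)
    have hψ1 : ∀ x, ψ x ≤ 1 := cut_le_one _
    have hψ2 : IsCutoff (Ioo (-((2 * N) ^ 2)) ((2 * N) ^ 2)) fun x => ψ x ^ 2 := by
      simpa only [sq] using hψ.mul_right hψ.contDiff hψ.nonneg
    have hψ21 : ∀ x, ψ x ^ 2 ≤ 1 := fun x => pow_le_one₀ (hψ.nonneg x) (hψ1 x)
    -- The same constant `f 0` is subtracted from both fluxes. By `flux_tail` the integral is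
    -- `O(N)`, and the cutoff derivative is `O(N⁻²)`.
    have hX : ∫ p in box ((2 * N) ^ 2) T', |f (u₁ p.1 p.2) - f (u₂ p.1 p.2)| * |deriv ψ p.1| ≤
        K * (C₁ + C₂) / N := by
      have j₁ := ((s₁.flux ((2 * N) ^ 2)).integrable.sub (integrable_const (f 0))).abs
      have j₂ := ((s₂.flux ((2 * N) ^ 2)).integrable.sub (integrable_const (f 0))).abs
      calc _ ≤ ∫ p in box ((2 * N) ^ 2) T', (|f (u₁ p.1 p.2) - f 0| + |f (u₂ p.1 p.2) - f 0|) *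
            (K / (2 * N ^ 2)) := by
            refine integral_mono_of_nonneg (Eventually.of_forall fun p => by positivity)
              ((j₁.add j₂).mul_const _) (Eventually.of_forall fun p => ?_)
            refine mul_le_mul ?_ (hK _ _ (by positivity)) (abs_nonneg _) (by positivity)
            rw [abs_sub_comm (f (u₂ p.1 p.2))]
            exact abs_sub_le _ _ _
        _ = ((∫ p in box ((2 * N) ^ 2) T', |f (u₁ p.1 p.2) - f 0|) +
              ∫ p in box ((2 * N) ^ 2) T', |f (u₂ p.1 p.2) - f 0|) * (K / (2 * N ^ 2)) := by
            rw [integral_mul_const]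
            congr 1
            exact integral_add j₁ j₂
        _ ≤ (C₁ * (2 * N) + C₂ * (2 * N)) * (K / (2 * N ^ 2)) :=
            mul_le_mul_of_nonneg_right (add_le_add (hC₁ _ (by linarith)) (hC₂ _ (by linarith)))
              (by positivity)
        _ = _ := by field_simp
    have hcont := continuousOn_dist h₁ h₂ hψ2
    -- The comparison holds between positive times; the earlier one is sent to `0` by continuity in
    -- time.
    have h0lim : ∫ x, (|u₁ x t - u₂ x t| + |w₁ x t - w₂ x t|) * ψ x ^ 2 ≤
        (∫ x, (|u₁ x 0 - u₂ x 0| + |w₁ x 0 - w₂ x 0|) * ψ x ^ 2) + 2 * (K * (C₁ + C₂) / N) := by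
      have hlim : Tendsto (fun s => (∫ x, (|u₁ x s - u₂ x s| + |w₁ x s - w₂ x s|) * ψ x ^ 2) +
          2 * (K * (C₁ + C₂) / N)) (𝓝[Ioo 0 t] 0)
          (𝓝 ((∫ x, (|u₁ x 0 - u₂ x 0| + |w₁ x 0 - w₂ x 0|) * ψ x ^ 2)
            + 2 * (K * (C₁ + C₂) / N))) :=
        ((hcont 0 ⟨le_rfl, ht.1.trans ht.2⟩).mono fun s hs => ⟨hs.1.le, hs.2.trans ht.2⟩).add_const _
      have : (𝓝[Ioo 0 t] (0 : ℝ)).NeBot := left_nhdsWithin_Ioo_neBot ht.1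
      refine ge_of_tendsto hlim ?_
      filter_upwards [self_mem_nhdsWithin] with s hs
      have := dist_le_dist_add h₁ h₂ hf ha hT' hs.1 hs.2 ht' hψ hψ1
      linarith
    have hle0 : ∫ x, (|u₁ x 0 - u₂ x 0| + |w₁ x 0 - w₂ x 0|) * ψ x ^ 2 ≤ I := by
      refine integral_mono_of_nonneg (Eventually.of_forall fun x => by positivity) hi ?_
      filter_upwards [h₀] with x hx
      rw [hx.1.1, hx.1.2, hx.2.1, hx.2.2]
      exact mul_le_of_le_one_right (by positivity) (hψ21 x)
    have hge : ∫ x in Ioo (-N ^ 2) (N ^ 2), (|u₁ x t - u₂ x t| + |w₁ x t - w₂ x t|) ≤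
        ∫ x, (|u₁ x t - u₂ x t| + |w₁ x t - w₂ x t|) * ψ x ^ 2 := by
      have hint : Integrable fun x => (|u₁ x t - u₂ x t| + |w₁ x t - w₂ x t|) * ψ x ^ 2 :=
        (hl.integrable_smul_left_of_hasCompactSupport hψ2.continuous
          hψ2.hasCompactSupport).congr (Eventually.of_forall fun x => by
            simp only [smul_eq_mul]; ring)
      calc _ = ∫ x in Ioo (-N ^ 2) (N ^ 2), (|u₁ x t - u₂ x t| + |w₁ x t - w₂ x t|) * ψ x ^ 2 := by
            refine setIntegral_congr_fun measurableSet_Ioo fun x hx => ?_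
            have : ψ x = 1 := cut_eq_one (by positivity) (by
              have := abs_lt.2 ⟨by linarith [hx.1], hx.2⟩; linarith)
            simp only [this]; ring
        _ ≤ _ := setIntegral_le_integral hint (Eventually.of_forall fun x => by
            simp only [Pi.zero_apply]; positivity)
    have : 2 * (K * (C₁ + C₂)) / N = 2 * (K * (C₁ + C₂) / N) := by ring
    linarith
  have hN : Tendsto (fun j : ℕ => ((j : ℝ) + 1)) atTop atTop :=
    tendsto_natCast_atTop_atTop.atTop_add tendsto_const_nhds
  have hN2 : Tendsto (fun j : ℕ => ((j : ℝ) + 1) ^ 2) atTop atTop :=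
    (tendsto_pow_atTop two_ne_zero).comp hN
  -- The bounds on these exhausting intervals are uniform, which proves integrability on the line
  -- before the limit of the integrals is taken.
  have cover : AECover volume atTop fun j : ℕ => Ioo (-((j : ℝ) + 1) ^ 2) (((j : ℝ) + 1) ^ 2) :=
    aecover_Ioo (tendsto_neg_atTop_atBot.comp hN2) hN2
  have hlimI : Tendsto (fun j : ℕ => I + 2 * (K * (C₁ + C₂)) / ((j : ℝ) + 1)) atTop (𝓝 I) := by
    simpa using (hN.const_div_atTop (2 * (K * (C₁ + C₂)))).const_add I
  have hle : ∀ j : ℕ, ∫ x in Ioo (-((j : ℝ) + 1) ^ 2) (((j : ℝ) + 1) ^ 2),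
      (|u₁ x t - u₂ x t| + |w₁ x t - w₂ x t|) ≤ I + 2 * (K * (C₁ + C₂)) / ((j : ℝ) + 1) :=
    fun j => main _ (by linarith [(Nat.cast_nonneg j : (0:ℝ) ≤ j)])
  have hion : ∀ j : ℕ, IntegrableOn (fun x => |u₁ x t - u₂ x t| + |w₁ x t - w₂ x t|)
      (Ioo (-((j : ℝ) + 1) ^ 2) (((j : ℝ) + 1) ^ 2)) := fun j =>
    (hl.integrableOn_isCompact isCompact_Icc).mono_set Ioo_subset_Icc_self
  obtain ⟨B, hB⟩ := hlimI.bddAbove_range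
  have hint : Integrable fun x => |u₁ x t - u₂ x t| + |w₁ x t - w₂ x t| :=
    cover.integrable_of_integral_bounded_of_nonneg_ae B hion
      (Eventually.of_forall fun x => by positivity)
      (Eventually.of_forall fun j => (hle j).trans (hB ⟨j, rfl⟩))
  exact ⟨hint, le_of_tendsto_of_tendsto' (cover.integral_tendsto_of_countably_generated hint)
    hlimI hle⟩

end Contraction

end PlayHysteresis

theorem mainTheorem2 (a T : ℝ) (ha : 0 < a) (hT : 0 < T)
    (f : ℝ → ℝ) (hf : ContDiff ℝ 2 f) (hfconv : StrictConvexOn ℝ univ f)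
    (u₀₁ w₀₁ u₀₂ w₀₂ : ℝ → ℝ)
    (hu₀₁ : PlayHysteresis.MemL1BV u₀₁) (hw₀₁ : PlayHysteresis.MemL1BV w₀₁)
    (hu₀₂ : PlayHysteresis.MemL1BV u₀₂) (hw₀₂ : PlayHysteresis.MemL1BV w₀₂)
    (h₀₁ : ∀ᵐ x, (u₀₁ x, w₀₁ x) ∈ PlayHysteresis.strip a)
    (h₀₂ : ∀ᵐ x, (u₀₂ x, w₀₂ x) ∈ PlayHysteresis.strip a)
    (u₁ w₁ u₂ w₂ : ℝ → ℝ → ℝ)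
    (hsol₁ : PlayHysteresis.IsEntropyWeakSolution a T f u₀₁ w₀₁ u₁ w₁)
    (hsol₂ : PlayHysteresis.IsEntropyWeakSolution a T f u₀₂ w₀₂ u₂ w₂) :
    (∀ᵐ t ∂(volume.restrict (Ico 0 T)),
      Integrable (fun x => |u₁ x t - u₂ x t| + |w₁ x t - w₂ x t|) ∧
      ∫ x, (|u₁ x t - u₂ x t| + |w₁ x t - w₂ x t|)
        ≤ ∫ x, (|u₀₁ x - u₀₂ x| + |w₀₁ x - w₀₂ x|)) ∧
    (u₀₁ =ᵐ[volume] u₀₂ → w₀₁ =ᵐ[volume] w₀₂ →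
      ∀ t ∈ Ico 0 T, (fun x => u₁ x t) =ᵐ[volume] (fun x => u₂ x t) ∧
        (fun x => w₁ x t) =ᵐ[volume] (fun x => w₂ x t)) := by

  have hflux : PlayHysteresis.ConvexFlux f := ⟨hf.of_le (by norm_num), hfconv.convexOn⟩
  have i₁ := hsol₁.initial hflux ha.le hT hu₀₁.1 hw₀₁.1 h₀₁
  have i₂ := hsol₂.initial hflux ha.le hT hu₀₂.1 hw₀₂.1 h₀₂
  have hi : Integrable fun x => |u₀₁ x - u₀₂ x| + |w₀₁ x - w₀₂ x| :=
    ((hu₀₁.1.sub hu₀₂.1).abs).add ((hw₀₁.1.sub hw₀₂.1).abs)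
  -- Continuity in time gives the estimate at every `t`. At `t = 0` it is an equality because the
  -- initial data are attained.
  have hall : ∀ t ∈ Ico 0 T, Integrable (fun x => |u₁ x t - u₂ x t| + |w₁ x t - w₂ x t|) ∧
      ∫ x, (|u₁ x t - u₂ x t| + |w₁ x t - w₂ x t|)
        ≤ ∫ x, (|u₀₁ x - u₀₂ x| + |w₀₁ x - w₀₂ x|) := by
    intro t ht
    rcases ht.1.eq_or_lt with rfl | h0
    · have e : (fun x => |u₀₁ x - u₀₂ x| + |w₀₁ x - w₀₂ x|) =ᵐ[volume]
          fun x => |u₁ x 0 - u₂ x 0| + |w₁ x 0 - w₂ x 0| := by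
        filter_upwards [i₁, i₂] with x h1 h2
        rw [h1.1, h1.2, h2.1, h2.2]
      exact ⟨hi.congr e, (integral_congr_ae e).ge⟩
    · exact PlayHysteresis.contraction_of_pos hsol₁ hsol₂ hflux ha.le (i₁.and i₂) hi ⟨h0, ht.2⟩
  refine ⟨(ae_restrict_mem measurableSet_Ico).mono hall, fun hu hw t ht => ?_⟩
  obtain ⟨h1, h2⟩ := hall t ht
  have hz : ∫ x, (|u₀₁ x - u₀₂ x| + |w₀₁ x - w₀₂ x|) = 0 := by
    refine integral_eq_zero_of_ae ?_
    filter_upwards [hu, hw] with x e1 e2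
    simp [e1, e2]
  rw [hz] at h2
  have h3 := (integral_eq_zero_iff_of_nonneg (fun x => by positivity) h1).1
    (le_antisymm h2 (integral_nonneg fun x => by positivity))
  constructor <;> filter_upwards [h3] with x hx
  all_goals
    simp only [Pi.zero_apply] at hx
    have a1 := abs_nonneg (u₁ x t - u₂ x t)
    have a2 := abs_nonneg (w₁ x t - w₂ x t)
  · exact sub_eq_zero.1 (abs_eq_zero.1 (by linarith))
  · exact sub_eq_zero.1 (abs_eq_zero.1 (by linarith))
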